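/- \textbf{Setting.} On $\{0,1\}^{\mathbb Z}$ let $\sigma$ be the left shift, $\mathcal O(x)=\{\sigma^n x:n\in\mathbb Z\}$, $X_x=\overline{\mathcal O(x)}$ (closure in the product topology), and let $d_1(x,y)=\limsup_{n\to\infty}\frac1{2n+1}\#\{|i|\le n:x_i\ne y_i\}$ be the Besicovitch pseudo-metric. For $X\subseteq\{0,1\}^{\mathbb Z}$ let $\mathcal N_\epsilon(X)$ be the smallest number of open $d_1$-balls of radius $\epsilon$, centred at points of $X$, that cover $X$. The set $X$ has amorphic complexity $\alpha\in[0,\infty]$ if, as $\epsilon\to0^+$, $\mathcal N_\epsilon(X)\,\epsilon^t\to0$ for all real $t>\alpha$ and $\mathcal N_\epsilon(X)\,\epsilon^t\to\infty$ for all real $t<\alpha$. For $F,G$ defined on $(0,\infty)$ write $F\approx G$ if there is $M>0$ with $F(M\epsilon)\le G(\epsilon)\le F(M^{-1}\epsilon)$ for all $\epsilon>0$. Two sequences $x,y$ are block code equivalent if each is the image of the other under some (sliding) block code $(F_{\mathcal C}v)_i=\mathcal C(v_{i-m}\dots v_{i+m})$. Let $3\le c_1<c_2<\dots$ be pairwise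 coprime odd integers. For non-negative integers $r_1,r_2,\dots$ put $\mathcal B=\{2^{r_i}c_i:i\ge1\}$, let $\eta=\eta_{c,r}$ be the indicator function of the set of integers that are not divisible by any $b\in\mathcal B$, and let $G_{\mathcal B}$ be the closure of $\{(n \bmod b)_{b\in\mathcal B}:n\in\mathbb Z\}$ in $\prod_{b\in\mathcal B}\mathbb Z/b\mathbb Z$, with the rotation by $(1,1,\dots)$. \textbf{Statement.} (0) Let $r_i\to\infty$ (for instance $r_1<r_2<\dots$, or $r$ as in (a) or (b) below). Then $\eta$ is a regular Toeplitz sequence; $(X_\eta,\sigma)$ is minimal with topological entropy $0$; $\mathcal N_\epsilon(\mathcal O(\eta))$ and $\mathcal N_\epsilon(X_\eta)$ are finite for all $\epsilon>0$; the rotation on $G_{\mathcal B}$ is the maximal equicontinuous factor (MEF) of $(X_\eta,\sigma)$, and the factor map is a measurable isomorphism with respect to the unique invariant probability measures of the two systems; there is an isomorphism of topological groups $G_{\mathcal B}\cong\mathbb Z_2\times\prod_{i\ge1}\mathbb Z/c_i\mathbb Z$, where $\mathbb Z_2$ is the group of $2$-adic integers, that sends $(1,1,\dots)$ to $(1,(1,1,\dots))$,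 so that for fixed $(c_i)$ all these MEFs are isomorphic; and the automorphism group of $(X_\eta,\sigma)$ is trivial, i.e. it equals $\{\sigma^n:n\in\mathbb Z\}\cong\mathbb Z$. Suppose in addition that $c_{n+1}=O\big((c_1\cdots c_n)^\gamma\big)$ for every $\gamma>0$. (a) If $r_i=i$ for all $i$, then $\mathcal O(\eta)$ and $X_\eta$ have infinite amorphic complexity. (b) If $\kappa>0$ and $r_i=\lfloor\kappa\log_2(c_1\cdots c_i)\rfloor$ for all $i$, then $\mathcal O(\eta)$ and $X_\eta$ have amorphic complexity $\frac{1+\kappa}{\kappa}$. (c) Consequently, if $\eta,\eta'$ are two of these sequences, one as in (a) and one as in (b), or both as in (b) with parameters $\kappa\ne\kappa'$ (the sequences $(c_i)$ and $(c'_i)$, both subject to the above assumptions, may be the same or different), then $\mathcal N_\bullet(\mathcal O(\eta))\not\approx\mathcal N_\bullet(\mathcal O(\eta'))$, $\eta$ and $\eta'$ are not block code equivalent, and the subshifts $X_\eta$ and $X_{\eta'}$ are not topologically conjugate. -/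

import Mathlib

open Filter Topology MeasureTheory
open SymbolicDynamics.FullShift (shift)

noncomputable section

namespace BFree

/-! ### Sequences, the shift, and orbit closures -/

section Shift

variable {A : Type*}

/-- The shift-orbit `{σⁿ x : n ∈ ℤ}` of a two-sided sequence. -/
def orbit (x : ℤ → A) : Set (ℤ → A) := Set.range fun n : ℤ => shift n x

variable [TopologicalSpace A]

/-- The left shift `σ`, `(σ x)_i = x_{1+i}`, as a homeomorphism of `A^ℤ`. -/
def shiftHomeo : (ℤ → A) ≃ₜ (ℤ → A) where
  toFun := shift 1
  invFun := shift (-1)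
  left_inv x := by ext i; simp
  right_inv x := by ext i; simp
  continuous_toFun := by fun_prop
  continuous_invFun := by fun_prop

/-- The closure of the orbit of `x` in the product topology. -/
def orbitClosure (x : ℤ → A) : Set (ℤ → A) := closure (orbit x)

theorem shiftHomeo_image_orbit (x : ℤ → A) : shiftHomeo '' orbit x = orbit x := by
  ext y
  constructor
  · rintro ⟨_, ⟨n, rfl⟩, rfl⟩
    refine ⟨n + 1, ?_⟩
    ext i
    simp [shiftHomeo, add_assoc]
  · rintro ⟨n, rfl⟩
    refine ⟨shift (n - 1) x, ⟨n - 1, rfl⟩, ?_⟩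
    ext i
    change x (n - 1 + (1 + i)) = x (n + i)
    congr 1
    ring

theorem mem_orbitClosure_iff (x y : ℤ → A) :
    y ∈ orbitClosure x ↔ shiftHomeo y ∈ orbitClosure x := by
  have h : shiftHomeo '' orbitClosure x = orbitClosure x := by
    rw [orbitClosure, shiftHomeo.image_closure, shiftHomeo_image_orbit]
  constructor
  · intro hy
    rw [← h]
    exact ⟨y, hy, rfl⟩
  · intro hy
    rw [← h] at hy
    obtain ⟨z, hz, hzy⟩ := hy
    rwa [← shiftHomeo.injective hzy]

/-- The subshift `(X_x, σ)`: the shift restricted to the orbit closure of `x`. -/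
def subshiftHomeo (x : ℤ → A) : orbitClosure x ≃ₜ orbitClosure x :=
  shiftHomeo.subtype (mem_orbitClosure_iff x)

instance [CompactSpace A] (x : ℤ → A) : CompactSpace (orbitClosure x) :=
  isCompact_iff_compactSpace.mp isClosed_closure.isCompact

end Shift

/-! ### Toeplitz sequences -/

section Toeplitz

variable {A : Type*}

/-- The positions at which `x` is `p`-periodic. -/
def perSet (x : ℤ → A) (p : ℕ) : Set ℤ := {n | ∀ k : ℤ, x (n + k * p) = x n}

/-- Every position of `x` is periodic for some period. -/
def IsToeplitz (x : ℤ → A) : Prop := ∀ n : ℤ, ∃ p : ℕ, 0 < p ∧ n ∈ perSet x p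

open Classical in
/-- A Toeplitz sequence is regular if the (rational) densities of the sets of `p`-periodic
positions have supremum `1`. -/
def IsRegularToeplitz (x : ℤ → A) : Prop :=
  IsToeplitz x ∧ ∀ δ : ℝ, 0 < δ → ∃ p : ℕ, 0 < p ∧
    1 - δ < (((Finset.Ico (0 : ℤ) p).filter (· ∈ perSet x p)).card : ℝ) / p

end Toeplitz

/-! ### The Besicovitch pseudo-metric, covering numbers, amorphic complexity -/

section Besicovitch

variable {A : Type*}

open Classical in
/-- The Besicovitch pseudo-metric
`d₁(x,y) = limsup_n #{|i| ≤ n : x_i ≠ y_i} / (2n+1)`. -/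
def d1 (x y : ℤ → A) : ℝ :=
  limsup (fun n : ℕ =>
    (((Finset.Icc (-(n : ℤ)) n).filter fun i => x i ≠ y i).card : ℝ) / (2 * n + 1)) atTop

/-- The smallest number (possibly `∞`) of open `d₁`-balls of radius `ε` centred at points of `X`
that cover `X`. -/
def covNum (X : Set (ℤ → A)) (ε : ℝ) : ℕ∞ :=
  ⨅ (C : Set (ℤ → A)) (_ : C ⊆ X ∧ ∀ x ∈ X, ∃ c ∈ C, d1 c x < ε), C.encard

/-- `ac(X) = α ∈ [0,∞]`: as `ε ↓ 0`, the quantity `N_ε(X) ε^t` tends to `0` for every real `t > α`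
and to `∞` for every real `t < α`. -/
def HasAmorphicComplexity (X : Set (ℤ → A)) (α : EReal) : Prop :=
  0 ≤ α ∧ ∀ t : ℝ,
    (α < t → Tendsto (fun ε : ℝ => (covNum X ε : ENNReal) * ENNReal.ofReal (ε ^ t))
      (𝓝[>] 0) (𝓝 0)) ∧
    (t < α → Tendsto (fun ε : ℝ => (covNum X ε : ENNReal) * ENNReal.ofReal (ε ^ t))
      (𝓝[>] 0) (𝓝 ⊤))

/-- The equivalence `F ≈ G` of functions on `(0,∞)`:
there is `M > 0` with `F(Mε) ≤ G(ε) ≤ F(ε/M)` for all `ε > 0`. -/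
def ScaleEquiv (F G : ℝ → ℕ∞) : Prop :=
  ∃ M : ℝ, 0 < M ∧ ∀ ε : ℝ, 0 < ε → F (M * ε) ≤ G ε ∧ G ε ≤ F (M⁻¹ * ε)

/-- The map `F_C` given by a block code `C` of length `2m+1`:
`(F_C v)_i = C(v_{i-m} … v_{i+m})`. -/
def applyCode {m : ℕ} (C : (Fin (2 * m + 1) → A) → A) (v : ℤ → A) : ℤ → A :=
  fun i => C fun j => v (i - m + (j : ℕ))

/-- `x` and `y` can be obtained from each other by block codes. -/
def BlockCodeEquiv (x y : ℤ → A) : Prop :=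
  (∃ (m : ℕ) (C : (Fin (2 * m + 1) → A) → A), applyCode C x = y) ∧
  (∃ (m : ℕ) (C : (Fin (2 * m + 1) → A) → A), applyCode C y = x)

end Besicovitch

/-! ### Topological dynamics of a homeomorphism -/

section Dynamics

universe u

variable {X Y : Type u} [TopologicalSpace X] [TopologicalSpace Y]

/-- Topological conjugacy. -/
def Conjugate (T : X ≃ₜ X) (S : Y ≃ₜ Y) : Prop :=
  ∃ h : X ≃ₜ Y, ∀ x, h (T x) = S (h x)

/-- Every orbit is dense (and the space is nonempty). -/
def IsMinimal (T : X ≃ₜ X) : Prop :=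
  Nonempty X ∧ ∀ x : X, Dense (Set.range fun n : ℤ => (T ^ n) x)

/-- The topological entropy of a compact Hausdorff system, w.r.t. its unique uniformity. -/
def topEntropy [CompactSpace X] [T2Space X] (T : X ≃ₜ X) : EReal :=
  @Dynamics.coverEntropy X uniformSpaceOfCompactR1 T Set.univ

/-- The automorphism group: all homeomorphisms commuting with `T`. -/
def autGroup (T : X ≃ₜ X) : Subgroup (X ≃ₜ X) := Subgroup.centralizer {T}

/-- The automorphism group consists of the powers of `T` only, and is isomorphic to `ℤ`. -/
def HasTrivialAut (T : X ≃ₜ X) : Prop :=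
  autGroup T = Subgroup.zpowers T ∧ Nonempty (autGroup T ≃* Multiplicative ℤ)

/-- `π` is a factor map from `(X,T)` onto `(Y,S)`. -/
def IsFactorMap (T : X ≃ₜ X) (S : Y ≃ₜ Y) (π : X → Y) : Prop :=
  Continuous π ∧ Function.Surjective π ∧ ∀ x, π (T x) = S (π x)

/-- `(Y,S)` is an equicontinuous compact Hausdorff system. -/
def IsEquicontinuousSystem (S : Y ≃ₜ Y) : Prop :=
  ∃ (_ : CompactSpace Y) (_ : T2Space Y),
    @Equicontinuous ℤ Y Y _ uniformSpaceOfCompactR1 (fun n => ⇑(S ^ n))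

/-- `π : (X,T) → (Y,S)` is the maximal equicontinuous factor: it is an equicontinuous factor, and
every equicontinuous factor of `(X,T)` factors through it. -/
def IsMEF (T : X ≃ₜ X) (S : Y ≃ₜ Y) (π : X → Y) : Prop :=
  IsFactorMap T S π ∧ IsEquicontinuousSystem S ∧
  ∀ (Z : Type u) [TopologicalSpace Z] (R : Z ≃ₜ Z) (ρ : X → Z),
    IsFactorMap T R ρ → IsEquicontinuousSystem R →
      ∃ q : Y → Z, IsFactorMap S R q ∧ q ∘ π = ρ

/-- `μ` is the unique invariant Borel probability measure of `T`. -/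
def IsUniqueInvariant [MeasurableSpace X] (T : X ≃ₜ X) (μ : Measure X) : Prop :=
  IsProbabilityMeasure μ ∧ MeasurePreserving T μ μ ∧
    ∀ μ' : Measure X, IsProbabilityMeasure μ' → MeasurePreserving T μ' μ' → μ' = μ

/-- `(X,T)` and `(Y,S)` are uniquely ergodic, and the map `π` is a measurable isomorphism
(modulo null sets) for the unique invariant Borel probability measures. -/
def IsMeasureIsoMap (T : X ≃ₜ X) (S : Y ≃ₜ Y) (π : X → Y) : Prop :=
  letI : MeasurableSpace X := borel X
  letI : MeasurableSpace Y := borel Y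
  ∃ (μ : Measure X) (ν : Measure Y), IsUniqueInvariant T μ ∧ IsUniqueInvariant S ν ∧
    MeasurePreserving π μ ν ∧
    ∃ g : Y → X, Measurable g ∧ (∀ᵐ x ∂μ, g (π x) = x) ∧ (∀ᵐ y ∂ν, π (g y) = y)

end Dynamics

/-! ### `𝓑`-free sequences and odometers -/

/-- The indicator sequence `η` of the `𝓑`-free integers, i.e. of the complement of
`⋃_{b ∈ 𝓑} bℤ`. -/
def eta (B : Set ℕ) : ℤ → Fin 2 :=
  open Classical in fun n => if ∀ b ∈ B, ¬ (b : ℤ) ∣ n then 1 else 0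

/-- The sequence `η` for `𝓑 = {2^{r_i} c_i}`. -/
def etaSeq (c r : ℕ → ℕ) : ℤ → Fin 2 := eta (Set.range fun i => 2 ^ r i * c i)

/-- The odometer group of `b`: the closure of the diagonal copy of `ℤ` in `∏ᵢ ℤ/bᵢℤ`. -/
abbrev odometer (b : ℕ → ℕ) : AddSubgroup (∀ i, ZMod (b i)) :=
  (Int.castAddHom (∀ i, ZMod (b i))).range.topologicalClosure

/-- The diagonal element `(1,1,…)` of the odometer group. -/
def odometerOne (b : ℕ → ℕ) : odometer b :=
  ⟨1, AddSubgroup.le_topologicalClosure _ ⟨1, by simp⟩⟩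

/-- The odometer, i.e. the rotation by `(1,1,…)`. -/
def odometerRot (b : ℕ → ℕ) : odometer b ≃ₜ odometer b := Homeomorph.addRight (odometerOne b)

/-! ### The parameters (all sequences are indexed from `0`) -/

/-- `3 ≤ c₁ < c₂ < …` are odd and pairwise coprime. -/
structure IsAdmissible (c : ℕ → ℕ) : Prop where
  three_le : 3 ≤ c 0
  strictMono : StrictMono c
  odd : ∀ i, Odd (c i)
  coprime : Pairwise fun i j => Nat.Coprime (c i) (c j)

/-- `c_{n+1} = O((c₁ ⋯ c_n)^γ)` for every `γ > 0`. -/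
def SlowGrowth (c : ℕ → ℕ) : Prop :=
  ∀ γ : ℝ, 0 < γ →
    (fun n => (c n : ℝ)) =O[atTop] fun n => (∏ i ∈ Finset.range n, (c i : ℝ)) ^ γ

/-- The exponents `r_i = i`, `i = 1, 2, …`. -/
def linExp : ℕ → ℕ := fun i => i + 1

/-- The exponents `r_i = [κ log₂(c₁ ⋯ c_i)]`, `i = 1, 2, …`. -/
def logExp (c : ℕ → ℕ) (κ : ℝ) : ℕ → ℕ :=
  fun i => ⌊κ * Real.logb 2 (∏ j ∈ Finset.range (i + 1), (c j : ℝ))⌋₊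

end BFree

end

open Filter Topology MeasureTheory
open SymbolicDynamics.FullShift (shift)

noncomputable section

namespace BFree

/-! ### The Chinese remainder theorem for integers -/

/-! Write b_i = 2^{r_i} c_i and C_n = c_0 ⋯ c_n. A position not divisible by 2^N can only be hit by
the b_i with r_i < N, so off the multiples of 2^N the sequence η has period P = 2^N ∏_{r_i<N} c_i
(`etaSeq_eq_of_modEq`). All aperiodicity sits at the single 2-adic point 0, and the theorem exploits
this in two ways.

Complexity. Every point of the orbit closure is within 2^{-N} of one of P shifts of η, which bounds
covering numbers above (`exists_skeleton`, `covNum_le`). Conversely, if b_i does not divide m' - m,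
the class on which σ^m η is forced to vanish contains, by a Chinese remainder sieve, many positions
where σ^{m'} η is 1 (`exists_free_residues`, `le_d1_shift_shift`). For monotone r this separates
2^{r_n} C_n shifts at a scale of order 1/(2^{r_n} c_n M), where M bounds the indices j with r_j ≤
r_n (`le_covNum`). Slow growth makes c_{n+1} and M equal to C_n^{o(1)}. If 2^{r_n} is about C_n^κ,
then about C_n^{1+κ} balls are needed at scale C_n^{-κ+o(1)}, whence (1+κ)/κ. If r is linear,
2^{r_n} is itself C_n^{o(1)}, because C_n ≥ (n+1)!, and the complexity is infinite. Block codes and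
conjugacies are Lipschitz for `d1`, so they preserve amorphic complexity; this yields the
inequivalences.

Dynamics. A point x of the orbit closure vanishes on exactly one class modulo each b_i, and these
classes form the factor map to the odometer. Two points over the same odometer element h differ only
at a position j at which h + j has zero 2-adic part and all other components nonzero
(`residue_add_of_ne`); as r is unbounded there is at most one such j. Hence points in one fibre are
proximal, so the odometer is the maximal equicontinuous factor; the fibres are singletons off a null
set, so the factor map is a measurable isomorphism; and an automorphism, which acts on the odometer
as a translation, must respect the set of h with two-point fibres, which is rigid enough to force
the translation to be by an integer. -/

theorem exists_modEq_modEq {q c : ℕ} (h : Nat.Coprime q c) (z w : ℤ) :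
    ∃ n : ℤ, n ≡ z [ZMOD q] ∧ n ≡ w [ZMOD c] := by
  obtain ⟨u, v, huv⟩ := Nat.isCoprime_iff_coprime.mpr h
  refine ⟨z + u * q * (w - z), ?_, ?_⟩
  · refine (Int.modEq_iff_dvd.mpr ⟨-(u * (w - z)), by ring⟩)
  · refine (Int.modEq_iff_dvd.mpr ⟨v * (w - z), ?_⟩)
    linear_combination (-(w - z)) * huv

theorem modEq_mul_of_coprime {q c : ℕ} (h : Nat.Coprime q c) {x y : ℤ}
    (h₁ : x ≡ y [ZMOD q]) (h₂ : x ≡ y [ZMOD c]) : x ≡ y [ZMOD (q * c : ℕ)] := by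
  rw [Int.modEq_iff_dvd] at *
  push_cast
  exact IsCoprime.mul_dvd (Nat.isCoprime_iff_coprime.mpr h) h₁ h₂

theorem exists_modEq_forall_modEq {ι : Type*} (c : ι → ℕ)
    (hc : Pairwise fun i j => Nat.Coprime (c i) (c j)) (J : Finset ι) (q : ℕ)
    (hq : ∀ j ∈ J, Nat.Coprime q (c j)) (z : ℤ) (a : ι → ℤ) :
    ∃ n : ℤ, n ≡ z [ZMOD q] ∧ ∀ j ∈ J, n ≡ a j [ZMOD c j] := by
  classical
  induction J using Finset.induction_on generalizing q z with
  | empty => exact ⟨z, rfl, by simp⟩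
  | insert j J hj ih =>
    obtain ⟨z', hz', hz''⟩ := exists_modEq_modEq (hq j (by simp)) z (a j)
    obtain ⟨n, hn, hn'⟩ := ih (q * c j) (fun i hi => Nat.Coprime.mul_left
      (hq i (by simp [hi])) (hc (by rintro rfl; exact hj hi))) z'
    have h1 : n ≡ z' [ZMOD q] := hn.of_dvd (by simp)
    have h2 : n ≡ z' [ZMOD c j] := hn.of_dvd (by simp)
    refine ⟨n, h1.trans hz', fun i hi => ?_⟩
    rcases Finset.mem_insert.mp hi with rfl | hi
    · exact h2.trans hz''
    · exact hn' i hi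

/-- In the class of `a` modulo `q` there are `∏ (c_j - 1)` residues modulo `q ∏ c_j` that are
divisible by none of the `c_j`. -/
theorem exists_sifted_residues {ι : Type*} (c : ι → ℕ)
    (hc : Pairwise fun i j => Nat.Coprime (c i) (c j)) (J : Finset ι) (q : ℕ)
    (hq : ∀ j ∈ J, Nat.Coprime q (c j)) (a : ℤ) :
    ∃ S : Finset ℤ, S.card = ∏ j ∈ J, (c j - 1) ∧
      (∀ s ∈ S, ∀ t ∈ S, s ≡ t [ZMOD (q * ∏ j ∈ J, c j : ℕ)] → s = t) ∧
      ∀ s ∈ S, s ≡ a [ZMOD q] ∧ ∀ j ∈ J, ¬ (c j : ℤ) ∣ s := by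
  classical
  induction J using Finset.induction_on with
  | empty => exact ⟨{a}, by simp, by simp, by simp⟩
  | insert j J hj ih =>
    obtain ⟨S, hcard, hinj, hS⟩ := ih fun i hi => hq i (by simp [hi])
    have hcop : Nat.Coprime (q * ∏ i ∈ J, c i) (c j) :=
      Nat.Coprime.mul_left (hq j (by simp))
        (Nat.Coprime.prod_left fun i hi => hc (by rintro rfl; exact hj hi))
    -- Each residue s sifted so far is glued to each of the c_j - 1 nonzero residues t modulo c_j;
    -- the images of the pairs (s, t) are the new sifted residues.
    choose f hf hf' using fun p : ℤ × ℤ => exists_modEq_modEq hcop p.1 p.2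
    have hmod : q * ∏ i ∈ insert j J, c i = (q * ∏ i ∈ J, c i) * c j := by
      rw [Finset.prod_insert hj]; ring
    have key : ∀ p ∈ S ×ˢ Finset.Ico (1 : ℤ) (c j), ∀ p' ∈ S ×ˢ Finset.Ico (1 : ℤ) (c j),
        f p ≡ f p' [ZMOD (q * ∏ i ∈ insert j J, c i : ℕ)] → p = p' := by
      rintro ⟨s, t⟩ hp ⟨s', t'⟩ hp' h
      simp only [Finset.mem_product, Finset.mem_Ico] at hp hp'
      rw [hmod] at h
      have h1 : f (s, t) ≡ f (s', t') [ZMOD (q * ∏ i ∈ J, c i : ℕ)] :=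
        h.of_dvd (by exact_mod_cast Nat.dvd_mul_right _ _)
      have h2 : f (s, t) ≡ f (s', t') [ZMOD (c j : ℕ)] :=
        h.of_dvd (by exact_mod_cast Nat.dvd_mul_left _ _)
      have e1 : s = s' := hinj s hp.1 s' hp'.1 ((hf (s, t)).symm.trans (h1.trans (hf (s', t'))))
      have e2 : t ≡ t' [ZMOD c j] := (hf' (s, t)).symm.trans (h2.trans (hf' (s', t')))
      have e3 : t = t' := by
        rw [Int.ModEq, Int.emod_eq_of_lt (by omega) hp.2.2,
          Int.emod_eq_of_lt (by omega) hp'.2.2] at e2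
        exact e2
      rw [e1, e3]
    refine ⟨(S ×ˢ Finset.Ico (1 : ℤ) (c j)).image f, ?_, ?_, ?_⟩
    · rw [Finset.card_image_of_injOn fun p hp p' hp' h => key p hp p' hp' (by rw [h]),
        Finset.card_product, hcard, Finset.prod_insert hj, mul_comm]
      congr 1
      simp
    · intro s hs t ht h
      obtain ⟨p, hp, rfl⟩ := Finset.mem_image.mp hs
      obtain ⟨p', hp', rfl⟩ := Finset.mem_image.mp ht
      rw [key p hp p' hp' h]
    · intro s hs
      obtain ⟨⟨s, t⟩, hp, rfl⟩ := Finset.mem_image.mp hs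
      simp only [Finset.mem_product, Finset.mem_Ico] at hp
      have h1 := hf (s, t)
      refine ⟨(h1.of_dvd (by simp)).trans (hS s hp.1).1, fun i hi hdvd => ?_⟩
      rcases Finset.mem_insert.mp hi with rfl | hi
      · have := (Int.modEq_zero_iff_dvd.mpr hdvd).symm.trans (hf' (s, t))
        have h3 := Int.modEq_zero_iff_dvd.mp this.symm
        exact absurd (Int.le_of_dvd (by omega) h3) (by simp; omega)
      · refine (hS s hp.1).2 i hi ?_
        have h3 : f (s, t) ≡ s [ZMOD c i] := h1.of_dvd (by
          push_cast
          exact (Finset.dvd_prod_of_mem (fun i => (c i : ℤ)) hi).mul_left _)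
        exact Int.modEq_zero_iff_dvd.mp (h3.symm.trans (Int.modEq_zero_iff_dvd.mpr hdvd))

/-! ### Arithmetic of the sequence `η` -/

theorem fin_two_eq_of_iff {u v : Fin 2} (h : u = 0 ↔ v = 0) : u = v := by
  revert u v; decide

theorem etaSeq_eq_zero_iff {c r : ℕ → ℕ} {n : ℤ} :
    etaSeq c r n = 0 ↔ ∃ i, ((2 ^ r i * c i : ℕ) : ℤ) ∣ n := by
  unfold etaSeq eta
  split_ifs with h
  · simp only [Set.mem_range, forall_exists_index, forall_apply_eq_imp_iff] at h
    simpa using h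
  · simp only [Set.mem_range, forall_exists_index, forall_apply_eq_imp_iff, not_forall,
      not_not] at h
    simpa using h

theorem etaSeq_eq_one_iff {c r : ℕ → ℕ} {n : ℤ} :
    etaSeq c r n = 1 ↔ ∀ i, ¬ ((2 ^ r i * c i : ℕ) : ℤ) ∣ n := by
  rw [← not_exists, ← etaSeq_eq_zero_iff]
  generalize etaSeq c r n = u
  revert u; decide

namespace IsAdmissible

variable {c : ℕ → ℕ} (hc : IsAdmissible c)

include hc

theorem add_three_le (i : ℕ) : i + 3 ≤ c i := by
  induction i with
  | zero => exact hc.three_le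
  | succ i ih => have := hc.strictMono (Nat.lt_add_one i); omega

theorem pos (i : ℕ) : 0 < c i := by have := hc.add_three_le i; omega

theorem b_pos (r : ℕ → ℕ) (i : ℕ) : 0 < 2 ^ r i * c i := Nat.mul_pos (by positivity) (hc.pos i)

theorem coprime_two_pow (k i : ℕ) : Nat.Coprime (2 ^ k) (c i) :=
  Nat.Coprime.pow_left _ (Nat.coprime_two_left.mpr (hc.odd i))

theorem b_dvd_iff {k i : ℕ} {n : ℤ} :
    ((2 ^ k * c i : ℕ) : ℤ) ∣ n ↔ ((2 ^ k : ℕ) : ℤ) ∣ n ∧ (c i : ℤ) ∣ n := by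
  constructor
  · intro h
    push_cast at h ⊢
    exact ⟨(Dvd.intro _ rfl).trans h, (Dvd.intro_left _ rfl).trans h⟩
  · rintro ⟨h1, h2⟩
    push_cast at *
    have := Nat.isCoprime_iff_coprime.mpr (hc.coprime_two_pow k i)
    push_cast at this
    exact this.mul_dvd h1 h2

/-- A nonzero residue class modulo `b_i` contains many classes on which `η = 1`. -/
theorem exists_free_residues {r : ℕ → ℕ} {i : ℕ} {a : ℤ}
    (ha : ¬ ((2 ^ r i * c i : ℕ) : ℤ) ∣ a) (J : Finset ℕ) (hi : i ∉ J)
    (hJ : ∀ j, j ≠ i → r j ≤ r i → j ∈ J) :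
    ∃ S : Finset ℤ, S.card = ∏ j ∈ J, (c j - 1) ∧
      (∀ s ∈ S, ∀ t ∈ S, s ≡ t [ZMOD (2 * (2 ^ r i * c i) * ∏ j ∈ J, c j : ℕ)] → s = t) ∧
      ∀ s ∈ S, ∀ n : ℤ, n ≡ s [ZMOD (2 * (2 ^ r i * c i) * ∏ j ∈ J, c j : ℕ)] →
        n ≡ a [ZMOD (2 ^ r i * c i : ℕ)] ∧ etaSeq c r n = 1 := by
  -- Of a and a + b_i at least one is not divisible by 2^{r_i+1}, since c_i is odd. Fixing that
  -- parity, at the price of the factor 2 in the modulus, excludes all b_j with r_j > r_i at once;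
  -- only the finitely many j ∈ J remain to be sieved.
  obtain ⟨a', ha', h2⟩ : ∃ a' : ℤ, a' ≡ a [ZMOD (2 ^ r i * c i : ℕ)] ∧
      ¬ ((2 ^ (r i + 1) : ℕ) : ℤ) ∣ a' := by
    by_cases h : ((2 ^ (r i + 1) : ℕ) : ℤ) ∣ a
    · refine ⟨a + (2 ^ r i * c i : ℕ), by simp [Int.ModEq], fun h' => ?_⟩
      have h3 := (Int.dvd_add_right h).mp h'
      rw [Int.natCast_dvd_natCast, pow_succ] at h3
      have := Nat.dvd_of_mul_dvd_mul_left (by positivity) h3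
      exact (Nat.not_even_iff_odd.mpr (hc.odd i)) (even_iff_two_dvd.mpr this)
    · exact ⟨a, rfl, h⟩
  have hq : 2 * (2 ^ r i * c i) = 2 ^ (r i + 1) * c i := by ring
  obtain ⟨S, h1, hinj, hS⟩ := exists_sifted_residues c hc.coprime J (2 * (2 ^ r i * c i))
    (fun j hj => by
      rw [hq]
      exact Nat.Coprime.mul_left (hc.coprime_two_pow _ _)
        (hc.coprime (by rintro rfl; exact hi hj))) a'
  refine ⟨S, h1, hinj, fun s hs n hn => ?_⟩
  have hna' : n ≡ a' [ZMOD (2 * (2 ^ r i * c i) : ℕ)] :=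
    (hn.of_dvd (by exact_mod_cast Nat.dvd_mul_right _ _)).trans (hS s hs).1
  have hna : n ≡ a [ZMOD (2 ^ r i * c i : ℕ)] :=
    (hna'.of_dvd (by exact_mod_cast Nat.dvd_mul_left _ _)).trans ha'
  refine ⟨hna, etaSeq_eq_one_iff.mpr fun j hj => ?_⟩
  have hji : j ≠ i := by
    rintro rfl
    exact ha (Int.modEq_zero_iff_dvd.mp (hna.symm.trans (Int.modEq_zero_iff_dvd.mpr hj)))
  obtain ⟨hj2, hjc⟩ := hc.b_dvd_iff.mp hj
  by_cases hr : r j ≤ r i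
  · refine (hS s hs).2 j (hJ j hji hr) ?_
    have h3 : n ≡ s [ZMOD c j] := hn.of_dvd (by
      exact_mod_cast (Finset.dvd_prod_of_mem c (hJ j hji hr)).mul_left _)
    exact Int.modEq_zero_iff_dvd.mp (h3.symm.trans (Int.modEq_zero_iff_dvd.mpr hjc))
  · refine h2 ?_
    have h4 : ((2 ^ (r i + 1) : ℕ) : ℤ) ∣ n :=
      (Int.natCast_dvd_natCast.mpr (pow_dvd_pow 2 (by omega))).trans hj2
    have h5 : n ≡ a' [ZMOD (2 ^ (r i + 1) : ℕ)] :=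
      hna'.of_dvd (by rw [hq]; exact_mod_cast Nat.dvd_mul_right _ _)
    exact Int.modEq_zero_iff_dvd.mp (h5.symm.trans (Int.modEq_zero_iff_dvd.mpr h4))

end IsAdmissible

/-- `η` is periodic modulo `2^N ∏_{i ∈ J} c_i` off the multiples of `2^N`, if `J` contains all
`i` with `r_i < N`, and only such with `r_i ≤ N`. -/
theorem etaSeq_eq_of_modEq {c r : ℕ → ℕ} {N : ℕ} {J : Finset ℕ} (hJ : ∀ i, i ∉ J → N ≤ r i)
    (hJ' : ∀ i ∈ J, r i ≤ N) {m n : ℤ} (h : m ≡ n [ZMOD (2 ^ N * ∏ i ∈ J, c i : ℕ)])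
    (hm : ¬ (2 ^ N : ℤ) ∣ m) : etaSeq c r m = etaSeq c r n := by
  have key : ∀ m n : ℤ, m ≡ n [ZMOD (2 ^ N * ∏ i ∈ J, c i : ℕ)] → ¬ (2 ^ N : ℤ) ∣ m →
      etaSeq c r m = 0 → etaSeq c r n = 0 := by
    intro m n h hm h0
    obtain ⟨i, hi⟩ := etaSeq_eq_zero_iff.mp h0
    refine etaSeq_eq_zero_iff.mpr ⟨i, ?_⟩
    by_cases hiJ : i ∈ J
    · have : m ≡ n [ZMOD (2 ^ r i * c i : ℕ)] := h.of_dvd (by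
        exact_mod_cast Nat.mul_dvd_mul (pow_dvd_pow 2 (hJ' i hiJ)) (Finset.dvd_prod_of_mem c hiJ))
      exact Int.modEq_zero_iff_dvd.mp (this.symm.trans (Int.modEq_zero_iff_dvd.mpr hi))
    · refine absurd ?_ hm
      refine (pow_dvd_pow 2 (hJ i hiJ)).trans (Dvd.dvd.trans ?_ hi)
      push_cast
      exact Dvd.intro _ rfl
  refine fin_two_eq_of_iff ⟨key m n h hm, key n m h.symm fun hn => hm ?_⟩
  have : m ≡ n [ZMOD (2 ^ N : ℤ)] := h.of_dvd (by push_cast; exact Dvd.intro _ rfl)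
  exact Int.modEq_zero_iff_dvd.mp (this.trans (Int.modEq_zero_iff_dvd.mpr hn))

theorem exists_finset_lt {r : ℕ → ℕ} (hr : Tendsto r atTop atTop) (N : ℕ) :
    ∃ J : Finset ℕ, ∀ i, i ∈ J ↔ r i < N := by
  have h : {i | r i < N}.Finite := by
    obtain ⟨M, hM⟩ := (tendsto_atTop.mp hr N).exists_forall_of_atTop
    exact (Set.finite_lt_nat M).subset fun i hi => by
      by_contra h
      exact absurd (hM i (not_lt.mp h)) (not_le.mpr hi)
  exact ⟨h.toFinset, by simp⟩

/-! ### The Besicovitch pseudo-metric -/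

section Besicovitch

variable {A : Type*}

open Classical in
/-- The frequency of `{i : x_i ≠ y_i}` in `[-n, n]`. -/
def diffFreq (x y : ℤ → A) (n : ℕ) : ℝ :=
  (((Finset.Icc (-(n : ℤ)) n).filter fun i => x i ≠ y i).card : ℝ) / (2 * n + 1)

theorem card_Icc_neg (n : ℕ) : (Finset.Icc (-(n : ℤ)) n).card = 2 * n + 1 := by
  rw [Int.card_Icc]; omega

theorem diffFreq_nonneg (x y : ℤ → A) (n : ℕ) : 0 ≤ diffFreq x y n := by
  unfold diffFreq; positivity

theorem diffFreq_le_one (x y : ℤ → A) (n : ℕ) : diffFreq x y n ≤ 1 := by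
  classical
  unfold diffFreq
  rw [div_le_one (by positivity)]
  have h := Finset.card_filter_le (Finset.Icc (-(n : ℤ)) n) fun i => x i ≠ y i
  rw [card_Icc_neg] at h
  exact_mod_cast h

theorem isBoundedUnder_diffFreq (x y : ℤ → A) :
    IsBoundedUnder (· ≤ ·) atTop (diffFreq x y) :=
  isBoundedUnder_of ⟨1, diffFreq_le_one x y⟩

theorem isBoundedUnder_ge_diffFreq (x y : ℤ → A) :
    IsBoundedUnder (· ≥ ·) atTop (diffFreq x y) :=
  isBoundedUnder_of ⟨0, diffFreq_nonneg x y⟩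

theorem d1_le_of_eventually_le {x y : ℤ → A} {L : ℝ}
    (h : ∀ δ : ℝ, 0 < δ → ∀ᶠ n in atTop, diffFreq x y n ≤ L + δ) : d1 x y ≤ L := by
  refine le_of_forall_pos_le_add fun δ hδ => ?_
  exact limsup_le_of_le (isBoundedUnder_ge_diffFreq x y).isCoboundedUnder_le (h δ hδ)

theorem eventually_diffFreq_lt {x y : ℤ → A} {L : ℝ} (h : d1 x y < L) :
    ∀ᶠ n in atTop, diffFreq x y n < L :=
  eventually_lt_of_limsup_lt h (isBoundedUnder_diffFreq x y)

theorem le_d1_of_eventually_le {x y : ℤ → A} {u : ℕ → ℝ} {L : ℝ} (hu : Tendsto u atTop (𝓝 L))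
    (h : ∀ᶠ n in atTop, u n ≤ diffFreq x y n) : L ≤ d1 x y := by
  by_contra! hlt
  obtain ⟨M, h1, h2⟩ := exists_between hlt
  obtain ⟨n, hn1, hn2, hn3⟩ :=
    ((eventually_diffFreq_lt h1).and ((hu.eventually_const_lt h2).and h)).exists
  linarith

theorem d1_comm (x y : ℤ → A) : d1 x y = d1 y x := by
  classical
  simp only [d1, ne_comm]

theorem diffFreq_triangle (x y z : ℤ → A) (n : ℕ) :
    diffFreq x z n ≤ diffFreq x y n + diffFreq y z n := by
  classical
  unfold diffFreq
  rw [← add_div]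
  gcongr
  rw [← Nat.cast_add]
  refine Nat.cast_le.mpr ((Finset.card_le_card ?_).trans (Finset.card_union_le _ _))
  intro i hi
  simp only [Finset.mem_union, Finset.mem_filter] at hi ⊢
  by_cases h : x i = y i
  · exact Or.inr ⟨hi.1, h ▸ hi.2⟩
  · exact Or.inl ⟨hi.1, h⟩

theorem d1_triangle (x y z : ℤ → A) : d1 x z ≤ d1 x y + d1 y z := by
  refine d1_le_of_eventually_le fun δ hδ => ?_
  filter_upwards [eventually_diffFreq_lt (x := x) (y := y) (L := d1 x y + δ / 2) (by linarith),
    eventually_diffFreq_lt (x := y) (y := z) (L := d1 y z + δ / 2) (by linarith)] with n h1 h2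
  linarith [diffFreq_triangle x y z n]

theorem abs_card_filter_modEq_sub_le (a : ℤ) {q : ℕ} (hq : 0 < q) (n : ℕ) :
    |(((Finset.Icc (-(n : ℤ)) n).filter fun i => i ≡ a [ZMOD q]).card : ℝ) - (2 * n + 1) / q|
      ≤ 1 := by
  have hI : Finset.Icc (-(n : ℤ)) n = Finset.Ioc (-(n : ℤ) - 1) n := by
    ext; simp
  have hq' : (0 : ℚ) < q := by exact_mod_cast hq
  have h := Int.Ioc_filter_modEq_card (-(n : ℤ) - 1) n (r := (q : ℤ)) (by exact_mod_cast hq) a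
  rw [← hI] at h
  have h2 : (⌊(((-(n : ℤ) - 1 : ℤ) : ℚ) - a) / (q : ℤ)⌋) ≤ ⌊(((n : ℤ) : ℚ) - a) / (q : ℤ)⌋ := by
    gcongr
    linarith
  rw [max_eq_left (by linarith)] at h
  have e1 := Int.floor_le ((((-(n : ℤ) - 1 : ℤ) : ℚ) - a) / (q : ℤ))
  have e2 := Int.lt_floor_add_one ((((-(n : ℤ) - 1 : ℤ) : ℚ) - a) / (q : ℤ))
  have e3 := Int.floor_le ((((n : ℤ) : ℚ) - a) / (q : ℤ))
  have e4 := Int.lt_floor_add_one ((((n : ℤ) : ℚ) - a) / (q : ℤ))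
  have h' := congrArg (Int.cast : ℤ → ℚ) h
  push_cast at h' e1 e2 e3 e4
  have e5 : ((n : ℚ) - a) / q - (-(n : ℚ) - 1 - a) / q = (2 * n + 1) / q := by ring
  have key : |(((Finset.Icc (-(n : ℤ)) n).filter fun i => i ≡ a [ZMOD q]).card : ℚ)
      - (2 * n + 1) / q| ≤ 1 := by
    rw [h', abs_le]
    constructor <;> linarith
  have := (Rat.cast_le (K := ℝ)).mpr key
  push_cast at this
  exact this

theorem tendsto_density_modEq (a : ℤ) {q : ℕ} (hq : 0 < q) :
    Tendsto (fun n : ℕ => (((Finset.Icc (-(n : ℤ)) n).filter fun i => i ≡ a [ZMOD q]).card : ℝ)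
      / (2 * n + 1)) atTop (𝓝 (1 / q)) := by
  rw [tendsto_iff_norm_sub_tendsto_zero]
  have h1 : Tendsto (fun n : ℕ => 1 / ((n : ℝ) + 1)) atTop (𝓝 0) :=
    tendsto_one_div_add_atTop_nhds_zero_nat
  refine squeeze_zero (fun n => norm_nonneg _) (fun n => ?_) h1
  have hpos : (0 : ℝ) < 2 * n + 1 := by positivity
  have hq' : (0 : ℝ) < q := by exact_mod_cast hq
  rw [Real.norm_eq_abs]
  have e : ((((Finset.Icc (-(n : ℤ)) n).filter fun i => i ≡ a [ZMOD q]).card : ℝ) / (2 * n + 1)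
      - 1 / q) = ((((Finset.Icc (-(n : ℤ)) n).filter fun i => i ≡ a [ZMOD q]).card : ℝ)
        - (2 * n + 1) / q) / (2 * n + 1) := by
    field_simp
  rw [e, abs_div, abs_of_pos hpos, div_le_div_iff₀ hpos (by positivity)]
  nlinarith [abs_card_filter_modEq_sub_le a hq n, Nat.cast_nonneg (α := ℝ) n]

theorem d1_le_inv_of_modEq {x y : ℤ → A} {q : ℕ} (hq : 0 < q) (a : ℤ)
    (h : ∀ i, x i ≠ y i → i ≡ a [ZMOD q]) : d1 x y ≤ 1 / q := by
  classical
  refine d1_le_of_eventually_le fun δ hδ => ?_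
  filter_upwards [(tendsto_density_modEq a hq).eventually_lt_const
    (show (1 : ℝ) / q < 1 / q + δ by linarith)] with n hn
  refine le_trans ?_ hn.le
  unfold diffFreq
  gcongr with i
  exact h i

/-- The classes of the elements of S are disjoint and each has density 1/q, so their densities add.
-/
theorem le_d1_of_residues {x y : ℤ → A} {q : ℕ} (hq : 0 < q) (S : Finset ℤ)
    (hS : ∀ s ∈ S, ∀ t ∈ S, s ≡ t [ZMOD q] → s = t)
    (h : ∀ s ∈ S, ∀ i, i ≡ s [ZMOD q] → x i ≠ y i) : (S.card : ℝ) / q ≤ d1 x y := by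
  classical
  have hlim := tendsto_finsetSum S fun s _ => tendsto_density_modEq s hq
  rw [Finset.sum_const, nsmul_eq_mul, mul_one_div] at hlim
  refine le_d1_of_eventually_le hlim (Eventually.of_forall fun n => ?_)
  rw [← Finset.sum_div]
  unfold diffFreq
  gcongr
  rw [← Nat.cast_sum, ← Finset.card_biUnion]
  · refine Nat.cast_le.mpr (Finset.card_le_card fun i hi => ?_)
    simp only [Finset.mem_biUnion, Finset.mem_filter] at hi ⊢
    obtain ⟨s, hs, hi1, hi2⟩ := hi
    exact ⟨hi1, h s hs i hi2⟩
  · intro s hs t ht hst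
    refine Finset.disjoint_left.mpr fun i hi hi' => ?_
    simp only [Finset.mem_filter] at hi hi'
    exact hst (hS s hs t ht (hi.2.symm.trans hi'.2))

/-- A map given by a local rule of radius `m` is `2m+1`-Lipschitz. -/
theorem d1_le_of_local {x y x' y' : ℤ → A} (m : ℕ)
    (h : ∀ i, (∀ k ∈ Finset.Icc (-(m : ℤ)) m, x (i + k) = y (i + k)) → x' i = y' i) :
    d1 x' y' ≤ (2 * m + 1) * d1 x y := by
  classical
  -- Translating the window [-n, n] by k moves it by at most m, so only boundary positions, at most
  -- 2m of them, are gained.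
  have hcard : ∀ (n : ℕ), ∀ k ∈ Finset.Icc (-(m : ℤ)) m,
      ((Finset.Icc (-(n : ℤ)) n).filter fun i => x (i + k) ≠ y (i + k)).card ≤
      ((Finset.Icc (-(n : ℤ)) n).filter fun i => x i ≠ y i).card + 2 * m := by
    intro n k hk
    have hk' := Finset.mem_Icc.mp hk
    rw [← Finset.card_map (addRightEmbedding k)]
    have hsub : (((Finset.Icc (-(n : ℤ)) n).filter fun i => x (i + k) ≠ y (i + k)).map
        (addRightEmbedding k)) ⊆ ((Finset.Icc (-(n : ℤ)) n).filter fun i => x i ≠ y i) ∪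
          (Finset.Ico (-(n : ℤ) - m) (-n) ∪ Finset.Ioc (n : ℤ) (n + m)) := by
      intro j hj
      simp only [Finset.mem_map, Finset.mem_filter, Finset.mem_Icc, addRightEmbedding_apply] at hj
      obtain ⟨i, ⟨hi, hne⟩, rfl⟩ := hj
      simp only [Finset.mem_union, Finset.mem_filter, Finset.mem_Icc, Finset.mem_Ico,
        Finset.mem_Ioc]
      by_cases h1 : i + k < -n
      · right; left; omega
      by_cases h2 : (n : ℤ) < i + k
      · right; right; omega
      · left; exact ⟨by omega, hne⟩
    refine (Finset.card_le_card hsub).trans ((Finset.card_union_le _ _).trans ?_)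
    have := Finset.card_union_le (Finset.Ico (-(n : ℤ) - m) (-n)) (Finset.Ioc (n : ℤ) (n + m))
    simp only [Int.card_Ico, Int.card_Ioc] at this
    omega
  have hfreq : ∀ n : ℕ, diffFreq x' y' n ≤
      (2 * m + 1) * diffFreq x y n + (2 * m + 1) * (2 * m) * (1 / ((n : ℝ) + 1)) := by
    intro n
    -- Wherever the outputs differ, the inputs differ within distance m; a union bound over the 2m +
    -- 1 offsets gives the Lipschitz constant.
    have hsub : ((Finset.Icc (-(n : ℤ)) n).filter fun i => x' i ≠ y' i) ⊆
        (Finset.Icc (-(m : ℤ)) m).biUnion fun k =>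
          (Finset.Icc (-(n : ℤ)) n).filter fun i => x (i + k) ≠ y (i + k) := by
      intro i hi
      simp only [Finset.mem_filter, Finset.mem_biUnion] at hi ⊢
      by_contra! hcon
      exact hi.2 (h i fun k hk => hcon k hk hi.1)
    have h1 := (Finset.card_le_card hsub).trans (Finset.card_biUnion_le.trans
      (Finset.sum_le_card_nsmul _ _ _ (hcard n)))
    rw [card_Icc_neg, smul_eq_mul] at h1
    have h2 := (Nat.cast_le (α := ℝ)).mpr h1
    push_cast at h2
    unfold diffFreq
    have hpos : (0 : ℝ) < 2 * n + 1 := by positivity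
    calc _ ≤ ((2 * m + 1) * ((((Finset.Icc (-(n : ℤ)) n).filter fun i => x i ≠ y i).card : ℝ)
          + 2 * m)) / (2 * n + 1) := by gcongr
      _ = (2 * m + 1) * ((((Finset.Icc (-(n : ℤ)) n).filter fun i => x i ≠ y i).card : ℝ)
          / (2 * n + 1)) + (2 * m + 1) * (2 * m) * (1 / (2 * n + 1)) := by ring
      _ ≤ _ := by
        gcongr
        linarith [Nat.cast_nonneg (α := ℝ) n]
  refine d1_le_of_eventually_le fun δ hδ => ?_
  have hm : (0 : ℝ) < 2 * m + 1 := by positivity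
  have hlim : Tendsto (fun n : ℕ => (2 * m + 1 : ℝ) * (2 * m) * (1 / ((n : ℝ) + 1))) atTop
      (𝓝 0) := by
    simpa using tendsto_one_div_add_atTop_nhds_zero_nat.const_mul ((2 * m + 1 : ℝ) * (2 * m))
  filter_upwards [eventually_diffFreq_lt (x := x) (y := y) (L := d1 x y + δ / (2 * (2 * m + 1)))
      (by linarith [show 0 < δ / (2 * (2 * m + 1 : ℝ)) by positivity]),
    hlim.eventually_lt_const (show (0 : ℝ) < δ / 2 by linarith)] with n h1 h2
  have h3 := mul_le_mul_of_nonneg_left h1.le hm.le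
  have h4 : (2 * m + 1 : ℝ) * (d1 x y + δ / (2 * (2 * m + 1))) =
      (2 * m + 1) * d1 x y + δ / 2 := by field_simp
  linarith [hfreq n]

end Besicovitch

/-! ### Skeletons and covering numbers -/

theorem shift_mem_orbit {A : Type*} (x : ℤ → A) (n : ℤ) : shift n x ∈ orbit x := ⟨n, rfl⟩

theorem self_mem_orbit {A : Type*} (x : ℤ → A) : x ∈ orbit x := ⟨0, by ext; simp⟩

theorem orbit_subset_orbitClosure {A : Type*} [TopologicalSpace A] (x : ℤ → A) :
    orbit x ⊆ orbitClosure x := subset_closure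

theorem IsAdmissible.level_pos {c : ℕ → ℕ} (hc : IsAdmissible c) (N : ℕ) (J : Finset ℕ) :
    0 < 2 ^ N * ∏ i ∈ J, c i :=
  Nat.mul_pos (by positivity) (Finset.prod_pos fun i _ => hc.pos i)

/-- Every point of the orbit closure agrees with some `σ^m η`, `0 ≤ m < 2^N ∏_{i ∈ J} c_i`, off a
residue class modulo `2^N`. -/
theorem exists_skeleton {c r : ℕ → ℕ} (hc : IsAdmissible c) {N : ℕ} {J : Finset ℕ}
    (hJ : ∀ i, i ∉ J → N ≤ r i) (hJ' : ∀ i ∈ J, r i ≤ N) {x : ℤ → Fin 2}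
    (hx : x ∈ orbitClosure (etaSeq c r)) :
    ∃ m : ℕ, m < 2 ^ N * ∏ i ∈ J, c i ∧
      ∀ j : ℤ, ¬ (2 ^ N : ℤ) ∣ m + j → x j = etaSeq c r (m + j) := by
  set P := 2 ^ N * ∏ i ∈ J, c i with hP
  have hPpos : 0 < P := hc.level_pos N J
  -- For fixed m the condition is closed and there are only P choices of m, so it is enough to treat
  -- the orbit, where m is the shift reduced modulo P.
  have hclosed : IsClosed (⋃ m ∈ Finset.range P,
      {x : ℤ → Fin 2 | ∀ j : ℤ, ¬ (2 ^ N : ℤ) ∣ m + j → x j = etaSeq c r (m + j)}) := by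
    refine isClosed_biUnion_finset fun m _ => ?_
    simp only [Set.ofPred_forall]
    exact isClosed_iInter fun j => isClosed_iInter fun _ =>
      isClosed_eq (continuous_apply j) continuous_const
  have hsub : orbit (etaSeq c r) ⊆ (⋃ m ∈ Finset.range P,
      {x : ℤ → Fin 2 | ∀ j : ℤ, ¬ (2 ^ N : ℤ) ∣ m + j → x j = etaSeq c r (m + j)}) := by
    rintro _ ⟨k, rfl⟩
    have hk0 : 0 ≤ k % (P : ℤ) := Int.emod_nonneg _ (by omega)
    have hk1 : k % (P : ℤ) < P := Int.emod_lt_of_pos _ (by omega)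
    simp only [Set.mem_iUnion, Finset.mem_range, Set.mem_ofPred_eq]
    refine ⟨(k % (P : ℤ)).toNat, by omega, fun j hj => ?_⟩
    rw [Int.toNat_of_nonneg hk0] at hj ⊢
    refine (etaSeq_eq_of_modEq hJ hJ' ?_ hj).symm
    exact Int.ModEq.add_right _ (Int.mod_modEq k P)
  have := closure_minimal hsub hclosed hx
  simpa only [Set.mem_iUnion, Finset.mem_range, Set.mem_ofPred_eq, exists_prop] using this

theorem d1_shift_le {c r : ℕ → ℕ} {N m : ℕ} {x : ℤ → Fin 2}
    (h : ∀ j : ℤ, ¬ (2 ^ N : ℤ) ∣ m + j → x j = etaSeq c r (m + j)) :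
    d1 (shift (m : ℤ) (etaSeq c r)) x ≤ 1 / 2 ^ N := by
  have := d1_le_inv_of_modEq (x := shift (m : ℤ) (etaSeq c r)) (y := x) (q := 2 ^ N)
    (by positivity) (-m) fun j hj => by
      have h1 : (2 ^ N : ℤ) ∣ m + j := by
        by_contra hcon
        exact hj (h j hcon).symm
      refine (Int.modEq_iff_dvd.mpr ?_).symm
      push_cast
      convert h1 using 1
      ring
  exact_mod_cast this

/-- The centres are the shifts provided by `exists_skeleton`. They lie in the orbit itself, so one
bound serves the orbit and its closure. -/
theorem covNum_le {c r : ℕ → ℕ} (hc : IsAdmissible c) {N : ℕ} {J : Finset ℕ}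
    (hJ : ∀ i, i ∉ J → N ≤ r i) (hJ' : ∀ i ∈ J, r i ≤ N) {X : Set (ℤ → Fin 2)}
    (h₁ : orbit (etaSeq c r) ⊆ X) (h₂ : X ⊆ orbitClosure (etaSeq c r)) {ε : ℝ}
    (hε : 1 / 2 ^ N < ε) : covNum X ε ≤ (2 ^ N * ∏ i ∈ J, c i : ℕ) := by
  classical
  refine (iInf₂_le (((Finset.range (2 ^ N * ∏ i ∈ J, c i)).image
    fun m : ℕ => shift (m : ℤ) (etaSeq c r) : Finset (ℤ → Fin 2)) : Set (ℤ → Fin 2)) ?_).trans ?_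
  · constructor
    · intro y hy
      obtain ⟨m, -, rfl⟩ := Finset.mem_image.mp hy
      exact h₁ (shift_mem_orbit _ _)
    · intro x hx
      obtain ⟨m, hm, h⟩ := exists_skeleton hc hJ hJ' (h₂ hx)
      exact ⟨_, Finset.mem_coe.mpr (Finset.mem_image_of_mem _ (Finset.mem_range.mpr hm)),
        (d1_shift_le h).trans_lt hε⟩
  · rw [Set.encard_coe_eq_coe_finsetCard]
    exact_mod_cast Finset.card_image_le.trans (Finset.card_range _).le

/-- Two points in a common ε-ball are less than 2ε apart, so choosing a centre for each member of
the separated family is injective. -/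
theorem card_le_covNum {A ι : Type*} {X : Set (ℤ → A)} {ε : ℝ} (S : Finset ι) (f : ι → ℤ → A)
    (hf : ∀ s ∈ S, f s ∈ X) (hsep : ∀ s ∈ S, ∀ t ∈ S, d1 (f s) (f t) < 2 * ε → s = t) :
    (S.card : ℕ∞) ≤ covNum X ε := by
  refine le_iInf₂ fun C hC => ?_
  have hC' : ∀ s, ∃ g, s ∈ S → g ∈ C ∧ d1 g (f s) < ε := fun s => by
    by_cases hs : s ∈ S
    · obtain ⟨g, h1, h2⟩ := hC.2 (f s) (hf s hs)
      exact ⟨g, fun _ => ⟨h1, h2⟩⟩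
    · exact ⟨f s, fun h => absurd h hs⟩
  choose g hg using hC'
  rw [← Set.encard_coe_eq_coe_finsetCard]
  refine Set.encard_le_encard_of_injOn (f := g) (fun s hs => (hg s hs).1) fun s hs t ht hst => ?_
  refine hsep s hs t ht ?_
  have h1 := (hg s hs).2
  have h2 := (hg t ht).2
  rw [← hst] at h2
  rw [d1_comm] at h1
  linarith [d1_triangle (f s) (g s) (f t)]

/-- Since c_j ≥ j + 2, the product is at least the telescoping product of (j+1)/(j+2) over j < M.
The crude loss of M + 1 is affordable because M will be only logarithmic in c_0 ⋯ c_n. -/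
theorem inv_le_prod_one_sub_inv {c : ℕ → ℕ} (hc : IsAdmissible c) (M : ℕ) (J : Finset ℕ)
    (hJ : J ⊆ Finset.range M) : 1 / ((M : ℝ) + 1) ≤ ∏ j ∈ J, (1 - 1 / (c j : ℝ)) := by
  have h3 : ∀ j : ℕ, (j : ℝ) + 2 ≤ c j := fun j => by
    exact_mod_cast (show j + 2 ≤ c j by have := hc.add_three_le j; omega)
  have hle : ∀ j : ℕ, 1 - 1 / ((j : ℝ) + 2) ≤ 1 - 1 / (c j : ℝ) := fun j => by
    have := one_div_le_one_div_of_le (by positivity) (h3 j)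
    linarith
  have h0 : ∀ j : ℕ, 0 ≤ 1 - 1 / ((j : ℝ) + 2) := fun j => by
    have : 1 / ((j : ℝ) + 2) ≤ 1 := by
      rw [div_le_one (by positivity)]; linarith [Nat.cast_nonneg (α := ℝ) j]
    linarith
  have h1 : ∀ j : ℕ, 1 - 1 / (c j : ℝ) ≤ 1 := fun j => by
    have : 0 ≤ 1 / (c j : ℝ) := by positivity
    linarith
  calc 1 / ((M : ℝ) + 1) = ∏ j ∈ Finset.range M, (1 - 1 / ((j : ℝ) + 2)) := by
        clear hJ
        induction M with
        | zero => simp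
        | succ M ih =>
          rw [Finset.prod_range_succ, ← ih]
          push_cast
          field_simp
          ring
    _ ≤ ∏ j ∈ Finset.range M, (1 - 1 / (c j : ℝ)) :=
        Finset.prod_le_prod (fun j _ => h0 j) fun j _ => hle j
    _ ≤ ∏ j ∈ J, (1 - 1 / (c j : ℝ)) := by
        rw [← Finset.prod_sdiff hJ]
        refine mul_le_of_le_one_left (Finset.prod_nonneg fun j _ => (h0 j).trans (hle j)) ?_
        exact Finset.prod_le_one (fun j _ => (h0 j).trans (hle j)) fun j _ => h1 j

/-- Shifts of `η` that differ modulo `b_i` are separated. -/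
theorem le_d1_shift_shift {c r : ℕ → ℕ} (hc : IsAdmissible c) {i M : ℕ}
    (hM : ∀ j, r j ≤ r i → j < M) {m m' : ℤ} (h : ¬ ((2 ^ r i * c i : ℕ) : ℤ) ∣ m' - m) :
    1 / (2 * (2 ^ r i * c i) * ((M : ℝ) + 1)) ≤
      d1 (shift m (etaSeq c r)) (shift m' (etaSeq c r)) := by
  classical
  set J := (Finset.range M).erase i with hJ
  -- Sift the class of m' - m modulo b_i. If m' + n lies in a sifted class then b_i ∣ m + n, so σ^m
  -- η vanishes at n while σ^{m'} η is 1 there.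
  obtain ⟨S, hcard, hinj, hS⟩ := hc.exists_free_residues h J (Finset.notMem_erase _ _)
    fun j hji hj => Finset.mem_erase.mpr ⟨hji, Finset.mem_range.mpr (hM j hj)⟩
  set Q := 2 * (2 ^ r i * c i) * ∏ j ∈ J, c j with hQ
  have hQpos : 0 < Q := Nat.mul_pos (Nat.mul_pos two_pos (hc.b_pos r i))
    (Finset.prod_pos fun i _ => hc.pos i)
  have hinj' : Function.Injective fun s : ℤ => s - m' := sub_left_injective
  have key := le_d1_of_residues (x := shift m (etaSeq c r)) (y := shift m' (etaSeq c r)) hQpos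
    (S.image fun s => s - m') (fun s hs t ht hst => by
      obtain ⟨s, hs', rfl⟩ := Finset.mem_image.mp hs
      obtain ⟨t, ht', rfl⟩ := Finset.mem_image.mp ht
      rw [hinj s hs' t ht' (Int.ModEq.add_right_cancel' (-m') (by simpa [sub_eq_add_neg] using hst))])
    (fun s hs n hn => by
      obtain ⟨s, hs', rfl⟩ := Finset.mem_image.mp hs
      obtain ⟨h1, h2⟩ := hS s hs' (m' + n) (by simpa using hn.add_left m')
      have h3 : etaSeq c r (m + n) = 0 := etaSeq_eq_zero_iff.mpr ⟨i, by
        have := h1.symm.dvd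
        convert this using 1
        ring⟩
      change etaSeq c r (m + n) ≠ etaSeq c r (m' + n)
      rw [h2, h3]
      decide)
  refine le_trans ?_ key
  rw [Finset.card_image_of_injective _ hinj', hcard]
  -- This turns the density of the sifted classes into 1/(2 b_i) times ∏ (1 - 1/c_j).
  have hprod : ((∏ j ∈ J, (c j - 1) : ℕ) : ℝ) = (∏ j ∈ J, (c j : ℝ)) *
      ∏ j ∈ J, (1 - 1 / (c j : ℝ)) := by
    rw [← Finset.prod_mul_distrib, Nat.cast_prod]
    refine Finset.prod_congr rfl fun j _ => ?_
    have := hc.pos j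
    have h' : (c j : ℝ) ≠ 0 := by positivity
    rw [Nat.cast_sub (by omega)]
    field_simp
    simp
  have hpos : 0 < ∏ j ∈ J, (c j : ℝ) := Finset.prod_pos fun j _ => by exact_mod_cast hc.pos j
  have hb : (0 : ℝ) < 2 ^ r i * c i := by exact_mod_cast hc.b_pos r i
  rw [hprod, hQ]
  push_cast
  rw [mul_comm (2 * _) (∏ j ∈ J, (c j : ℝ)), mul_div_mul_left _ _ hpos.ne', ← div_div,
    div_right_comm]
  gcongr
  exact inv_le_prod_one_sub_inv hc M J (Finset.erase_subset _ _)

/-- For monotone exponents, the shifts `σ^m η` with `0 ≤ m < 2^{r_n} c_0 ⋯ c_n` are separated. -/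
theorem le_covNum {c r : ℕ → ℕ} (hc : IsAdmissible c) (hr : Monotone r) {n M : ℕ}
    (hM : ∀ j, r j ≤ r n → j < M) {X : Set (ℤ → Fin 2)}
    (h₁ : orbit (etaSeq c r) ⊆ X) {ε : ℝ}
    (hε : ε ≤ 1 / (4 * (2 ^ r n * c n) * ((M : ℝ) + 1))) :
    ((2 ^ r n * ∏ i ∈ Finset.range (n + 1), c i : ℕ) : ℕ∞) ≤ covNum X ε := by
  have := card_le_covNum (X := X) (ε := ε)
    (Finset.range (2 ^ r n * ∏ i ∈ Finset.range (n + 1), c i))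
    (fun m : ℕ => shift (m : ℤ) (etaSeq c r)) (fun m _ => h₁ (shift_mem_orbit _ _)) ?_
  · simpa using this
  intro m hm m' hm' hlt
  rw [Finset.mem_range] at hm hm'
  -- By monotonicity b_i ≤ b_n for i ≤ n, so a failure of divisibility by any of these b_i already
  -- separates the two shifts at the scale of b_n. The 4 in `hε` is twice the 2 of
  -- `le_d1_shift_shift`, as separation by 2ε is needed.
  have hdvd : ∀ i ∈ Finset.range (n + 1), ((2 ^ r i * c i : ℕ) : ℤ) ∣ (m' : ℤ) - m := by
    intro i hi
    by_contra hcon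
    have hin : i ≤ n := Nat.lt_succ_iff.mp (Finset.mem_range.mp hi)
    have h1 := le_d1_shift_shift hc (fun j hj => hM j (hj.trans (hr hin))) hcon
    refine absurd hlt (not_lt.mpr (le_trans ?_ h1))
    have h2 : (2 : ℝ) ^ r i * c i ≤ 2 ^ r n * c n := by
      gcongr
      · norm_num
      · exact hr hin
      · exact hc.strictMono.monotone hin
    have hb : (0 : ℝ) < 2 ^ r i * c i := by exact_mod_cast hc.b_pos r i
    calc 2 * ε ≤ 2 * (1 / (4 * (2 ^ r n * c n) * ((M : ℝ) + 1))) := by gcongr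
      _ = 1 / (2 * (2 ^ r n * c n) * ((M : ℝ) + 1)) := by
          rw [show (4 : ℝ) * (2 ^ r n * c n) * ((M : ℝ) + 1) =
            2 * (2 * (2 ^ r n * c n) * ((M : ℝ) + 1)) by ring]
          rw [one_div, mul_inv, ← mul_assoc]; norm_num
      _ ≤ _ := by gcongr
  have hprod : ((∏ i ∈ Finset.range (n + 1), c i : ℕ) : ℤ) ∣ (m' : ℤ) - m := by
    push_cast
    refine Finset.prod_dvd_of_coprime (fun i _ j _ hij =>
      Nat.isCoprime_iff_coprime.mpr (hc.coprime hij)) fun i hi => ?_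
    exact (hc.b_dvd_iff.mp (hdvd i hi)).2
  have h2 := (hc.b_dvd_iff.mp (hdvd n (by simp))).1
  have hall : ((2 ^ r n * ∏ i ∈ Finset.range (n + 1), c i : ℕ) : ℤ) ∣ (m' : ℤ) - m := by
    rw [Nat.cast_mul]
    exact IsCoprime.mul_dvd (Nat.isCoprime_iff_coprime.mpr
      (Nat.Coprime.prod_right fun i _ => hc.coprime_two_pow _ _)) h2 hprod
  exact Nat.ModEq.eq_of_lt_of_lt ((Nat.modEq_iff_dvd.mpr hall)) hm hm'

/-! ### From covering numbers along a sequence of scales to amorphic complexity -/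

section Scales

variable {A : Type*}

/-- Take the first index from n₀ on whose successor has scale below ε; no monotonicity of δ is
needed. -/
theorem exists_bracket {δ : ℕ → ℝ} (hδ : Tendsto δ atTop (𝓝 0)) {n₀ : ℕ} {ε : ℝ} (hε : 0 < ε)
    (h : ε ≤ δ n₀) : ∃ n, n₀ ≤ n ∧ δ (n + 1) < ε ∧ ε ≤ δ n := by
  classical
  have hex : ∃ k, n₀ ≤ k ∧ δ (k + 1) < ε := by
    obtain ⟨k, hk, hk'⟩ := (((tendsto_add_atTop_iff_nat 1).mpr hδ).eventually_lt_const hε |>.and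
      (eventually_ge_atTop n₀)).exists
    exact ⟨k, hk', hk⟩
  refine ⟨Nat.find hex, (Nat.find_spec hex).1, (Nat.find_spec hex).2, ?_⟩
  rcases (Nat.find_spec hex).1.eq_or_lt with heq | hlt
  · rwa [← heq]
  · by_contra! hcon
    refine Nat.find_min hex (m := Nat.find hex - 1) (by omega) ⟨by omega, ?_⟩
    rwa [Nat.sub_add_cancel (by omega)]

/-- For δ_{n+1} < ε ≤ δ_n the covering number is estimated at index n + 1 but ε^t at index n. This
mismatch of one index is what the slow growth of c has to absorb. -/
theorem tendsto_covNum_mul_rpow_zero {X : Set (ℤ → A)} {M : ℕ → ℕ} {δ : ℕ → ℝ}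
    (hδpos : ∀ n, 0 < δ n) (hδ : Tendsto δ atTop (𝓝 0))
    (hM : ∀ n ε, δ n < ε → covNum X ε ≤ M n) {t : ℝ} (ht : 0 ≤ t)
    (h : Tendsto (fun n => (M (n + 1) : ℝ) * δ n ^ t) atTop (𝓝 0)) :
    Tendsto (fun ε : ℝ => (covNum X ε : ENNReal) * ENNReal.ofReal (ε ^ t)) (𝓝[>] 0) (𝓝 0) := by
  rw [ENNReal.tendsto_nhds_zero]
  intro e he
  by_cases hetop : e = ⊤
  · simp [hetop]
  have hepos : 0 < e.toReal := ENNReal.toReal_pos he.ne' hetop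
  obtain ⟨n₀, hn₀⟩ := (h.eventually_lt_const hepos).exists_forall_of_atTop
  filter_upwards [Ioc_mem_nhdsGT (hδpos n₀)] with ε hε
  obtain ⟨n, hn, h1, h2⟩ := exists_bracket hδ hε.1 hε.2
  have h3 : (covNum X ε : ENNReal) ≤ (M (n + 1) : ENNReal) := by
    exact_mod_cast hM (n + 1) ε h1
  calc (covNum X ε : ENNReal) * ENNReal.ofReal (ε ^ t)
      ≤ (M (n + 1) : ENNReal) * ENNReal.ofReal (δ n ^ t) := by
        gcongr
        exact hε.1.le
    _ = ENNReal.ofReal ((M (n + 1) : ℝ) * δ n ^ t) := by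
        rw [ENNReal.ofReal_mul (by positivity), ENNReal.ofReal_natCast]
    _ ≤ ENNReal.ofReal e.toReal := ENNReal.ofReal_le_ofReal (hn₀ n hn).le
    _ = e := ENNReal.ofReal_toReal hetop

/-- The two exponents s ≤ t allow s to be negative: for ε ≤ 1 one has ε^s ≥ ε^t, so it suffices to
work with some nonnegative t. -/
theorem tendsto_covNum_mul_rpow_top {X : Set (ℤ → A)} {N : ℕ → ℕ} {δ : ℕ → ℝ}
    (hδpos : ∀ n, 0 < δ n) (hδ : Tendsto δ atTop (𝓝 0))
    (hN : ∀ n ε, ε ≤ δ n → (N n : ℕ∞) ≤ covNum X ε) {s t : ℝ} (hst : s ≤ t) (ht : 0 ≤ t)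
    (h : Tendsto (fun n => (N n : ℝ) * δ (n + 1) ^ t) atTop atTop) :
    Tendsto (fun ε : ℝ => (covNum X ε : ENNReal) * ENNReal.ofReal (ε ^ s)) (𝓝[>] 0) (𝓝 ⊤) := by
  rw [ENNReal.tendsto_nhds_top_iff_nat]
  intro K
  obtain ⟨n₀, hn₀⟩ := (h.eventually_gt_atTop (K : ℝ)).exists_forall_of_atTop
  filter_upwards [Ioc_mem_nhdsGT (hδpos n₀), Ioc_mem_nhdsGT (one_pos (α := ℝ))] with ε hε hε1
  obtain ⟨n, hn, h1, h2⟩ := exists_bracket hδ hε.1 hε.2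
  have h3 : (N n : ENNReal) ≤ (covNum X ε : ENNReal) := by
    exact_mod_cast hN n ε h2
  calc (K : ENNReal) = ENNReal.ofReal K := (ENNReal.ofReal_natCast K).symm
    _ < ENNReal.ofReal ((N n : ℝ) * δ (n + 1) ^ t) :=
        (ENNReal.ofReal_lt_ofReal_iff_of_nonneg (by positivity)).mpr (hn₀ n hn)
    _ = (N n : ENNReal) * ENNReal.ofReal (δ (n + 1) ^ t) := by
        rw [ENNReal.ofReal_mul (by positivity), ENNReal.ofReal_natCast]
    _ ≤ (covNum X ε : ENNReal) * ENNReal.ofReal (ε ^ s) := by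
        gcongr
        exact (Real.rpow_le_rpow (hδpos _).le h1.le ht).trans
          (Real.rpow_le_rpow_of_exponent_ge hε.1 hε1.2 hst)

end Scales

/-! ### Growth of the products `c_0 ⋯ c_n` -/

/-- The product `c_0 ⋯ c_n`, as a real number. -/
def cprod (c : ℕ → ℕ) (n : ℕ) : ℝ := ∏ i ∈ Finset.range (n + 1), (c i : ℝ)

theorem cprod_succ (c : ℕ → ℕ) (n : ℕ) : cprod c (n + 1) = cprod c n * c (n + 1) :=
  Finset.prod_range_succ _ _

theorem natCast_prod_eq_cprod (c : ℕ → ℕ) (n : ℕ) :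
    ((∏ i ∈ Finset.range (n + 1), c i : ℕ) : ℝ) = cprod c n := by
  simp [cprod]

namespace IsAdmissible

variable {c : ℕ → ℕ}

/-- Superexponential growth of the products is what makes 2^n negligible against every power of
them. -/
theorem factorial_le_cprod (hc : IsAdmissible c) (n : ℕ) : ((n + 1).factorial : ℝ) ≤ cprod c n := by
  rw [← natCast_prod_eq_cprod, ← Finset.prod_range_add_one_eq_factorial]
  refine Nat.cast_le.mpr (Finset.prod_le_prod' fun i _ => ?_)
  have := hc.add_three_le i
  omega

theorem three_pow_le_cprod (hc : IsAdmissible c) (n : ℕ) : (3 : ℝ) ^ (n + 1) ≤ cprod c n := by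
  rw [← natCast_prod_eq_cprod]
  have : 3 ^ (n + 1) ≤ ∏ i ∈ Finset.range (n + 1), c i := by
    calc 3 ^ (n + 1) = ∏ i ∈ Finset.range (n + 1), 3 := by simp
      _ ≤ _ := Finset.prod_le_prod' fun i _ => by have := hc.add_three_le i; omega
  exact_mod_cast this

theorem cprod_pos (hc : IsAdmissible c) (n : ℕ) : 0 < cprod c n :=
  lt_of_lt_of_le (by positivity) (hc.three_pow_le_cprod n)

theorem one_le_cprod (hc : IsAdmissible c) (n : ℕ) : 1 ≤ cprod c n :=
  (one_le_pow₀ (by norm_num)).trans (hc.three_pow_le_cprod n)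

theorem cast_succ_le_logb (hc : IsAdmissible c) (n : ℕ) : (n : ℝ) + 1 ≤ Real.logb 2 (cprod c n) := by
  rw [Real.le_logb_iff_rpow_le (by norm_num) (hc.cprod_pos n)]
  refine le_trans ?_ (hc.three_pow_le_cprod n)
  rw [show (n : ℝ) + 1 = ((n + 1 : ℕ) : ℝ) by push_cast; ring, Real.rpow_natCast]
  gcongr
  norm_num

theorem tendsto_cprod (hc : IsAdmissible c) : Tendsto (cprod c) atTop atTop :=
  tendsto_atTop_mono hc.three_pow_le_cprod
    ((tendsto_add_atTop_iff_nat 1).mpr (tendsto_pow_atTop_atTop_of_one_lt (by norm_num)))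

theorem eventually_const_le_rpow (hc : IsAdmissible c) (K : ℝ) {γ : ℝ} (hγ : 0 < γ) :
    ∀ᶠ n in atTop, K ≤ cprod c n ^ γ :=
  ((tendsto_rpow_atTop hγ).comp hc.tendsto_cprod).eventually_ge_atTop K

theorem eventually_logb_add_le_rpow (hc : IsAdmissible c) (K : ℝ) {γ : ℝ} (hγ : 0 < γ) :
    ∀ᶠ n in atTop, Real.logb 2 (cprod c n) + K ≤ cprod c n ^ γ := by
  have h1 := ((isLittleO_log_rpow_atTop hγ).comp_tendsto hc.tendsto_cprod).bound
    (show 0 < Real.log 2 / 2 by positivity)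
  filter_upwards [h1, hc.eventually_const_le_rpow (2 * K) hγ] with n h1 h2
  simp only [Function.comp_apply, Real.norm_eq_abs] at h1
  rw [abs_of_nonneg (Real.log_nonneg (hc.one_le_cprod n)),
    abs_of_nonneg (Real.rpow_nonneg (hc.cprod_pos n).le _)] at h1
  have h3 : Real.logb 2 (cprod c n) ≤ cprod c n ^ γ / 2 := by
    rw [Real.logb, div_le_iff₀ (by positivity)]
    linarith
  linarith

theorem eventually_two_pow_le_rpow (hc : IsAdmissible c) {γ : ℝ} (hγ : 0 < γ) :
    ∀ᶠ n in atTop, (2 : ℝ) ^ (n + 2) ≤ cprod c n ^ γ := by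
  -- With this K the claim becomes K^(n+2) ≤ c_0 ⋯ c_n, which follows from K^(n+1)/(n+1)! → 0. The
  -- exponent n + 2 is `linExp (n + 1)`.
  set K : ℝ := 2 ^ (1 / γ) with hK
  have hKpos : 0 < K := by positivity
  have h := ((tendsto_add_atTop_iff_nat 1).mpr
    (FloorSemiring.tendsto_pow_div_factorial_atTop K)).const_mul K
  rw [mul_zero] at h
  filter_upwards [h.eventually_lt_const one_pos] with n hn
  have hle : K ^ (n + 2) ≤ cprod c n := by
    refine le_trans ?_ (hc.factorial_le_cprod n)
    rw [← mul_div_assoc, div_lt_one (by positivity)] at hn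
    calc K ^ (n + 2) = K * K ^ (n + 1) := by ring
      _ ≤ _ := hn.le
  calc (2 : ℝ) ^ (n + 2) = (K ^ (n + 2)) ^ γ := by
        rw [← Real.rpow_natCast K, ← Real.rpow_mul hKpos.le, hK,
          ← Real.rpow_mul (zero_le_two (α := ℝ)), ← Real.rpow_natCast]
        congr 1
        field_simp
    _ ≤ _ := by gcongr

theorem eventually_c_succ_le_rpow (hc : IsAdmissible c) (hs : SlowGrowth c) {γ : ℝ} (hγ : 0 < γ) :
    ∀ᶠ n in atTop, (c (n + 1) : ℝ) ≤ cprod c n ^ γ := by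
  -- One half of γ is spent on the growth bound, the other half absorbs its implied constant K.
  obtain ⟨K, hK⟩ := (hs (γ / 2) (half_pos hγ)).bound
  filter_upwards [(tendsto_add_atTop_nat 1).eventually hK,
    hc.eventually_const_le_rpow K (half_pos hγ)] with n h1 h2
  have hp : 0 ≤ cprod c n ^ (γ / 2) := Real.rpow_nonneg (hc.cprod_pos n).le _
  rw [Real.norm_of_nonneg (by positivity)] at h1
  change (c (n + 1) : ℝ) ≤ K * ‖cprod c n ^ (γ / 2)‖ at h1
  rw [Real.norm_of_nonneg hp] at h1
  calc (c (n + 1) : ℝ) ≤ cprod c n ^ (γ / 2) * cprod c n ^ (γ / 2) := h1.trans (by gcongr)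
    _ = cprod c n ^ γ := by rw [← Real.rpow_add (hc.cprod_pos n), add_halves]

theorem eventually_cprod_succ_le_rpow (hc : IsAdmissible c) (hs : SlowGrowth c) {γ : ℝ}
    (hγ : 0 < γ) : ∀ᶠ n in atTop, cprod c (n + 1) ≤ cprod c n ^ (1 + γ) := by
  filter_upwards [hc.eventually_c_succ_le_rpow hs hγ] with n h
  rw [cprod_succ, Real.rpow_add (hc.cprod_pos n), Real.rpow_one]
  have := hc.cprod_pos n
  gcongr

end IsAdmissible

/-! ### Amorphic complexity for linear exponents -/

theorem linExp_monotone : Monotone linExp := fun _ _ h => Nat.succ_le_succ h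

/-- The scale at which `2^{r_n} c_0 ⋯ c_n` shifts are separated. -/
def sepScale (c r M : ℕ → ℕ) (n : ℕ) : ℝ := 1 / (4 * (2 ^ r n * c n) * ((M n : ℝ) + 1))

theorem sepScale_pos {c : ℕ → ℕ} (hc : IsAdmissible c) (r M : ℕ → ℕ) (n : ℕ) :
    0 < sepScale c r M n := by
  have : (0 : ℝ) < 2 ^ r n * c n := by exact_mod_cast hc.b_pos r n
  unfold sepScale
  positivity

theorem tendsto_sepScale {c : ℕ → ℕ} (hc : IsAdmissible c) (r M : ℕ → ℕ) :
    Tendsto (sepScale c r M) atTop (𝓝 0) := by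
  refine squeeze_zero (fun n => (sepScale_pos hc r M n).le) (fun n => ?_)
    tendsto_one_div_add_atTop_nhds_zero_nat
  unfold sepScale
  have h1 : (n : ℝ) + 1 ≤ c n := by
    exact_mod_cast (show n + 1 ≤ c n by have := hc.add_three_le n; omega)
  have h2 : (1 : ℝ) ≤ 2 ^ r n := one_le_pow₀ (by norm_num)
  have h3 : (1 : ℝ) ≤ (M n : ℝ) + 1 := by linarith [Nat.cast_nonneg (α := ℝ) (M n)]
  have h4 : (0 : ℝ) < (n : ℝ) + 1 := by positivity
  gcongr
  calc (n : ℝ) + 1 ≤ 1 * (1 * c n) * 1 := by linarith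
    _ ≤ _ := by gcongr; norm_num

/-- A lower bound for the separation scale in terms of upper bounds for its ingredients. -/
theorem rpow_neg_le_sepScale {c r M : ℕ → ℕ} (hc : IsAdmissible c) {n : ℕ} {x u v w γ : ℝ}
    (hx : 0 < x) (h4 : 4 ≤ x ^ γ) (hr : 2 ^ r n ≤ x ^ u) (hcn : (c n : ℝ) ≤ x ^ v)
    (hM : (M n : ℝ) + 1 ≤ x ^ w) : x ^ (-(γ + u + v + w)) ≤ sepScale c r M n := by
  have hb : (0 : ℝ) < 2 ^ r n * c n := by exact_mod_cast hc.b_pos r n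
  rw [Real.rpow_neg hx.le, ← one_div, sepScale]
  refine one_div_le_one_div_of_le (by positivity) ?_
  rw [Real.rpow_add hx, Real.rpow_add hx, Real.rpow_add hx, mul_assoc (x ^ γ)]
  gcongr

/-- At least C_n = c_0 ⋯ c_n shifts are separated at scale C_n^{-o(1)}, so the covering number
outgrows every power of 1/ε. -/
theorem hasAmorphicComplexity_top_linExp {c : ℕ → ℕ} (hc : IsAdmissible c) (hs : SlowGrowth c)
    {X : Set (ℤ → Fin 2)} (h₁ : orbit (etaSeq c linExp) ⊆ X) : HasAmorphicComplexity X ⊤ := by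
  refine ⟨le_top, fun t => ⟨fun h => absurd h not_top_lt, fun _ => ?_⟩⟩
  have hN := fun n ε (hε : ε ≤ sepScale c linExp (fun n => n + 1) n) =>
    le_covNum hc linExp_monotone (n := n) (M := n + 1)
      (fun j hj => by unfold linExp at hj; omega) h₁ hε
  have ht : 0 < max t 1 := lt_max_of_lt_right one_pos
  refine tendsto_covNum_mul_rpow_top (sepScale_pos hc linExp fun n => n + 1)
    (tendsto_sepScale hc _ _) hN (le_max_left t 1) ht.le ?_
  set s := max t 1
  -- Each of the four factors in the separation scale at index n + 1 costs at most C_n^γ. The scale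
  -- is thus at least C_n^{-4γ} = C_n^{-1/(2s)}, and its s-th power leaves C_n^{1/2}.
  set γ := 1 / (8 * s) with hγ
  have hγpos : 0 < γ := by positivity
  refine tendsto_atTop_mono' _ ?_ ((tendsto_rpow_atTop (half_pos one_pos)).comp hc.tendsto_cprod)
  filter_upwards [hc.eventually_const_le_rpow 4 hγpos, hc.eventually_two_pow_le_rpow hγpos,
    hc.eventually_c_succ_le_rpow hs hγpos, hc.eventually_logb_add_le_rpow 2 hγpos] with n h1 h2 h3 h4
  have hx := hc.cprod_pos n
  have h5 := rpow_neg_le_sepScale (r := linExp) (M := fun n => n + 1) hc hx h1 h2 h3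
    (show (((n + 1 + 1 : ℕ) : ℝ)) + 1 ≤ cprod c n ^ γ by
      push_cast
      linarith [hc.cast_succ_le_logb n])
  have h6 : cprod c n ≤ ((2 ^ linExp n * ∏ i ∈ Finset.range (n + 1), c i : ℕ) : ℝ) := by
    rw [Nat.cast_mul, natCast_prod_eq_cprod]
    exact le_mul_of_one_le_left hx.le (by exact_mod_cast Nat.one_le_two_pow)
  calc cprod c n ^ (1 / 2 : ℝ) = cprod c n * (cprod c n ^ (-(γ + γ + γ + γ))) ^ s := by
        rw [← Real.rpow_mul hx.le, ← Real.rpow_one_add' hx.le]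
        · congr 1
          rw [hγ]; field_simp; norm_num
        · rw [hγ]; field_simp; norm_num
    _ ≤ _ := by gcongr

/-! ### Amorphic complexity for logarithmic exponents -/

section LogExp

variable {c : ℕ → ℕ}

theorem logExp_eq (c : ℕ → ℕ) (κ : ℝ) (n : ℕ) :
    logExp c κ n = ⌊κ * Real.logb 2 (cprod c n)⌋₊ := rfl

theorem logExp_monotone (hc : IsAdmissible c) {κ : ℝ} (hκ : 0 < κ) : Monotone (logExp c κ) := by
  refine monotone_nat_of_le_succ fun n => ?_
  rw [logExp_eq, logExp_eq, cprod_succ]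
  have h1 := hc.cprod_pos n
  have h2 : (1 : ℝ) ≤ c (n + 1) := by exact_mod_cast hc.pos (n + 1)
  gcongr
  · norm_num
  · exact le_mul_of_one_le_right h1.le h2

theorem tendsto_logExp (hc : IsAdmissible c) {κ : ℝ} (hκ : 0 < κ) :
    Tendsto (logExp c κ) atTop atTop := by
  refine tendsto_nat_floor_atTop.comp (Tendsto.const_mul_atTop hκ ?_)
  exact (Real.tendsto_logb_atTop (by norm_num)).comp hc.tendsto_cprod

/-- Together with `rpow_le_two_mul_two_pow_logExp` this says that 2^{r_n} equals (c_0 ⋯ c_n)^κ up to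
a factor 2, the cost of the floor. -/
theorem two_pow_logExp_le (hc : IsAdmissible c) {κ : ℝ} (hκ : 0 < κ) (n : ℕ) :
    (2 : ℝ) ^ logExp c κ n ≤ cprod c n ^ κ := by
  have hx := hc.cprod_pos n
  have h0 : 0 ≤ κ * Real.logb 2 (cprod c n) :=
    mul_nonneg hκ.le (Real.logb_nonneg (by norm_num) (hc.one_le_cprod n))
  calc (2 : ℝ) ^ logExp c κ n = 2 ^ ((logExp c κ n : ℕ) : ℝ) := (Real.rpow_natCast _ _).symm
    _ ≤ 2 ^ (κ * Real.logb 2 (cprod c n)) := by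
        gcongr
        · norm_num
        · exact Nat.floor_le h0
    _ = cprod c n ^ κ := by
        rw [mul_comm, Real.rpow_mul (by norm_num), Real.rpow_logb (by norm_num) (by norm_num) hx]

theorem rpow_le_two_mul_two_pow_logExp (hc : IsAdmissible c) (κ : ℝ) (n : ℕ) :
    cprod c n ^ κ ≤ 2 * 2 ^ logExp c κ n := by
  have hx := hc.cprod_pos n
  calc cprod c n ^ κ = 2 ^ (κ * Real.logb 2 (cprod c n)) := by
        rw [mul_comm, Real.rpow_mul (by norm_num), Real.rpow_logb (by norm_num) (by norm_num) hx]
    _ ≤ 2 ^ (((logExp c κ n + 1 : ℕ) : ℝ)) := by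
        gcongr
        · norm_num
        · push_cast
          exact (Nat.lt_floor_add_one _).le
    _ = 2 * 2 ^ logExp c κ n := by rw [Real.rpow_natCast, pow_succ, mul_comm]

/-- For small κ the floor can give r_j = r_n with j > n. Since κ(j+1) ≤ κ log₂(c_0 ⋯ c_j) < r_j + 1,
such j are still only logarithmic in c_0 ⋯ c_n, so the sieve loss stays negligible. -/
theorem lt_of_logExp_le (hc : IsAdmissible c) {κ : ℝ} (hκ : 0 < κ) {j n : ℕ}
    (h : logExp c κ j ≤ logExp c κ n) : j < ⌈Real.logb 2 (cprod c n) + 1 / κ⌉₊ := by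
  rw [Nat.lt_ceil]
  have h1 : κ * Real.logb 2 (cprod c j) < logExp c κ j + 1 := Nat.lt_floor_add_one _
  have h2 : (logExp c κ n : ℝ) ≤ κ * Real.logb 2 (cprod c n) := Nat.floor_le
    (mul_nonneg hκ.le (Real.logb_nonneg (by norm_num) (hc.one_le_cprod n)))
  have h3 : (logExp c κ j : ℝ) ≤ logExp c κ n := by exact_mod_cast h
  have h4 := mul_le_mul_of_nonneg_left (hc.cast_succ_le_logb j) hκ.le
  have h5 : κ * (j : ℝ) < κ * (Real.logb 2 (cprod c n) + 1 / κ) := by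
    rw [mul_add, mul_one_div_cancel hκ.ne']
    nlinarith
  exact lt_of_mul_lt_mul_left h5 hκ.le

theorem tendsto_covNum_logExp_zero (hc : IsAdmissible c) (hs : SlowGrowth c) {κ : ℝ} (hκ : 0 < κ)
    {X : Set (ℤ → Fin 2)} (h₁ : orbit (etaSeq c (logExp c κ)) ⊆ X)
    (h₂ : X ⊆ orbitClosure (etaSeq c (logExp c κ))) {t : ℝ} (ht : (1 + κ) / κ < t) :
    Tendsto (fun ε : ℝ => (covNum X ε : ENNReal) * ENNReal.ofReal (ε ^ t)) (𝓝[>] 0) (𝓝 0) := by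
  have hmono := logExp_monotone hc hκ
  have htpos : 0 < t := lt_trans (by positivity) ht
  rw [div_lt_iff₀ hκ] at ht
  refine tendsto_covNum_mul_rpow_zero (δ := fun n => 1 / 2 ^ logExp c κ n)
    (M := fun n => 2 ^ logExp c κ n * ∏ i ∈ Finset.range (n + 1), c i) (fun n => by positivity)
    -- With N = r_n the choice J = {0, …, n} is admissible even if later exponents equal r_n, since
    -- the conditions on J leave indices with r_i = N free.
    ?_ (fun n ε hε => covNum_le hc (fun i hi => hmono ?_) (fun i hi => hmono ?_) h₁ h₂ hε)
    htpos.le ?_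
  · have := (tendsto_pow_atTop_nhds_zero_of_lt_one (r := (1 / 2 : ℝ)) (by norm_num)
      (by norm_num)).comp (tendsto_logExp hc hκ)
    simpa [Function.comp_def] using this
  · simp only [Finset.mem_range, not_lt] at hi; omega
  · simp only [Finset.mem_range] at hi; omega
  -- The count C_{n+1}^{1+κ} is at most C_n^{(1+γ)(1+κ)}, while ε^t contributes C_n^{-κt} up to a
  -- constant. The witness γ uses up half of the gap κt - (1 + κ).
  obtain ⟨γ, hγ, hγt⟩ : ∃ γ : ℝ, 0 < γ ∧ (1 + γ) * (1 + κ) - κ * t < 0 := by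
    refine ⟨(κ * t - (1 + κ)) / (2 * (1 + κ)), div_pos (by linarith) (by linarith), ?_⟩
    field_simp
    nlinarith
  have hlim : Tendsto (fun n => (2 : ℝ) ^ t * cprod c n ^ ((1 + γ) * (1 + κ) - κ * t)) atTop
      (𝓝 0) := by
    have := ((tendsto_rpow_neg_atTop (neg_pos.mpr hγt)).comp hc.tendsto_cprod).const_mul
      ((2 : ℝ) ^ t)
    simpa [Function.comp_def] using this
  refine squeeze_zero' (Eventually.of_forall fun n => by positivity) ?_ hlim
  filter_upwards [hc.eventually_cprod_succ_le_rpow hs hγ] with n h1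
  have hx := hc.cprod_pos n
  have hx' := hc.cprod_pos (n + 1)
  rw [Nat.cast_mul, natCast_prod_eq_cprod]
  push_cast
  calc (2 : ℝ) ^ logExp c κ (n + 1) * cprod c (n + 1) * (1 / 2 ^ logExp c κ n) ^ t
      ≤ cprod c (n + 1) ^ κ * cprod c (n + 1) * (2 / cprod c n ^ κ) ^ t := by
        refine mul_le_mul ?_ (Real.rpow_le_rpow (by positivity) ?_ htpos.le) (by positivity)
          (by positivity)
        · gcongr
          exact two_pow_logExp_le hc hκ _
        · rw [div_le_div_iff₀ (by positivity) (by positivity), one_mul]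
          exact rpow_le_two_mul_two_pow_logExp hc κ n
    _ = cprod c (n + 1) ^ (1 + κ) * (2 / cprod c n ^ κ) ^ t := by
        rw [add_comm 1 κ, Real.rpow_add_one hx'.ne']
    _ ≤ (cprod c n ^ (1 + γ)) ^ (1 + κ) * (2 / cprod c n ^ κ) ^ t := by gcongr
    _ = _ := by
        rw [Real.div_rpow (by norm_num) (by positivity), ← Real.rpow_mul hx.le,
          ← Real.rpow_mul hx.le, Real.rpow_sub hx]
        ring

theorem tendsto_covNum_logExp_top (hc : IsAdmissible c) (hs : SlowGrowth c) {κ : ℝ} (hκ : 0 < κ)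
    {X : Set (ℤ → Fin 2)} (h₁ : orbit (etaSeq c (logExp c κ)) ⊆ X) {t : ℝ}
    (ht : t < (1 + κ) / κ) :
    Tendsto (fun ε : ℝ => (covNum X ε : ENNReal) * ENNReal.ofReal (ε ^ t)) (𝓝[>] 0) (𝓝 ⊤) := by
  have hN := fun n ε (hε : ε ≤ sepScale c (logExp c κ)
      (fun n => ⌈Real.logb 2 (cprod c n) + 1 / κ⌉₊) n) =>
    le_covNum hc (logExp_monotone hc hκ) (n := n) (M := ⌈Real.logb 2 (cprod c n) + 1 / κ⌉₊)
      (fun j hj => lt_of_logExp_le hc hκ hj) h₁ hε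
  refine tendsto_covNum_mul_rpow_top (sepScale_pos hc _ _)
    (tendsto_sepScale hc _ _) hN (le_max_left t 0) (le_max_right _ _) ?_
  have hs0 : max t 0 < (1 + κ) / κ := max_lt ht (by positivity)
  have hs1 : 0 ≤ max t 0 := le_max_right _ _
  set s := max t 0
  rw [lt_div_iff₀ hκ] at hs0
  -- The terms multiplied by s bound, as exponents of C_n, the constant 4, 2^{r_{n+1}}, c_{n+1} and
  -- the sieve loss. At γ = 0 the expression is 1 + κ - κs > 0, so by continuity a small positive γ
  -- will do.
  obtain ⟨γ, hγ, hγs⟩ : ∃ γ : ℝ, 0 < γ ∧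
      0 < 1 + κ + -(γ + (1 + γ) * κ + γ + (1 + γ) * γ) * s := by
    have hcont : Continuous fun γ : ℝ => 1 + κ + -(γ + (1 + γ) * κ + γ + (1 + γ) * γ) * s := by
      fun_prop
    have h0 : 0 < (fun γ : ℝ => 1 + κ + -(γ + (1 + γ) * κ + γ + (1 + γ) * γ) * s) 0 := by
      simp only; nlinarith
    have := (hcont.continuousAt.eventually_const_lt h0).filter_mono
      (nhdsWithin_le_nhds (s := Set.Ioi (0 : ℝ)))
    obtain ⟨γ, h1, h2⟩ := (this.and (self_mem_nhdsWithin (s := Set.Ioi (0 : ℝ)))).exists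
    exact ⟨γ, h2, h1⟩
  refine tendsto_atTop_mono' _ ?_
    (((tendsto_rpow_atTop hγs).comp hc.tendsto_cprod).const_mul_atTop (half_pos one_pos))
  filter_upwards [hc.eventually_const_le_rpow 4 hγ, hc.eventually_c_succ_le_rpow hs hγ,
    hc.eventually_cprod_succ_le_rpow hs hγ,
    (tendsto_add_atTop_nat 1).eventually (hc.eventually_logb_add_le_rpow (1 / κ + 2) hγ)]
    with n h1 h2 h3 h4
  have hx := hc.cprod_pos n
  have hx' := hc.cprod_pos (n + 1)
  have h5 := rpow_neg_le_sepScale (r := logExp c κ)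
    (M := fun n => ⌈Real.logb 2 (cprod c n) + 1 / κ⌉₊) (n := n + 1) hc hx h1
    (u := (1 + γ) * κ) (w := (1 + γ) * γ)
    ((two_pow_logExp_le hc hκ _).trans (by rw [Real.rpow_mul hx.le]; gcongr)) h2 (by
      have h6 : 0 ≤ Real.logb 2 (cprod c (n + 1)) + 1 / κ :=
        add_nonneg (Real.logb_nonneg (by norm_num) (hc.one_le_cprod _)) (by positivity)
      calc _ ≤ Real.logb 2 (cprod c (n + 1)) + 1 / κ + 1 + 1 := by
            gcongr
            exact (Nat.ceil_lt_add_one h6).le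
        _ ≤ cprod c (n + 1) ^ γ := by linarith
        _ ≤ _ := by rw [Real.rpow_mul hx.le]; gcongr)
  have h6 : 1 / 2 * cprod c n ^ (1 + κ) ≤
      ((2 ^ logExp c κ n * ∏ i ∈ Finset.range (n + 1), c i : ℕ) : ℝ) := by
    rw [Nat.cast_mul, natCast_prod_eq_cprod, add_comm 1 κ, Real.rpow_add_one hx.ne']
    push_cast
    rw [← mul_assoc]
    gcongr
    linarith [rpow_le_two_mul_two_pow_logExp hc κ n]
  calc _ = 1 / 2 * cprod c n ^ (1 + κ) *
        (cprod c n ^ (-(γ + (1 + γ) * κ + γ + (1 + γ) * γ))) ^ s := by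
        rw [← Real.rpow_mul hx.le, mul_assoc, ← Real.rpow_add hx]
        rfl
    _ ≤ _ := by gcongr

theorem hasAmorphicComplexity_logExp (hc : IsAdmissible c) (hs : SlowGrowth c) {κ : ℝ} (hκ : 0 < κ)
    {X : Set (ℤ → Fin 2)} (h₁ : orbit (etaSeq c (logExp c κ)) ⊆ X)
    (h₂ : X ⊆ orbitClosure (etaSeq c (logExp c κ))) :
    HasAmorphicComplexity X (((1 + κ) / κ : ℝ) : EReal) := by
  refine ⟨by exact_mod_cast (by positivity : 0 ≤ (1 + κ) / κ), fun t => ⟨fun h => ?_, fun h => ?_⟩⟩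
  · exact tendsto_covNum_logExp_zero hc hs hκ h₁ h₂ (EReal.coe_lt_coe_iff.mp h)
  · exact tendsto_covNum_logExp_top hc hs hκ h₁ (EReal.coe_lt_coe_iff.mp h)

end LogExp

/-! ### Equivariance under powers, and windows -/

section Windows

theorem map_zpow_apply {X Y : Type*} [TopologicalSpace X] [TopologicalSpace Y] {T : X ≃ₜ X}
    {S : Y ≃ₜ Y} {f : X → Y} (h : ∀ x, f (T x) = S (f x)) (n : ℤ) (x : X) :
    f ((T ^ n) x) = (S ^ n) (f x) := by
  have hinv : ∀ x, f (T⁻¹ x) = S⁻¹ (f x) := fun x => by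
    apply S.injective
    rw [← h]
    change f (T (T.symm x)) = S (S.symm (f x))
    simp
  induction n generalizing x with
  | zero => rfl
  | succ n ih =>
    rw [zpow_add_one, zpow_add_one]
    change f ((T ^ (n : ℤ)) (T x)) = (S ^ (n : ℤ)) (S (f x))
    rw [ih, h]
  | pred n ih =>
    rw [zpow_sub_one, zpow_sub_one]
    change f ((T ^ (-(n : ℤ))) (T⁻¹ x)) = (S ^ (-(n : ℤ))) (S⁻¹ (f x))
    rw [ih, hinv]

variable {A : Type*} [TopologicalSpace A]

theorem shiftHomeo_zpow_apply (n : ℤ) (x : ℤ → A) :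
    ((shiftHomeo : (ℤ → A) ≃ₜ (ℤ → A)) ^ n) x = shift n x := by
  induction n generalizing x with
  | zero => ext i; simp
  | succ n ih =>
    rw [zpow_add_one]
    change ((shiftHomeo : (ℤ → A) ≃ₜ (ℤ → A)) ^ (n : ℤ)) (shift 1 x) = _
    rw [ih]
    ext i
    change x (1 + (n + i)) = x (n + 1 + i)
    congr 1; ring
  | pred n ih =>
    rw [zpow_sub_one]
    change ((shiftHomeo : (ℤ → A) ≃ₜ (ℤ → A)) ^ (-(n : ℤ))) (shift (-1) x) = _
    rw [ih]
    ext i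
    change x (-1 + (-n + i)) = x (-n - 1 + i)
    congr 1; ring

theorem coe_subshiftHomeo_zpow (x : ℤ → A) (n : ℤ) (y : orbitClosure x) :
    (((subshiftHomeo x ^ n) y : orbitClosure x) : ℤ → A) = shift n (y : ℤ → A) := by
  rw [← shiftHomeo_zpow_apply]
  exact map_zpow_apply (f := Subtype.val) (fun _ => rfl) n y

/-- In a compact space of sequences, points that agree on a long window are close. -/
theorem exists_window [T2Space A] {X : Set (ℤ → A)} [CompactSpace X] {V : Set (X × X)}
    (hV : IsOpen V) (hdiag : ∀ x, (x, x) ∈ V) :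
    ∃ m : ℕ, ∀ x y : X, (∀ k ∈ Finset.Icc (-(m : ℤ)) m, (x : ℤ → A) k = (y : ℤ → A) k) →
      (x, y) ∈ V := by
  -- These sets decrease to the diagonal, which misses the compact complement of V, so one of them
  -- already misses it.
  have hclosed : ∀ m : ℕ, IsClosed {p : X × X | ∀ k ∈ Finset.Icc (-(m : ℤ)) m,
      (p.1 : ℤ → A) k = (p.2 : ℤ → A) k} := fun m => by
    simp only [Set.ofPred_forall]
    exact isClosed_iInter fun k => isClosed_iInter fun _ => isClosed_eq
      ((continuous_apply k).comp (continuous_subtype_val.comp continuous_fst))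
      ((continuous_apply k).comp (continuous_subtype_val.comp continuous_snd))
  have hempty : Vᶜ ∩ ⋂ m : ℕ, {p : X × X | ∀ k ∈ Finset.Icc (-(m : ℤ)) m,
      (p.1 : ℤ → A) k = (p.2 : ℤ → A) k} = ∅ := by
    refine Set.eq_empty_iff_forall_notMem.mpr ?_
    rintro ⟨x, y⟩ ⟨h1, h2⟩
    refine h1 ?_
    have : x = y := by
      ext k
      exact Set.mem_iInter.mp h2 k.natAbs k (Finset.mem_Icc.mpr (by omega))
    rw [this]
    exact hdiag y
  obtain ⟨m, hm⟩ := hV.isClosed_compl.isCompact.elim_directed_family_closed _ hclosed hempty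
    (directed_of_isDirected_le fun m n hmn p hp k hk => hp k (by
      rw [Finset.mem_Icc] at hk ⊢
      omega))
  refine ⟨m, fun x y h => ?_⟩
  by_contra hcon
  exact (Set.eq_empty_iff_forall_notMem.mp hm) (x, y) ⟨hcon, h⟩

end Windows

/-! ### Comparison of covering numbers -/

section Comparison

universe u

variable {A : Type*}

theorem covNum_antitone (X : Set (ℤ → A)) : Antitone (covNum X) := fun _ _ h =>
  le_iInf₂ fun C hC => iInf₂_le C ⟨hC.1, fun x hx =>
    (hC.2 x hx).imp fun _ hc => ⟨hc.1, hc.2.trans_le h⟩⟩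

theorem covNum_le_of_lipschitz {B : Type*} {X : Set (ℤ → A)} {Y : Set (ℤ → B)} (f : X → Y)
    (hf : Function.Surjective f) {K : ℝ} (hK : 0 < K)
    (h : ∀ x y : X, d1 (f x : ℤ → B) (f y) ≤ K * d1 (x : ℤ → A) y) (ε : ℝ) :
    covNum Y (K * ε) ≤ covNum X ε := by
  refine le_iInf₂ fun C hC => ?_
  refine (iInf₂_le ((fun c : X => (f c : ℤ → B)) '' (Subtype.val ⁻¹' C)) ?_).trans ?_
  · constructor
    · rintro _ ⟨c, -, rfl⟩
      exact (f c).2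
    · intro y hy
      obtain ⟨x, hx⟩ := hf ⟨y, hy⟩
      obtain ⟨c, hc, hd⟩ := hC.2 x x.2
      refine ⟨_, ⟨⟨c, hC.1 hc⟩, hc, rfl⟩, ?_⟩
      have := h ⟨c, hC.1 hc⟩ x
      rw [hx] at this
      exact this.trans_lt (mul_lt_mul_of_pos_left hd hK)
  · exact (Set.encard_image_le _ _).trans (Set.encard_le_encard_of_injOn (f := Subtype.val)
      (fun _ h => h) Subtype.val_injective.injOn)

/-- For a real t strictly between α and β the left side, multiplied by ε^t, would tend to ∞ and the
right side to 0; rescaling ε by M only costs the constant M^t. -/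
theorem amorphicComplexity_le {B : Type*} {X : Set (ℤ → A)} {Y : Set (ℤ → B)} {α β : EReal}
    (hX : HasAmorphicComplexity X α) (hY : HasAmorphicComplexity Y β) {M : ℝ} (hM : 0 < M)
    (h : ∀ ε, 0 < ε → covNum Y (M * ε) ≤ covNum X ε) : β ≤ α := by
  by_contra! hlt
  obtain ⟨t, h1, h2⟩ := EReal.lt_iff_exists_real_btwn.mp hlt
  have hx := (hX.2 t).1 h1
  have hy := (hY.2 t).2 h2
  have hmul : Tendsto (fun ε : ℝ => M * ε) (𝓝[>] 0) (𝓝[>] 0) := by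
    refine tendsto_nhdsWithin_iff.mpr ⟨?_, ?_⟩
    · have : Tendsto (fun ε : ℝ => M * ε) (𝓝 0) (𝓝 (M * 0)) := tendsto_id.const_mul M
      rw [mul_zero] at this
      exact this.mono_left nhdsWithin_le_nhds
    · filter_upwards [self_mem_nhdsWithin] with ε hε
      exact mul_pos hM hε
  have hx' := ENNReal.Tendsto.mul_const (b := ENNReal.ofReal (M ^ t)) hx
    (Or.inr ENNReal.ofReal_ne_top)
  rw [zero_mul] at hx'
  have hle : ∀ᶠ ε in 𝓝[>] (0 : ℝ), (covNum Y (M * ε) : ENNReal) * ENNReal.ofReal ((M * ε) ^ t) ≤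
      (covNum X ε : ENNReal) * ENNReal.ofReal (ε ^ t) * ENNReal.ofReal (M ^ t) := by
    filter_upwards [self_mem_nhdsWithin] with ε hε
    have hε' : (0 : ℝ) < ε := hε
    rw [mul_assoc, ← ENNReal.ofReal_mul (by positivity), Real.mul_rpow hM.le hε'.le, mul_comm (M ^ t)]
    gcongr
    exact h ε hε
  have := le_of_tendsto_of_tendsto (hy.comp hmul) hx' hle
  exact absurd this (by simp)

theorem ScaleEquiv.amorphicComplexity_eq {B : Type*} {X : Set (ℤ → A)} {Y : Set (ℤ → B)}
    {α β : EReal} (h : ScaleEquiv (covNum X) (covNum Y)) (hX : HasAmorphicComplexity X α)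
    (hY : HasAmorphicComplexity Y β) : α = β := by
  obtain ⟨M, hM, h⟩ := h
  refine le_antisymm (amorphicComplexity_le hY hX hM fun ε hε => (h ε hε).1)
    (amorphicComplexity_le hX hY hM fun ε hε => ?_)
  have := (h (M * ε) (by positivity)).2
  rwa [inv_mul_cancel_left₀ hM.ne'] at this

theorem applyCode_shift {m : ℕ} (C : (Fin (2 * m + 1) → A) → A) (n : ℤ) (x : ℤ → A) :
    applyCode C (shift n x) = shift n (applyCode C x) := by
  ext i
  change C (fun j => x (n + (i - m + (j : ℕ)))) = C fun j => x (n + i - m + (j : ℕ))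
  congr 1
  ext j
  congr 1
  ring

theorem d1_applyCode_le {m : ℕ} (C : (Fin (2 * m + 1) → A) → A) (x y : ℤ → A) :
    d1 (applyCode C x) (applyCode C y) ≤ (2 * m + 1) * d1 x y := by
  refine d1_le_of_local m fun i h => ?_
  refine congrArg C (funext fun j => ?_)
  have := h (-(m : ℤ) + (j : ℕ)) (Finset.mem_Icc.mpr (by omega))
  rwa [← add_assoc, ← sub_eq_add_neg] at this

theorem covNum_orbit_applyCode_le {m : ℕ} (C : (Fin (2 * m + 1) → A) → A) {x y : ℤ → A}
    (h : applyCode C x = y) (ε : ℝ) :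
    covNum (orbit y) ((2 * m + 1) * ε) ≤ covNum (orbit x) ε := by
  refine covNum_le_of_lipschitz (fun z : orbit x => (⟨applyCode C z, by
    obtain ⟨_, n, rfl⟩ := z
    exact ⟨n, by simp only [applyCode_shift, h]⟩⟩ : orbit y)) ?_
      (by positivity : (0 : ℝ) < 2 * m + 1) (fun z w =>
      d1_applyCode_le C z w) ε
  rintro ⟨_, n, rfl⟩
  exact ⟨⟨shift n x, n, rfl⟩, Subtype.ext (by simp only [applyCode_shift, h])⟩

theorem BlockCodeEquiv.scaleEquiv {x y : ℤ → A} (h : BlockCodeEquiv x y) :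
    ScaleEquiv (covNum (orbit x)) (covNum (orbit y)) := by
  obtain ⟨⟨m, C, hC⟩, ⟨m', C', hC'⟩⟩ := h
  have hM : (0 : ℝ) < max (2 * (m : ℝ) + 1) (2 * (m' : ℝ) + 1) :=
    lt_max_of_lt_left (by positivity : (0 : ℝ) < 2 * m + 1)
  refine ⟨max (2 * (m : ℝ) + 1) (2 * (m' : ℝ) + 1), hM, fun ε hε => ⟨?_, ?_⟩⟩
  · refine le_trans (covNum_antitone _ ?_) (covNum_orbit_applyCode_le C' hC' ε)
    gcongr
    exact le_max_right _ _
  · refine le_trans (covNum_antitone _ ?_) (covNum_orbit_applyCode_le C hC _)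
    rw [← mul_assoc, ← div_eq_mul_inv]
    exact mul_le_of_le_one_left hε.le ((div_le_one hM).mpr (le_max_left _ _))

/-- This is the Curtis–Hedlund–Lyndon argument: coordinate 0 of the image depends on a finite
window, so by equivariance the conjugacy is a local rule and therefore Lipschitz for `d1`. -/
theorem Conjugate.exists_covNum_le [TopologicalSpace A] [DiscreteTopology A] [CompactSpace A]
    {x y : ℤ → A} (h : Conjugate (subshiftHomeo x) (subshiftHomeo y)) :
    ∃ M : ℝ, 0 < M ∧ ∀ ε, 0 < ε →
      covNum (orbitClosure y) (M * ε) ≤ covNum (orbitClosure x) ε := by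
  obtain ⟨h, hh⟩ := h
  have hcont : Continuous fun z : orbitClosure x => (h z : ℤ → A) 0 :=
    (continuous_apply 0).comp (continuous_subtype_val.comp h.continuous)
  obtain ⟨m, hm⟩ := exists_window (X := orbitClosure x)
    (V := (fun p : orbitClosure x × orbitClosure x => ((h p.1 : ℤ → A) 0, (h p.2 : ℤ → A) 0)) ⁻¹'
      Set.diagonal A)
    ((isOpen_discrete _).preimage
      ((hcont.comp continuous_fst).prodMk (hcont.comp continuous_snd))) (fun _ => rfl)
  refine ⟨2 * m + 1, by positivity, fun ε _ => covNum_le_of_lipschitz h h.surjective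
    (by positivity) (fun z w => d1_le_of_local m fun i hi => ?_) ε⟩
  have key : ∀ z : orbitClosure x, (h z : ℤ → A) i = (h ((subshiftHomeo x ^ i) z) : ℤ → A) 0 := by
    intro z
    rw [map_zpow_apply hh, coe_subshiftHomeo_zpow]
    simp
  rw [key, key]
  refine hm _ _ fun k hk => ?_
  rw [coe_subshiftHomeo_zpow, coe_subshiftHomeo_zpow]
  exact hi k hk

theorem Conjugate.symm {X Y : Type u} [TopologicalSpace X] [TopologicalSpace Y] {T : X ≃ₜ X}
    {S : Y ≃ₜ Y} (h : Conjugate T S) : Conjugate S T := by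
  obtain ⟨h, hh⟩ := h
  exact ⟨h.symm, fun y => h.injective (by simp [hh])⟩

theorem Conjugate.amorphicComplexity_eq [TopologicalSpace A] [DiscreteTopology A] [CompactSpace A]
    {x y : ℤ → A} (h : Conjugate (subshiftHomeo x) (subshiftHomeo y)) {α β : EReal}
    (hx : HasAmorphicComplexity (orbitClosure x) α)
    (hy : HasAmorphicComplexity (orbitClosure y) β) : α = β := by
  obtain ⟨M, hM, h1⟩ := h.exists_covNum_le
  obtain ⟨M', hM', h2⟩ := h.symm.exists_covNum_le
  exact le_antisymm (amorphicComplexity_le hy hx hM' h2) (amorphicComplexity_le hx hy hM h1)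

theorem inequivalent_of_amorphicComplexity_ne [TopologicalSpace A] [DiscreteTopology A]
    [CompactSpace A] {x y : ℤ → A} {α β : EReal} (hαβ : α ≠ β)
    (hx : HasAmorphicComplexity (orbit x) α ∧ HasAmorphicComplexity (orbitClosure x) α)
    (hy : HasAmorphicComplexity (orbit y) β ∧ HasAmorphicComplexity (orbitClosure y) β) :
    ¬ ScaleEquiv (covNum (orbit x)) (covNum (orbit y)) ∧ ¬ BlockCodeEquiv x y ∧
      ¬ Conjugate (subshiftHomeo x) (subshiftHomeo y) :=
  ⟨fun h => hαβ (h.amorphicComplexity_eq hx.1 hy.1),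
    fun h => hαβ (h.scaleEquiv.amorphicComplexity_eq hx.1 hy.1),
    fun h => hαβ (h.amorphicComplexity_eq hx.2 hy.2)⟩

end Comparison

/-! ### Toeplitz structure, minimality and entropy -/

theorem exists_level {r : ℕ → ℕ} (hr : Tendsto r atTop atTop) (N : ℕ) :
    ∃ J : Finset ℕ, (∀ i, i ∉ J → N ≤ r i) ∧ ∀ i ∈ J, r i ≤ N := by
  obtain ⟨J, hJ⟩ := exists_finset_lt hr N
  exact ⟨J, fun i hi => not_lt.mp fun h => hi ((hJ i).mpr h), fun i hi => ((hJ i).mp hi).le⟩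

theorem mem_perSet_of_not_dvd {c r : ℕ → ℕ} {N : ℕ} {J : Finset ℕ} (hJ : ∀ i, i ∉ J → N ≤ r i)
    (hJ' : ∀ i ∈ J, r i ≤ N) {n : ℤ} (hn : ¬ (2 ^ N : ℤ) ∣ n) :
    n ∈ perSet (etaSeq c r) (2 ^ N * ∏ i ∈ J, c i) := fun k =>
  (etaSeq_eq_of_modEq hJ hJ' (by simp [Int.ModEq]) hn).symm

theorem not_two_pow_dvd {n : ℤ} (hn : n ≠ 0) : ¬ (2 ^ n.natAbs : ℤ) ∣ n := fun h => by
  have h1 := Int.natAbs_le_of_dvd_ne_zero h hn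
  rw [Int.natAbs_pow] at h1
  exact absurd h1 (not_le.mpr Nat.lt_two_pow_self)

/-- A nonzero n escapes some power of 2 and is covered by the skeleton of that level; at 0 the
period b_0 works, since η vanishes on its multiples. -/
theorem isToeplitz_etaSeq {c r : ℕ → ℕ} (hc : IsAdmissible c) (hr : Tendsto r atTop atTop) :
    IsToeplitz (etaSeq c r) := by
  intro n
  by_cases hn : n = 0
  · refine ⟨2 ^ r 0 * c 0, hc.b_pos r 0, fun k => ?_⟩
    rw [hn, etaSeq_eq_zero_iff.mpr ⟨0, dvd_zero _⟩]
    exact etaSeq_eq_zero_iff.mpr ⟨0, by simp⟩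
  · obtain ⟨J, hJ, hJ'⟩ := exists_level hr n.natAbs
    exact ⟨_, hc.level_pos _ J, mem_perSet_of_not_dvd hJ hJ' (not_two_pow_dvd hn)⟩

theorem isRegularToeplitz_etaSeq {c r : ℕ → ℕ} (hc : IsAdmissible c)
    (hr : Tendsto r atTop atTop) : IsRegularToeplitz (etaSeq c r) := by
  classical
  refine ⟨isToeplitz_etaSeq hc hr, fun δ hδ => ?_⟩
  obtain ⟨N, hN⟩ := exists_pow_lt_of_lt_one hδ (show (1 / 2 : ℝ) < 1 by norm_num)
  obtain ⟨J, hJ, hJ'⟩ := exists_level hr N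
  set Q := ∏ i ∈ J, c i with hQ
  have hQpos : 0 < Q := Finset.prod_pos fun i _ => hc.pos i
  have hP := hc.level_pos N J
  refine ⟨2 ^ N * Q, hP, ?_⟩
  -- Only the Q multiples of 2^N in one period may fail to be periodic, a proportion of 2^{-N}.
  have hcard : (2 ^ N * Q : ℕ) - Q ≤ ((Finset.Ico (0 : ℤ) (2 ^ N * Q : ℕ)).filter
      (· ∈ perSet (etaSeq c r) (2 ^ N * Q))).card := by
    have hsub : Finset.Ico (0 : ℤ) (2 ^ N * Q : ℕ) \
        (Finset.Ico (0 : ℤ) Q).image (fun j => 2 ^ N * j) ⊆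
        (Finset.Ico (0 : ℤ) (2 ^ N * Q : ℕ)).filter (· ∈ perSet (etaSeq c r) (2 ^ N * Q)) := by
      intro n hn
      rw [Finset.mem_sdiff] at hn
      refine Finset.mem_filter.mpr ⟨hn.1, mem_perSet_of_not_dvd hJ hJ' ?_⟩
      rintro ⟨j, rfl⟩
      refine hn.2 (Finset.mem_image_of_mem _ (Finset.mem_Ico.mpr ?_))
      have h := Finset.mem_Ico.mp hn.1
      push_cast at h
      exact ⟨nonneg_of_mul_nonneg_right h.1 (by positivity), lt_of_mul_lt_mul_left h.2 (by positivity)⟩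
    refine le_trans ?_ (Finset.card_le_card hsub)
    refine le_trans ?_ (Finset.le_card_sdiff _ _)
    have h1 : ((Finset.Ico (0 : ℤ) Q).image fun j => 2 ^ N * j).card ≤ Q :=
      Finset.card_image_le.trans (by simp)
    have h2 : (Finset.Ico (0 : ℤ) (2 ^ N * Q : ℕ)).card = 2 ^ N * Q := by
      rw [Int.card_Ico, sub_zero, Int.toNat_natCast]
    omega
  have hle : Q ≤ 2 ^ N * Q := Nat.le_mul_of_pos_left _ (by positivity)
  rw [lt_div_iff₀ (by exact_mod_cast hP)]
  have hcard' := (Nat.cast_le (α := ℝ)).mpr hcard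
  rw [Nat.cast_sub hle] at hcard'
  refine lt_of_lt_of_le ?_ hcard'
  push_cast
  have hQ' : (0 : ℝ) < Q := by exact_mod_cast hQpos
  have h1 : (1 : ℝ) < δ * 2 ^ N := by
    rw [one_div, inv_pow, inv_lt_iff_one_lt_mul₀ (by positivity)] at hN
    exact hN
  nlinarith

/-- A shift invariant closed set of sequences which meets the orbit closure of a Toeplitz sequence
contains it. -/
theorem IsToeplitz.mem_of_isClosed {A : Type*} [TopologicalSpace A] [DiscreteTopology A]
    {x : ℤ → A} (hx : IsToeplitz x) {D : Set (ℤ → A)} (hD : IsClosed D)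
    (hinv : ∀ y ∈ D, ∀ n : ℤ, shift n y ∈ D) {y : ℤ → A} (hy : y ∈ orbitClosure x) (hyD : y ∈ D) :
    x ∈ D := by
  classical
  rw [← hD.closure_eq, mem_closure_iff]
  intro O hO hxO
  obtain ⟨I, u, hu, hIu⟩ := isOpen_pi_iff.mp hO x hxO
  choose p hp hper using hx
  set q := ∏ i ∈ I, p i with hq
  have hqpos : 0 < q := Finset.prod_pos fun i _ => hp i
  have hxq : ∀ i ∈ I, ∀ k : ℤ, x (i + k * q) = x i := fun i hi k => by
    obtain ⟨m, hm⟩ := Finset.dvd_prod_of_mem p hi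
    have := hper i (k * m)
    rw [← this, hq, hm]
    congr 1
    push_cast
    ring
  obtain ⟨z, hz, n, rfl⟩ := mem_closure_iff.mp hy
    -- Approximate y by σ^n x on I + [0, q). For k ≡ -n modulo the common period q, the shift σ^k y
    -- reads at i ∈ I the value of x at i plus a multiple of q, which is x_i.
    {z | ∀ j ∈ I.biUnion fun i => (Finset.Ico (0 : ℤ) q).image fun k => i + k, z j = y j}
    (by
      have : {z : ℤ → A | ∀ j ∈ I.biUnion fun i => (Finset.Ico (0 : ℤ) q).image fun k => i + k,
          z j = y j} = ⋂ j ∈ I.biUnion fun i => (Finset.Ico (0 : ℤ) q).image fun k => i + k,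
          (fun z : ℤ → A => z j) ⁻¹' {y j} := by
        ext z
        simp only [Set.mem_ofPred_eq, Set.mem_iInter, Set.mem_preimage, Set.mem_singleton_iff]
      rw [this]
      exact isOpen_biInter_finset fun j _ => (isOpen_discrete _).preimage (continuous_apply j))
    (fun j _ => rfl)
  set k := (-n) % (q : ℤ) with hk
  have hk0 : 0 ≤ k := Int.emod_nonneg _ (by omega)
  have hk1 : k < q := Int.emod_lt_of_pos _ (by omega)
  refine ⟨shift k y, hIu fun i hi => ?_, hinv y hyD k⟩
  have h1 := hz (i + k) (Finset.mem_biUnion.mpr ⟨i, hi, Finset.mem_image.mpr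
    ⟨k, Finset.mem_Ico.mpr ⟨hk0, hk1⟩, rfl⟩⟩)
  change y (k + i) ∈ u i
  rw [add_comm, ← h1]
  change x (n + (i + k)) ∈ u i
  have h2 : n + (i + k) = i + (-((-n) / (q : ℤ))) * q := by
    have := Int.emod_add_mul_ediv (-n) q
    rw [← hk] at this
    linear_combination this
  rw [h2, hxq i hi]
  exact (hu i hi).2

theorem shift_mem_orbitClosure {A : Type*} [TopologicalSpace A] {x y : ℤ → A}
    (hy : y ∈ orbitClosure x) (n : ℤ) : shift n y ∈ orbitClosure x := by
  rw [← coe_subshiftHomeo_zpow x n ⟨y, hy⟩]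
  exact Subtype.property _

theorem shift_mem_orbit_of_mem {A : Type*} {x y : ℤ → A} (hy : y ∈ orbit x) (n : ℤ) :
    shift n y ∈ orbit x := by
  obtain ⟨m, rfl⟩ := hy
  refine ⟨m + n, ?_⟩
  ext i
  simp [add_assoc]

theorem shift_mem_closure {A : Type*} [TopologicalSpace A] {D : Set (ℤ → A)}
    (h : ∀ y ∈ D, ∀ n : ℤ, shift n y ∈ D) : ∀ y ∈ closure D, ∀ n : ℤ, shift n y ∈ closure D :=
  fun _ hy n => map_mem_closure (by fun_prop) hy fun z hz => h z hz n

theorem IsToeplitz.isMinimal {A : Type*} [TopologicalSpace A] [DiscreteTopology A] {x : ℤ → A}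
    (hx : IsToeplitz x) : IsMinimal (subshiftHomeo x) := by
  refine ⟨⟨⟨x, subset_closure (self_mem_orbit x)⟩⟩, fun y => ?_⟩
  have hinv := shift_mem_closure (D := orbit (y : ℤ → A)) fun z hz => shift_mem_orbit_of_mem hz
  have hxy : x ∈ closure (orbit (y : ℤ → A)) :=
    hx.mem_of_isClosed isClosed_closure hinv y.2 (subset_closure (self_mem_orbit _))
  have hsub : orbitClosure x ⊆ closure (orbit (y : ℤ → A)) := by
    refine closure_minimal ?_ isClosed_closure
    rintro _ ⟨n, rfl⟩
    exact hinv x hxy n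
  have himg : Subtype.val '' (Set.range fun n : ℤ => (subshiftHomeo x ^ n) y) =
      orbit (y : ℤ → A) := by
    rw [← Set.range_comp]
    exact congrArg Set.range (funext fun n => coe_subshiftHomeo_zpow x n y)
  intro z
  rw [closure_subtype, himg]
  exact hsub z.2

/-- The entourage of a window in a space of sequences. -/
def windowRel {A : Type*} (X : Set (ℤ → A)) (m : ℕ) : SetRel X X :=
  {p | ∀ k ∈ Finset.Icc (-(m : ℤ)) m, (p.1 : ℤ → A) k = (p.2 : ℤ → A) k}

instance {A : Type*} (X : Set (ℤ → A)) (m : ℕ) : (windowRel X m).IsSymm where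
  symm _ _ h k hk := (h k hk).symm

theorem windowRel_comp_subset {A : Type*} (X : Set (ℤ → A)) (m : ℕ) :
    SetRel.comp (windowRel X m) (windowRel X m) ⊆ windowRel X m := by
  rintro ⟨x, z⟩ ⟨y, h1, h2⟩ k hk
  exact (h1 k hk).trans (h2 k hk)

theorem exists_finset_representatives {X κ : Type*} [Fintype κ] (f : X → κ) :
    ∃ s : Finset X, s.card ≤ Fintype.card κ ∧ ∀ x, ∃ y ∈ s, f x = f y := by
  classical
  have : Fintype (Set.range f) := Fintype.ofFinite _
  refine ⟨Finset.univ.image (fun k : Set.range f => k.2.choose), ?_, fun x => ?_⟩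
  · refine Finset.card_image_le.trans ?_
    rw [Finset.card_univ]
    exact Fintype.card_subtype_le _
  · exact ⟨_, Finset.mem_image_of_mem _ (Finset.mem_univ ⟨f x, x, rfl⟩),
      (Exists.choose_spec (⟨x, rfl⟩ : ∃ y, f y = f x)).symm⟩

theorem exists_windowRel_subset {A : Type*} [TopologicalSpace A] [T2Space A] {X : Set (ℤ → A)}
    [CompactSpace X] {U : SetRel X X} (hU : U ∈ @uniformity X uniformSpaceOfCompactR1) :
    ∃ m, windowRel X m ⊆ U := by
  obtain ⟨V, hV, hdiag, hVU⟩ := mem_nhdsSet_iff_exists.mp hU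
  obtain ⟨m, hm⟩ := exists_window hV fun x => hdiag rfl
  exact ⟨m, fun p hp => hVU (hm p.1 p.2 hp)⟩

/-- A word of length n + 2m is determined by the skeleton index p and by the entries at the
positions j with 2^N ∣ p + j, which are the only ones the skeleton leaves open. -/
theorem exists_dynCover {c r : ℕ → ℕ} (hc : IsAdmissible c) {N : ℕ} {J : Finset ℕ}
    (hJ : ∀ i, i ∉ J → N ≤ r i) (hJ' : ∀ i ∈ J, r i ≤ N) (m n : ℕ) :
    ∃ s : Finset (orbitClosure (etaSeq c r)),
      s.card ≤ (2 ^ N * ∏ i ∈ J, c i) * 2 ^ ((n + 2 * m) / 2 ^ N + 2) ∧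
      Dynamics.IsDynCoverOf (subshiftHomeo (etaSeq c r)) Set.univ
        (windowRel (orbitClosure (etaSeq c r)) m) n s := by
  classical
  choose! p hp hpx using fun x : orbitClosure (etaSeq c r) => exists_skeleton hc hJ hJ' x.2
  obtain ⟨s, hs, hs'⟩ := exists_finset_representatives
    -- The open positions 2^N q - p are listed from q = ⌊(p - m)/2^N⌋ onwards; the extra 2 in the
    -- number of slots accounts for rounding at both ends of the window.
    (fun x : orbitClosure (etaSeq c r) => ((⟨p x, hp x⟩ : Fin (2 ^ N * ∏ i ∈ J, c i)),
      fun k : Fin ((n + 2 * m) / 2 ^ N + 2) =>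
        (x : ℤ → Fin 2) (2 ^ N * (((p x : ℤ) - m) / 2 ^ N + (k : ℕ)) - p x)))
  refine ⟨s, by simpa using hs, fun x _ => ?_⟩
  obtain ⟨y, hy, hxy⟩ := hs' x
  refine ⟨y, hy, Dynamics.mem_dynEntourage.mpr fun k hk j hj => ?_⟩
  have hiter : ∀ z : orbitClosure (etaSeq c r), (((subshiftHomeo (etaSeq c r))^[k] z :
      orbitClosure (etaSeq c r)) : ℤ → Fin 2) j = (z : ℤ → Fin 2) (k + j) := fun z => by
    have h1 : (subshiftHomeo (etaSeq c r))^[k] z = (subshiftHomeo (etaSeq c r) ^ (k : ℤ)) z := by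
      clear hk
      induction k generalizing z with
      | zero => rfl
      | succ k ih =>
        rw [Function.iterate_succ_apply, ih, Nat.cast_add, Nat.cast_one, zpow_add_one]
        rfl
    rw [h1, coe_subshiftHomeo_zpow]
    rfl
  rw [hiter, hiter]
  rw [Prod.mk.injEq] at hxy
  have hpxy : p x = p y := congrArg Fin.val hxy.1
  rw [Finset.mem_Icc] at hj
  by_cases hdvd : (2 ^ N : ℤ) ∣ p x + (k + j)
  · obtain ⟨q, hq⟩ := hdvd
    have hpow : (0 : ℤ) < 2 ^ N := by positivity
    set d := ((p x : ℤ) - m) / 2 ^ N with hd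
    have h1 : d ≤ q := by
      have : d * 2 ^ N ≤ p x - m := Int.ediv_mul_le _ hpow.ne'
      have : d * 2 ^ N ≤ q * 2 ^ N := by rw [mul_comm q]; omega
      exact le_of_mul_le_mul_right this hpow
    have h2 : q - d < (((n + 2 * m) / 2 ^ N + 2 : ℕ) : ℤ) := by
      have e1 := Int.lt_ediv_add_one_mul_self ((p x : ℤ) - m) hpow
      have e2 := Int.lt_ediv_add_one_mul_self ((n + 2 * m : ℕ) : ℤ) hpow
      rw [← hd] at e1
      have : (q - d) * 2 ^ N < ((((n + 2 * m : ℕ) : ℤ) / 2 ^ N + 1) + 1) * 2 ^ N := by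
        have e3 : (k : ℤ) < n := by exact_mod_cast hk
        push_cast at e2 ⊢
        linarith [hj.2]
      have := lt_of_mul_lt_mul_right this hpow.le
      push_cast at this ⊢
      omega
    have h3 := congrFun hxy.2 ⟨(q - d).toNat, by omega⟩
    simp only [Int.toNat_of_nonneg (sub_nonneg.mpr h1), ← hpxy, ← hd] at h3
    convert h3 using 2 <;> rw [add_sub_cancel, ← hq] <;> ring
  · rw [hpx x _ hdvd, hpx y _ (hpxy ▸ hdvd), hpxy]

theorem topEntropy_etaSeq {c r : ℕ → ℕ} (hc : IsAdmissible c) (hr : Tendsto r atTop atTop) :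
    topEntropy (subshiftHomeo (etaSeq c r)) = 0 := by
  let _ : UniformSpace (orbitClosure (etaSeq c r)) := uniformSpaceOfCompactR1
  refine le_antisymm (iSup₂_le fun U hU => ?_)
    (Dynamics.coverEntropy_nonneg _ ⟨⟨_, subset_closure (self_mem_orbit _)⟩, trivial⟩)
  obtain ⟨m, hm⟩ := exists_windowRel_subset hU
  -- The entropy estimate used below concerns a composed entourage; window relations are transitive,
  -- so composing costs nothing.
  refine (Dynamics.coverEntropyEntourage_antitone _ _
    ((windowRel_comp_subset _ m).trans hm)).trans ?_
  refine EReal.le_of_forall_lt_iff_le.mp fun δ hδ => ?_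
  have hδ' : 0 < δ := by exact_mod_cast hδ
  -- The exponent of the cover grows like n/2^N < nδ/2; the time n is then taken so large that log P
  -- and the window terms fit into the other nδ/2.
  obtain ⟨N, hN⟩ := exists_pow_lt_of_lt_one (half_pos hδ') (show (1 / 2 : ℝ) < 1 by norm_num)
  obtain ⟨J, hJ, hJ'⟩ := exists_level hr N
  set P := 2 ^ N * ∏ i ∈ J, c i with hP
  have hPpos : 0 < P := hc.level_pos N J
  obtain ⟨n, hn⟩ := exists_nat_ge (max 1 ((Real.log P + (2 * m + 2)) / (δ / 2)))
  have hn1 : (1 : ℝ) ≤ n := (le_max_left _ _).trans hn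
  have hn2 := (le_max_right _ _).trans hn
  rw [div_le_iff₀ (half_pos hδ')] at hn2
  have hnpos : n ≠ 0 := by rintro rfl; norm_num at hn1
  obtain ⟨s, hs, hcov⟩ := exists_dynCover hc hJ hJ' m n
  refine (hcov.coverEntropyEntourage_le_log_card_div (Set.mapsTo_univ _ _) hnpos).trans ?_
  have hlog : ENNReal.log (s.card : ENNReal) ≤ ((δ * n : ℝ) : EReal) := by
    have h1 : (s.card : ENNReal) ≤
        ENNReal.ofReal ((P : ℝ) * 2 ^ ((n + 2 * m) / 2 ^ N + 2)) := by
      rw [show (P : ℝ) * 2 ^ ((n + 2 * m) / 2 ^ N + 2) =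
        ((P * 2 ^ ((n + 2 * m) / 2 ^ N + 2) : ℕ) : ℝ) by push_cast; ring, ENNReal.ofReal_natCast]
      exact_mod_cast hs
    have hP' : (0 : ℝ) < P := by exact_mod_cast hPpos
    refine (ENNReal.log_monotone h1).trans ?_
    rw [ENNReal.log_ofReal_of_pos (by positivity), EReal.coe_le_coe_iff,
      Real.log_mul hP'.ne' (by positivity), Real.log_pow]
    have h2 : (((n + 2 * m) / 2 ^ N + 2 : ℕ) : ℝ) ≤ n * (1 / 2) ^ N + 2 * m + 2 := by
      have h3 := Nat.cast_div_le (α := ℝ) (m := n + 2 * m) (n := 2 ^ N)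
      push_cast at h3 ⊢
      have h4 : ((n : ℝ) + 2 * m) / 2 ^ N ≤ n * (1 / 2) ^ N + 2 * m := by
        rw [one_div, inv_pow, add_div, div_eq_mul_inv]
        gcongr
        exact div_le_self (by positivity) (one_le_pow₀ (by norm_num))
      linarith
    have h5 : Real.log 2 ≤ 1 := by linarith [Real.log_two_lt_d9]
    have h6 := mul_le_of_le_one_right
      (Nat.cast_nonneg (α := ℝ) ((n + 2 * m) / 2 ^ N + 2)) h5
    have h7 := mul_le_mul_of_nonneg_left hN.le (Nat.cast_nonneg (α := ℝ) n)
    linarith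
  rw [EReal.div_le_iff_le_mul (by exact_mod_cast Nat.pos_of_ne_zero hnpos) (EReal.natCast_ne_top n)]
  rw [EReal.coe_mul] at hlog
  rw [mul_comm]
  exact hlog

theorem covNum_ne_top {c r : ℕ → ℕ} (hc : IsAdmissible c) (hr : Tendsto r atTop atTop)
    {X : Set (ℤ → Fin 2)} (h₁ : orbit (etaSeq c r) ⊆ X) (h₂ : X ⊆ orbitClosure (etaSeq c r))
    {ε : ℝ} (hε : 0 < ε) : covNum X ε ≠ ⊤ := by
  obtain ⟨N, hN⟩ := exists_pow_lt_of_lt_one hε (show (1 / 2 : ℝ) < 1 by norm_num)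
  obtain ⟨J, hJ, hJ'⟩ := exists_level hr N
  exact ne_top_of_le_ne_top (ENat.natCast_ne_top _)
    (covNum_le hc hJ hJ' h₁ h₂ (by rwa [one_div, inv_pow, ← one_div] at hN))

/-! ### Residues of the points of the orbit closure -/

/-- `x` vanishes on the class of `-a` modulo `b`. -/
def VanishesOn (b : ℕ) (x : ℤ → Fin 2) (a : ZMod b) : Prop := ∀ j : ℤ, a + j = 0 → x j = 0

/-- The class `a` modulo `b` for which `x` vanishes on the class of `-a`. -/
def residue (b : ℕ) (x : ℤ → Fin 2) : ZMod b := Classical.epsilon (VanishesOn b x)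

theorem VanishesOn.shift {b : ℕ} {x : ℤ → Fin 2} {a : ZMod b} (h : VanishesOn b x a) (n : ℤ) :
    VanishesOn b (shift n x) (a + n) := fun j hj =>
  h (n + j) (by rw [← hj]; push_cast; ring)

theorem isClosed_vanishesOn (b : ℕ) (a : ZMod b) : IsClosed {x | VanishesOn b x a} := by
  simp only [VanishesOn, Set.ofPred_forall]
  exact isClosed_iInter fun j => isClosed_iInter fun _ =>
    isClosed_eq (continuous_apply j) continuous_const

/-- The moduli `b_i = 2^{r_i} c_i`. -/
abbrev moduli (c r : ℕ → ℕ) : ℕ → ℕ := fun i => 2 ^ r i * c i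

section Residues

variable {c r : ℕ → ℕ}

theorem IsAdmissible.neZero_moduli (hc : IsAdmissible c) (r : ℕ → ℕ) (i : ℕ) :
    NeZero (moduli c r i) := ⟨(hc.b_pos r i).ne'⟩

theorem vanishesOn_etaSeq (c r : ℕ → ℕ) (i : ℕ) : VanishesOn (moduli c r i) (etaSeq c r) 0 :=
  fun j hj => etaSeq_eq_zero_iff.mpr ⟨i, by
    rw [zero_add] at hj
    exact (ZMod.intCast_zmod_eq_zero_iff_dvd _ _).mp hj⟩

/-- By the sieve, every nonzero class modulo b_i contains a position where η is 1. -/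
theorem eq_zero_of_vanishesOn_etaSeq (hc : IsAdmissible c) (hr : Tendsto r atTop atTop) {i : ℕ}
    {a : ZMod (moduli c r i)} (h : VanishesOn (moduli c r i) (etaSeq c r) a) : a = 0 := by
  obtain ⟨z, rfl⟩ := ZMod.intCast_surjective a
  rw [ZMod.intCast_zmod_eq_zero_iff_dvd]
  by_contra hz
  obtain ⟨J, hJ⟩ := exists_finset_lt hr (r i + 1)
  obtain ⟨S, hcard, -, hS⟩ := hc.exists_free_residues (r := r) (a := -z) (fun h => hz (by simpa using h))
    (J.erase i) (Finset.notMem_erase _ _)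
    fun j hji hj => Finset.mem_erase.mpr ⟨hji, (hJ j).mpr (Nat.lt_succ_of_le hj)⟩
  have hpos : 0 < S.card := by
    rw [hcard]
    exact Finset.prod_pos fun j _ => by have := hc.add_three_le j; omega
  obtain ⟨s, hs⟩ := Finset.card_pos.mp hpos
  obtain ⟨h1, h2⟩ := hS s hs s rfl
  have h3 := h s (by
    rw [← Int.cast_add, ZMod.intCast_zmod_eq_zero_iff_dvd]
    have := h1.symm.dvd
    rwa [sub_neg_eq_add, add_comm] at this)
  rw [h2] at h3
  exact absurd h3 (by decide)

theorem exists_vanishesOn (hc : IsAdmissible c) (i : ℕ) {x : ℤ → Fin 2}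
    (hx : x ∈ orbitClosure (etaSeq c r)) : ∃ a, VanishesOn (moduli c r i) x a := by
  have := hc.neZero_moduli r i
  have hclosed : IsClosed (⋃ a, {x | VanishesOn (moduli c r i) x a}) :=
    isClosed_iUnion_of_finite fun a => isClosed_vanishesOn _ a
  refine Set.mem_iUnion.mp (closure_minimal ?_ hclosed hx)
  rintro _ ⟨n, rfl⟩
  exact Set.mem_iUnion.mpr ⟨_, (vanishesOn_etaSeq c r i).shift n⟩

/-- Having two different vanishing classes is a closed, shift invariant property. If some point of
the orbit closure had it, so would η, by the Toeplitz property. -/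
theorem VanishesOn.unique (hc : IsAdmissible c) (hr : Tendsto r atTop atTop) {i : ℕ}
    {x : ℤ → Fin 2} (hx : x ∈ orbitClosure (etaSeq c r)) {a a' : ZMod (moduli c r i)}
    (h : VanishesOn (moduli c r i) x a) (h' : VanishesOn (moduli c r i) x a') : a = a' := by
  have := hc.neZero_moduli r i
  by_contra hne
  have hclosed : IsClosed (⋃ (a : ZMod (moduli c r i)) (a' : ZMod (moduli c r i)) (_ : a ≠ a'),
      {x | VanishesOn (moduli c r i) x a} ∩ {x | VanishesOn (moduli c r i) x a'}) :=
    isClosed_iUnion_of_finite fun a => isClosed_iUnion_of_finite fun a' =>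
      isClosed_iUnion_of_finite fun _ => (isClosed_vanishesOn _ a).inter (isClosed_vanishesOn _ a')
  have hmem := (isToeplitz_etaSeq hc hr).mem_of_isClosed hclosed (fun y hy n => ?_) hx
    (by simp only [Set.mem_iUnion]; exact ⟨a, a', hne, h, h'⟩)
  · simp only [Set.mem_iUnion] at hmem
    obtain ⟨e, e', hee, h1, h2⟩ := hmem
    exact hee ((eq_zero_of_vanishesOn_etaSeq hc hr h1).trans
      (eq_zero_of_vanishesOn_etaSeq hc hr h2).symm)
  · simp only [Set.mem_iUnion] at hy ⊢
    obtain ⟨e, e', hee, h1, h2⟩ := hy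
    exact ⟨e + n, e' + n, fun heq => hee (add_right_cancel heq), h1.shift n, h2.shift n⟩

theorem vanishesOn_residue (hc : IsAdmissible c) (i : ℕ) {x : ℤ → Fin 2}
    (hx : x ∈ orbitClosure (etaSeq c r)) :
    VanishesOn (moduli c r i) x (residue (moduli c r i) x) :=
  Classical.epsilon_spec (exists_vanishesOn hc i hx)

theorem VanishesOn.residue_eq (hc : IsAdmissible c) (hr : Tendsto r atTop atTop) {i : ℕ}
    {x : ℤ → Fin 2} (hx : x ∈ orbitClosure (etaSeq c r)) {a : ZMod (moduli c r i)}
    (h : VanishesOn (moduli c r i) x a) : residue (moduli c r i) x = a :=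
  (vanishesOn_residue hc i hx).unique hc hr hx h

theorem residue_shift (hc : IsAdmissible c) (hr : Tendsto r atTop atTop) (i : ℕ)
    {x : ℤ → Fin 2} (hx : x ∈ orbitClosure (etaSeq c r)) (n : ℤ) :
    residue (moduli c r i) (shift n x) = residue (moduli c r i) x + n :=
  ((vanishesOn_residue hc i hx).shift n).residue_eq hc hr (shift_mem_orbitClosure hx n)

theorem residue_etaSeq (hc : IsAdmissible c) (hr : Tendsto r atTop atTop) (i : ℕ) :
    residue (moduli c r i) (etaSeq c r) = 0 :=
  (vanishesOn_etaSeq c r i).residue_eq hc hr (subset_closure (self_mem_orbit _))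

theorem residue_shift_etaSeq (hc : IsAdmissible c) (hr : Tendsto r atTop atTop) (i : ℕ) (n : ℤ) :
    residue (moduli c r i) (shift n (etaSeq c r)) = n := by
  rw [residue_shift hc hr i (subset_closure (self_mem_orbit _)), residue_etaSeq hc hr, zero_add]

theorem continuous_residue (hc : IsAdmissible c) (hr : Tendsto r atTop atTop) (i : ℕ) :
    Continuous fun x : orbitClosure (etaSeq c r) => residue (moduli c r i) (x : ℤ → Fin 2) := by
  have := hc.neZero_moduli r i
  refine continuous_iff_isClosed.mpr fun s _ => ?_
  have : (fun x : orbitClosure (etaSeq c r) => residue (moduli c r i) (x : ℤ → Fin 2)) ⁻¹' s =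
      ⋃ a ∈ s, Subtype.val ⁻¹' {x | VanishesOn (moduli c r i) x a} := by
    ext x
    simp only [Set.mem_preimage, Set.mem_iUnion, Set.mem_ofPred_eq, exists_prop]
    constructor
    · exact fun h => ⟨_, h, vanishesOn_residue hc i x.2⟩
    · rintro ⟨a, ha, hx⟩
      rwa [hx.residue_eq hc hr x.2]
  rw [this]
  exact s.toFinite.isClosed_biUnion fun a _ =>
    (isClosed_vanishesOn _ a).preimage continuous_subtype_val

/-- A closed property of the orbit of `η` holds on the orbit closure. -/
theorem forall_orbitClosure_of_isClosed {A : Type*} [TopologicalSpace A] {x : ℤ → A}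
    {D : Set (orbitClosure x)} (hD : IsClosed D)
    (h : ∀ n : ℤ, (⟨shift n x, subset_closure (shift_mem_orbit x n)⟩ : orbitClosure x) ∈ D)
    (y : orbitClosure x) : y ∈ D := by
  rw [← hD.closure_eq, closure_subtype]
  refine closure_mono ?_ y.2
  rintro _ ⟨n, rfl⟩
  exact ⟨_, h n, rfl⟩

theorem two_pow_dvd_intCast_iff {k m : ℕ} {w : ℤ} :
    (2 ^ k : ZMod (2 ^ k * m)) ∣ (w : ZMod (2 ^ k * m)) ↔ (2 ^ k : ℤ) ∣ w := by
  constructor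
  · rintro ⟨u, hu⟩
    obtain ⟨u, rfl⟩ := ZMod.intCast_surjective u
    have h : ((w - 2 ^ k * u : ℤ) : ZMod (2 ^ k * m)) = 0 := by push_cast; rw [hu, sub_self]
    rw [ZMod.intCast_zmod_eq_zero_iff_dvd] at h
    push_cast at h
    exact (dvd_sub_left (Dvd.intro _ rfl)).mp ((Dvd.intro _ rfl).trans h)
  · rintro ⟨u, rfl⟩
    exact ⟨u, by push_cast; rfl⟩

theorem residue_add_ne_zero (hc : IsAdmissible c) {x : ℤ → Fin 2}
    (hx : x ∈ orbitClosure (etaSeq c r)) {j : ℤ} (hj : x j ≠ 0) (i : ℕ) :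
    residue (moduli c r i) x + j ≠ 0 := fun h => hj (vanishesOn_residue hc i hx j h)

/-- On the orbit, a zero at j comes from some b_k dividing n + j: either k is in the finite set J,
or r_k ≥ r_i and so 2^{r_i} ∣ n + j. Because J is finite this alternative is a closed condition and
persists on the closure, where the first case is ruled out by hypothesis. -/
theorem two_pow_dvd_residue_add (hc : IsAdmissible c) (hr : Tendsto r atTop atTop) {x : ℤ → Fin 2}
    (hx : x ∈ orbitClosure (etaSeq c r)) {j : ℤ} (hj : x j = 0)
    (h : ∀ i, residue (moduli c r i) x + j ≠ 0) (i : ℕ) :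
    (2 ^ r i : ZMod (moduli c r i)) ∣ residue (moduli c r i) x + j := by
  obtain ⟨J, hJ, -⟩ := exists_level hr (r i)
  have hres : ∀ (k : ℕ) (s : Set (ZMod (moduli c r k))), IsClosed
      {y : orbitClosure (etaSeq c r) | residue (moduli c r k) (y : ℤ → Fin 2) ∈ s} := fun k s =>
    (isClosed_discrete s).preimage (continuous_residue hc hr k)
  have hclosed : IsClosed (({y : orbitClosure (etaSeq c r) | (y : ℤ → Fin 2) j ≠ 0} ∪
      ⋃ k ∈ J, {y : orbitClosure (etaSeq c r) | residue (moduli c r k) (y : ℤ → Fin 2) ∈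
        {a : ZMod (moduli c r k) | a + (j : ZMod (moduli c r k)) = 0}}) ∪
      {y : orbitClosure (etaSeq c r) | residue (moduli c r i) (y : ℤ → Fin 2) ∈
        {a : ZMod (moduli c r i) | (2 ^ r i : ZMod (moduli c r i)) ∣ a + (j : ZMod (moduli c r i))}}) := by
    refine (IsClosed.union ?_ (isClosed_biUnion_finset fun k _ => hres k _)).union (hres i _)
    have hcont : Continuous fun y : orbitClosure (etaSeq c r) => (y : ℤ → Fin 2) j :=
      (continuous_apply j).comp continuous_subtype_val
    exact (isClosed_discrete ({a | a ≠ 0} : Set (Fin 2))).preimage hcont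
  have := forall_orbitClosure_of_isClosed hclosed (fun n => ?_) ⟨x, hx⟩
  · rcases this with (h1 | h1) | h1
    · exact absurd hj h1
    · simp only [Set.mem_iUnion] at h1
      obtain ⟨k, -, hk⟩ := h1
      exact absurd hk (h k)
    · exact h1
  · by_cases h0 : etaSeq c r (n + j) = 0
    · obtain ⟨k, hk⟩ := etaSeq_eq_zero_iff.mp h0
      by_cases hkJ : k ∈ J
      · refine Or.inl (Or.inr (Set.mem_biUnion (x := k) hkJ ?_))
        change residue (moduli c r k) (shift n (etaSeq c r)) + j = 0
        rw [residue_shift_etaSeq hc hr, ← Int.cast_add]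
        exact (ZMod.intCast_zmod_eq_zero_iff_dvd _ _).mpr hk
      · refine Or.inr ?_
        change (2 ^ r i : ZMod (moduli c r i)) ∣ residue (moduli c r i) (shift n (etaSeq c r)) + j
        rw [residue_shift_etaSeq hc hr, ← Int.cast_add, two_pow_dvd_intCast_iff]
        refine (pow_dvd_pow 2 (hJ k hkJ)).trans (Dvd.dvd.trans ?_ hk)
        push_cast
        exact Dvd.intro _ rfl
    · exact Or.inl (Or.inl h0)

/-- Two points with the same residues differ only at positions that are zero in the `2`-adic
component of the odometer, and nonzero in the other components. -/
theorem residue_add_of_ne (hc : IsAdmissible c) (hr : Tendsto r atTop atTop) {x y : ℤ → Fin 2}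
    (hx : x ∈ orbitClosure (etaSeq c r)) (hy : y ∈ orbitClosure (etaSeq c r))
    (hxy : ∀ i, residue (moduli c r i) x = residue (moduli c r i) y) {j : ℤ} (hj : x j ≠ y j)
    (i : ℕ) : (2 ^ r i : ZMod (moduli c r i)) ∣ residue (moduli c r i) x + j ∧
      residue (moduli c r i) x + j ≠ 0 := by
  by_cases h0 : x j = 0
  · have hne : ∀ i, residue (moduli c r i) x + j ≠ 0 := fun i => by
      rw [hxy i]
      exact residue_add_ne_zero hc hy (fun h => hj (h0.trans h.symm)) i
    exact ⟨two_pow_dvd_residue_add hc hr hx h0 hne i, hne i⟩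
  · have hne : ∀ i, residue (moduli c r i) x + j ≠ 0 := residue_add_ne_zero hc hx h0
    have h1 : y j = 0 := by
      revert hj h0
      generalize x j = u
      generalize y j = v
      revert u v
      decide
    refine ⟨?_, hne i⟩
    rw [hxy i]
    exact two_pow_dvd_residue_add hc hr hy h1 (fun i => hxy i ▸ hne i) i

theorem exists_agree_window (hc : IsAdmissible c) (hr : Tendsto r atTop atTop) {x y : ℤ → Fin 2}
    (hx : x ∈ orbitClosure (etaSeq c r)) (hy : y ∈ orbitClosure (etaSeq c r))
    (hxy : ∀ i, residue (moduli c r i) x = residue (moduli c r i) y) (m : ℕ) :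
    ∃ n : ℤ, ∀ k ∈ Finset.Icc (-(m : ℤ)) m, x (n + k) = y (n + k) := by
  obtain ⟨i, hi⟩ := (hr.eventually_ge_atTop (2 * m + 2)).exists
  obtain ⟨z, hz⟩ := ZMod.intCast_surjective (residue (moduli c r i) x)
  -- The two points can differ only where z plus the position is a multiple of 2^{r_i} > 2m + 2; on
  -- this window the sum runs through 1, …, 2m + 1.
  refine ⟨-z + m + 1, fun k hk => ?_⟩
  by_contra hne
  have h := (residue_add_of_ne hc hr hx hy hxy hne i).1
  rw [← hz, ← Int.cast_add, two_pow_dvd_intCast_iff] at h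
  rw [Finset.mem_Icc] at hk
  have h1 := Int.le_of_dvd (by omega) h
  have h2 : ((2 * m + 2 : ℕ) : ℤ) < ((2 ^ r i : ℕ) : ℤ) := by
    exact_mod_cast hi.trans_lt Nat.lt_two_pow_self
  push_cast at h2
  omega

end Residues

/-! ### The odometer as maximal equicontinuous factor -/

theorem compactSpace_odometer {b : ℕ → ℕ} (hb : ∀ i, NeZero (b i)) : CompactSpace (odometer b) :=
  isCompact_iff_compactSpace.mp
    (AddSubgroup.isClosed_topologicalClosure (Int.castAddHom (∀ i, ZMod (b i))).range).isCompact

theorem addRight_zpow_apply {G : Type*} [AddGroup G] [TopologicalSpace G] [ContinuousAdd G]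
    (a : G) (n : ℤ) (x : G) : ((Homeomorph.addRight a) ^ n) x = x + n • a := by
  induction n generalizing x with
  | zero => simp
  | succ n ih =>
    rw [zpow_add_one]
    change ((Homeomorph.addRight a) ^ (n : ℤ)) (x + a) = _
    rw [ih, add_assoc, ← one_add_zsmul, add_comm (1 : ℤ)]
  | pred n ih =>
    rw [zpow_sub_one]
    change ((Homeomorph.addRight a) ^ (-(n : ℤ))) (x + -a) = _
    rw [ih, add_assoc, sub_eq_neg_add, add_zsmul, neg_one_zsmul]

theorem isEquicontinuousSystem_addRight {G : Type*} [AddGroup G] [TopologicalSpace G]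
    [ContinuousAdd G] [CompactSpace G] [T2Space G] (a : G) :
    IsEquicontinuousSystem (Homeomorph.addRight a) := by
  refine ⟨inferInstance, inferInstance, fun x₀ U hU => ?_⟩
  obtain ⟨V, hV, hdiag, hVU⟩ := mem_nhdsSet_iff_exists.mp hU
  have h := isCompact_univ.eventually_forall_of_forall_eventually (x₀ := x₀)
    (P := fun x g => (x₀ + g, x + g) ∈ V) fun g _ => by
      have hcont : Continuous fun z : G × G => (x₀ + z.2, z.1 + z.2) := by fun_prop
      exact hcont.continuousAt.eventually_mem (hV.mem_nhds (hdiag rfl))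
  filter_upwards [h] with x hx n
  rw [addRight_zpow_apply, addRight_zpow_apply]
  exact hVU (hx _ trivial)

/-- If points with equal image under a factor map `π` are proximal, then every equicontinuous factor
map factors through `π`. -/
theorem isMEF_of_proximal {A : Type} [TopologicalSpace A] [T2Space A] {X : Set (ℤ → A)}
    [CompactSpace X] {Y : Type} [TopologicalSpace Y] {T : X ≃ₜ X} {S : Y ≃ₜ Y} {π : X → Y}
    (hπ : IsFactorMap T S π) (hS : IsEquicontinuousSystem S)
    (hprox : ∀ x y, π x = π y → ∀ m : ℕ, ∃ n : ℤ, ∀ k ∈ Finset.Icc (-(m : ℤ)) m,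
      ((T ^ n) x : ℤ → A) k = ((T ^ n) y : ℤ → A) k) : IsMEF T S π := by
  refine ⟨hπ, hS, fun Z _ R ρ hρ hR => ?_⟩
  obtain ⟨_, _, hequi⟩ := hR
  let _ : UniformSpace Z := uniformSpaceOfCompactR1
  have huequi := CompactSpace.uniformEquicontinuous_of_equicontinuous hequi
  have key : ∀ x y, π x = π y → ρ x = ρ y := by
    intro x y hxy
    refine eq_of_uniformity fun {U} hU => ?_
    -- Once the orbits of x and y are close at time n, uniform equicontinuity allows applying
    -- R^{-n}, so ρ x and ρ y are U-close for every U.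
    obtain ⟨V, hV, hdiag, hVW⟩ := mem_nhdsSet_iff_exists.mp (huequi U hU)
    obtain ⟨m, hm⟩ := exists_window (X := X) (V := (fun p : X × X => (ρ p.1, ρ p.2)) ⁻¹' V)
      (hV.preimage ((hρ.1.comp continuous_fst).prodMk (hρ.1.comp continuous_snd)))
      (fun x => hdiag rfl)
    obtain ⟨n, hn⟩ := hprox x y hxy m
    have h1 : ((R ^ (-n)) (ρ ((T ^ n) x)), (R ^ (-n)) (ρ ((T ^ n) y))) ∈ U :=
      hVW (hm _ _ hn) (-n)
    rw [map_zpow_apply hρ.2.2, map_zpow_apply hρ.2.2] at h1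
    have h2 : ∀ z : Z, (R ^ (-n)) ((R ^ n) z) = z := fun z => by
      change (R ^ (-n) * R ^ n) z = z
      rw [← zpow_add, neg_add_cancel]
      rfl
    rwa [h2, h2] at h1
  obtain ⟨_, _, _⟩ := hS
  have hquot : IsQuotientMap π := hπ.1.isClosedMap.isQuotientMap hπ.1 hπ.2.1
  have hq : (ρ ∘ Function.surjInv hπ.2.1) ∘ π = ρ :=
    funext fun x => key _ _ (Function.surjInv_eq hπ.2.1 (π x))
  refine ⟨ρ ∘ Function.surjInv hπ.2.1, ⟨?_, ?_, fun y => ?_⟩, hq⟩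
  · rw [hquot.continuous_iff, hq]
    exact hρ.1
  · intro z
    obtain ⟨x, rfl⟩ := hρ.2.1 z
    exact ⟨π x, congrFun hq x⟩
  · obtain ⟨x, rfl⟩ := hπ.2.1 y
    rw [← hπ.2.2]
    exact (congrFun hq (T x)).trans ((hρ.2.2 x).trans (congrArg R (congrFun hq x)).symm)

section Factor

variable {c r : ℕ → ℕ}

theorem intCast_mem_odometer (b : ℕ → ℕ) (n : ℤ) : (fun i => (n : ZMod (b i))) ∈ odometer b :=
  AddSubgroup.le_topologicalClosure _ ⟨n, by ext; simp⟩

theorem residues_mem_odometer (hc : IsAdmissible c) (hr : Tendsto r atTop atTop)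
    (x : orbitClosure (etaSeq c r)) :
    (fun i => residue (moduli c r i) (x : ℤ → Fin 2)) ∈ odometer (moduli c r) := by
  have hclosed := (AddSubgroup.isClosed_topologicalClosure
    (Int.castAddHom (∀ i, ZMod (moduli c r i))).range).preimage
      (continuous_pi fun i => continuous_residue hc hr i)
  refine forall_orbitClosure_of_isClosed hclosed (fun n => ?_) x
  have : (fun i => residue (moduli c r i) (shift n (etaSeq c r))) =
      fun i => (n : ZMod (moduli c r i)) := funext fun i => residue_shift_etaSeq hc hr i n
  change (fun i => residue (moduli c r i) (shift n (etaSeq c r))) ∈ odometer (moduli c r)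
  rw [this]
  exact intCast_mem_odometer _ n

/-- The factor map from the orbit closure of `η` onto the odometer. -/
def factorMap (hc : IsAdmissible c) (hr : Tendsto r atTop atTop) (x : orbitClosure (etaSeq c r)) :
    odometer (moduli c r) :=
  ⟨fun i => residue (moduli c r i) (x : ℤ → Fin 2), residues_mem_odometer hc hr x⟩

theorem continuous_factorMap (hc : IsAdmissible c) (hr : Tendsto r atTop atTop) :
    Continuous (factorMap hc hr) :=
  (continuous_pi fun i => continuous_residue hc hr i).subtype_mk _

theorem factorMap_surjective (hc : IsAdmissible c) (hr : Tendsto r atTop atTop) :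
    Function.Surjective (factorMap hc hr) := by
  have hcl : IsClosed (Set.range fun x => (factorMap hc hr x : ∀ i, ZMod (moduli c r i))) :=
    (isCompact_range (continuous_subtype_val.comp (continuous_factorMap hc hr))).isClosed
  intro y
  have hsub : ((Int.castAddHom (∀ i, ZMod (moduli c r i))).range : Set (∀ i, ZMod (moduli c r i))) ⊆
      Set.range fun x => (factorMap hc hr x : ∀ i, ZMod (moduli c r i)) := by
    rintro _ ⟨n, rfl⟩
    refine ⟨⟨shift n (etaSeq c r), subset_closure (shift_mem_orbit _ n)⟩, funext fun i => ?_⟩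
    exact (residue_shift_etaSeq hc hr i n).trans (by simp)
  obtain ⟨x, hx⟩ := closure_minimal hsub hcl y.2
  exact ⟨x, Subtype.ext hx⟩

theorem factorMap_subshiftHomeo (hc : IsAdmissible c) (hr : Tendsto r atTop atTop)
    (x : orbitClosure (etaSeq c r)) :
    factorMap hc hr (subshiftHomeo (etaSeq c r) x) =
      odometerRot (moduli c r) (factorMap hc hr x) :=
  Subtype.ext (funext fun i => (residue_shift hc hr i x.2 1).trans (by
    rw [Int.cast_one]; rfl))

theorem isFactorMap_factorMap (hc : IsAdmissible c) (hr : Tendsto r atTop atTop) :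
    IsFactorMap (subshiftHomeo (etaSeq c r)) (odometerRot (moduli c r)) (factorMap hc hr) :=
  ⟨continuous_factorMap hc hr, factorMap_surjective hc hr, factorMap_subshiftHomeo hc hr⟩

theorem isMEF_factorMap (hc : IsAdmissible c) (hr : Tendsto r atTop atTop) :
    IsMEF (subshiftHomeo (etaSeq c r)) (odometerRot (moduli c r)) (factorMap hc hr) := by
  have := compactSpace_odometer (hc.neZero_moduli r)
  refine isMEF_of_proximal (isFactorMap_factorMap hc hr) (isEquicontinuousSystem_addRight _)
    fun x y hxy m => ?_
  obtain ⟨n, hn⟩ := exists_agree_window hc hr x.2 y.2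
    (fun i => congrFun (congrArg Subtype.val hxy) i) m
  refine ⟨n, fun k hk => ?_⟩
  rw [coe_subshiftHomeo_zpow, coe_subshiftHomeo_zpow]
  exact hn k hk

end Factor

/-! ### Unique ergodicity and the measurable isomorphism -/

section Rotation

variable {G : Type*} [AddCommGroup G] [TopologicalSpace G] [IsTopologicalAddGroup G]
  [MeasurableSpace G] [BorelSpace G]

theorem measurePreserving_addRight_zsmul {a : G} {μ : Measure G}
    (h : MeasurePreserving (Homeomorph.addRight a) μ μ) (n : ℤ) :
    MeasurePreserving (fun x => x + n • a) μ μ := by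
  have hinv : MeasurePreserving (fun x => x + -a) μ μ :=
    MeasurePreserving.symm (Homeomorph.addRight a).toMeasurableEquiv h
  induction n with
  | zero =>
    simp only [zero_zsmul, add_zero]
    exact MeasurePreserving.id μ
  | succ n ih =>
    convert h.comp ih using 1
    ext x
    change x + ((n : ℤ) + 1) • a = x + (n : ℤ) • a + a
    rw [add_zsmul, one_zsmul, add_assoc]
  | pred n ih =>
    convert hinv.comp ih using 1
    ext x
    change x + (-(n : ℤ) - 1) • a = x + (-(n : ℤ)) • a + -a
    rw [sub_zsmul, one_zsmul, add_assoc]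

/-- For bounded continuous f the map g ↦ ∫ f(g + x) dμ is continuous and constant on the dense set
of multiples of a. With uniqueness of Haar measure this gives unique ergodicity of the rotation. -/
theorem isAddLeftInvariant_of_dense [FirstCountableTopology G] [HasOuterApproxClosed G] {a : G}
    (ha : DenseRange fun n : ℤ => n • a) {μ : Measure G} [IsFiniteMeasure μ]
    (h : MeasurePreserving (Homeomorph.addRight a) μ μ) : μ.IsAddLeftInvariant := by
  refine ⟨fun g => ?_⟩
  have hmeas : Measurable fun x : G => g + x := (continuous_const_add g).measurable
  have : IsFiniteMeasure (μ.map fun x => g + x) := Measure.isFiniteMeasure_map μ _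
  refine ext_of_forall_integral_eq_of_IsFiniteMeasure fun f => ?_
  rw [integral_map hmeas.aemeasurable f.continuous.aestronglyMeasurable]
  have hcont : Continuous fun g : G => ∫ x, f (g + x) ∂μ := by
    refine continuous_of_dominated (bound := fun _ => ‖f‖) (fun g => ?_) (fun g => ?_)
      (integrable_const _) (ae_of_all _ fun x => ?_)
    · exact (f.continuous.comp (continuous_const_add g)).aestronglyMeasurable
    · exact ae_of_all _ fun x => f.norm_coe_le_norm _
    · exact f.continuous.comp (continuous_add_const x)
  refine congrFun (ha.equalizer hcont (continuous_const (y := ∫ x, f x ∂μ)) (funext fun n => ?_)) g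
  have hn := measurePreserving_addRight_zsmul h n
  have hemb : MeasurableEmbedding fun x : G => x + n • a :=
    (Homeomorph.addRight (n • a)).measurableEmbedding
  simpa only [Function.comp_apply, add_comm] using hn.integral_comp hemb f

theorem exists_isUniqueInvariant_addRight [CompactSpace G] [T2Space G]
    [SecondCountableTopology G] [HasOuterApproxClosed G] {a : G}
    (ha : DenseRange fun n : ℤ => n • a) :
    ∃ μ : Measure G, IsUniqueInvariant (Homeomorph.addRight a) μ ∧ μ.IsAddLeftInvariant := by
  let K : TopologicalSpace.PositiveCompacts G := ⊤
  have hK : (K : Set G) = Set.univ := rfl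
  refine ⟨Measure.addHaarMeasure K, ⟨⟨?_⟩, ⟨?_, ?_⟩, fun μ' hμ' h => ?_⟩, inferInstance⟩
  · rw [← hK]
    exact Measure.addHaarMeasure_self
  · exact (Homeomorph.addRight a).continuous.measurable
  · exact map_add_right_eq_self _ a
  · have := isAddLeftInvariant_of_dense ha h
    rw [Measure.addHaarMeasure_unique μ' K, hK, measure_univ, one_smul]

end Rotation

/-- A factor map over a uniquely ergodic system that is injective over the complement of an
invariant null set is a measurable isomorphism. -/
theorem isMeasureIsoMap_of_subsingleton_fibres {X Y : Type} [TopologicalSpace X]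
    [TopologicalSpace Y] [CompactSpace X] [T2Space Y] {T : X ≃ₜ X} {S : Y ≃ₜ Y} {π : X → Y}
    (hπ : IsFactorMap T S π) [MeasurableSpace Y] [BorelSpace Y] {ν : Measure Y}
    (hν : IsUniqueInvariant S ν) {N : Set Y} (hN : MeasurableSet N) (hνN : ν N = 0)
    (hinv : ∀ y, y ∉ N → S y ∉ N) (hfib : ∀ x x', π x = π x' → π x ∉ N → x = x') :
    IsMeasureIsoMap T S π := by
  classical
  obtain rfl : ‹MeasurableSpace Y› = borel Y := BorelSpace.measurable_eq
  let _ : MeasurableSpace Y := borel Y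
  let _ : MeasurableSpace X := borel X
  have : BorelSpace X := ⟨rfl⟩
  obtain ⟨hcont, hsurj, heq⟩ := hπ
  obtain ⟨hprob, hpres, huniq⟩ := hν
  have hYne : Nonempty Y := by
    by_contra h
    have := not_nonempty_iff.mp h
    have h1 := hprob.measure_univ
    rw [Set.univ_eq_empty_iff.mpr this, measure_empty] at h1
    exact zero_ne_one h1
  obtain ⟨x₀⟩ : Nonempty X := ⟨(hsurj hYne.some).choose⟩
  have hπm : Measurable π := hcont.measurable
  -- Off N this is the inverse of π, so the preimage of a closed C is π(C) there, closed by
  -- compactness; the constant value on N is irrelevant.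
  let g : Y → X := fun y => if y ∈ N then x₀ else Function.surjInv hsurj y
  have hπg : ∀ y, y ∉ N → π (g y) = y := fun y hy => by
    simp only [g, if_neg hy]
    exact Function.surjInv_eq hsurj y
  have hgπ : ∀ x, π x ∉ N → g (π x) = x := fun x hx =>
    hfib _ _ (hπg _ hx) (by rwa [hπg _ hx])
  have hgm : Measurable g := by
    refine measurable_of_isClosed fun C hC => ?_
    have : g ⁻¹' C = (π '' C ∩ Nᶜ) ∪ (N ∩ {_y : Y | x₀ ∈ C}) := by
      ext y
      simp only [Set.mem_preimage, Set.mem_union, Set.mem_inter_iff, Set.mem_compl_iff,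
        Set.mem_ofPred_eq]
      by_cases hy : y ∈ N
      · simp [g, hy]
      · simp only [hy, not_false_eq_true, and_true, false_and, or_false]
        constructor
        · exact fun h => ⟨g y, h, hπg y hy⟩
        · rintro ⟨x, hx, rfl⟩
          rwa [hgπ x hy]
    rw [this]
    exact ((hcont.isClosedMap C hC).measurableSet.inter hN.compl).union
      (hN.inter (MeasurableSet.const _))
  have hae : ∀ᵐ y ∂ν, y ∉ N := measure_eq_zero_iff_ae_notMem.mp hνN
  have hae_πg : π ∘ g =ᵐ[ν] id := hae.mono fun y hy => hπg y hy
  have hmap : (ν.map g).map π = ν := by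
    rw [Measure.map_map hπm hgm, Measure.map_congr hae_πg, Measure.map_id]
  have hae' : ∀ μ' : Measure X, μ'.map π = ν → ∀ᵐ x ∂μ', g (π x) = x := fun μ' h => by
    have h2 : ∀ᵐ y ∂(μ'.map π), y ∉ N := by rwa [h]
    exact (ae_of_ae_map hπm.aemeasurable h2).mono hgπ
  refine ⟨ν.map g, ν, ⟨Measure.isProbabilityMeasure_map hgm.aemeasurable, ⟨T.continuous.measurable,
    ?_⟩, fun μ' hμ' hT => ?_⟩, ⟨hprob, hpres, huniq⟩, ⟨hπm, hmap⟩, g, hgm, hae' _ hmap,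
    hae.mono hπg⟩
  · have : T ∘ g =ᵐ[ν] g ∘ S := hae.mono fun y hy => by
      have h1 : π (T (g y)) = S y := by rw [heq, hπg y hy]
      have h2 := hgπ (T (g y)) (by rw [h1]; exact hinv y hy)
      rw [h1] at h2
      exact h2.symm
    rw [Measure.map_map T.continuous.measurable hgm, Measure.map_congr this,
      ← Measure.map_map hgm S.continuous.measurable, hpres.map_eq]
  -- Any invariant μ' projects to ν, and g ∘ π is the identity almost everywhere for it, so μ' is
  -- the image of ν under g.
  · have h1 : μ'.map π = ν := by
      refine huniq _ (Measure.isProbabilityMeasure_map hπm.aemeasurable)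
        ⟨S.continuous.measurable, ?_⟩
      rw [Measure.map_map S.continuous.measurable hπm,
        show S ∘ π = π ∘ T from funext fun x => (heq x).symm,
        ← Measure.map_map hπm T.continuous.measurable, hT.map_eq]
    rw [← h1, Measure.map_map hgm hπm]
    exact (Measure.map_id.symm.trans (Measure.map_congr ((hae' μ' h1).mono fun x hx => hx.symm)))

section Odometer

variable {c r : ℕ → ℕ}

theorem zsmul_odometerOne_apply (b : ℕ → ℕ) (n : ℤ) (i : ℕ) :
    (n • odometerOne b : odometer b).1 i = n := by
  change n • (1 : ZMod (b i)) = n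
  simp

theorem denseRange_zsmul_odometerOne (b : ℕ → ℕ) :
    DenseRange fun n : ℤ => n • odometerOne b := by
  intro x
  rw [closure_subtype]
  refine closure_mono ?_ x.2
  rintro _ ⟨n, rfl⟩
  exact ⟨n • odometerOne b, ⟨n, rfl⟩, funext fun i => by
    rw [zsmul_odometerOne_apply]; simp⟩

theorem eq_zero_of_forall_two_pow_dvd (hr : Tendsto r atTop atTop) {n : ℤ}
    (h : ∀ i, (2 ^ r i : ℤ) ∣ n) : n = 0 := by
  by_contra hn
  obtain ⟨i, hi⟩ := (hr.eventually_ge_atTop n.natAbs).exists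
  exact not_two_pow_dvd hn ((pow_dvd_pow 2 hi).trans (h i))

/-- The elements of the odometer whose `2`-adic component is `-j`. -/
def twoAdicFibre (c r : ℕ → ℕ) (j : ℤ) : Set (odometer (moduli c r)) :=
  {h | ∀ i, (2 ^ r i : ZMod (moduli c r i)) ∣ h.1 i + j}

theorem isClosed_twoAdicFibre (c r : ℕ → ℕ) (j : ℤ) : IsClosed (twoAdicFibre c r j) := by
  simp only [twoAdicFibre, Set.ofPred_forall]
  refine isClosed_iInter fun i => ?_
  have hcont : Continuous fun h : odometer (moduli c r) => h.1 i :=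
    (continuous_apply i).comp continuous_subtype_val
  exact (isClosed_discrete {a : ZMod (moduli c r i) |
    (2 ^ r i : ZMod (moduli c r i)) ∣ a + (j : ZMod (moduli c r i))}).preimage hcont

theorem preimage_twoAdicFibre (c r : ℕ → ℕ) (j k : ℤ) :
    (fun h => k • odometerOne (moduli c r) + h) ⁻¹' twoAdicFibre c r j =
      twoAdicFibre c r (j + k) := by
  ext h
  refine forall_congr' fun i => ?_
  change (2 ^ r i : ZMod (moduli c r i)) ∣
    (k • odometerOne (moduli c r) : odometer (moduli c r)).1 i + h.1 i + j ↔ _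
  rw [zsmul_odometerOne_apply]
  push_cast
  rw [show (k : ZMod (moduli c r i)) + h.1 i + j = h.1 i + (j + k) by ring]

theorem eq_of_mem_twoAdicFibre (hr : Tendsto r atTop atTop) {j k : ℤ} {h : odometer (moduli c r)}
    (hj : h ∈ twoAdicFibre c r j) (hk : h ∈ twoAdicFibre c r k) : j = k := by
  refine sub_eq_zero.mp (eq_zero_of_forall_two_pow_dvd hr fun i => ?_)
  rw [← two_pow_dvd_intCast_iff (m := c i)]
  have := dvd_sub (hj i) (hk i)
  rw [add_sub_add_left_eq_sub] at this
  push_cast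
  exact this

/-- The sets for different j are disjoint translates of one another; infinitely many of equal
measure fit into a probability space only if that measure is 0. -/
theorem measure_twoAdicFibre (hr : Tendsto r atTop atTop) [MeasurableSpace (odometer (moduli c r))]
    [BorelSpace (odometer (moduli c r))] (ν : Measure (odometer (moduli c r)))
    [IsProbabilityMeasure ν] [ν.IsAddLeftInvariant] (j : ℤ) : ν (twoAdicFibre c r j) = 0 := by
  have hconst : ∀ k, ν (twoAdicFibre c r k) = ν (twoAdicFibre c r 0) := fun k => by
    have := measure_preimage_add ν (k • odometerOne (moduli c r)) (twoAdicFibre c r 0)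
    rwa [preimage_twoAdicFibre, zero_add] at this
  have hsum := measure_iUnion (μ := ν) (f := twoAdicFibre c r)
    (fun k l hkl => Set.disjoint_left.mpr fun h hk hl => hkl (eq_of_mem_twoAdicFibre hr hk hl))
    fun k => (isClosed_twoAdicFibre c r k).measurableSet
  simp only [hconst] at hsum
  rw [hconst]
  by_contra hne
  rw [ENNReal.tsum_const_eq_top_of_ne_zero hne] at hsum
  exact measure_ne_top ν _ hsum

theorem isMeasureIsoMap_factorMap (hc : IsAdmissible c) (hr : Tendsto r atTop atTop) :
    IsMeasureIsoMap (subshiftHomeo (etaSeq c r)) (odometerRot (moduli c r))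
      (factorMap hc hr) := by
  have hne := hc.neZero_moduli r
  have := compactSpace_odometer hne
  have : SecondCountableTopology (odometer (moduli c r)) :=
    TopologicalSpace.Subtype.secondCountableTopology _
  have : TopologicalSpace.PseudoMetrizableSpace (odometer (moduli c r)) := inferInstance
  let _ : MeasurableSpace (odometer (moduli c r)) := borel _
  have : BorelSpace (odometer (moduli c r)) := ⟨rfl⟩
  obtain ⟨ν, hν, hνinv⟩ :=
    exists_isUniqueInvariant_addRight (denseRange_zsmul_odometerOne (moduli c r))
  have := hν.1
  refine isMeasureIsoMap_of_subsingleton_fibres (isFactorMap_factorMap hc hr) hν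
    (N := ⋃ j, twoAdicFibre c r j)
    (MeasurableSet.iUnion fun j => (isClosed_twoAdicFibre c r j).measurableSet)
    (measure_iUnion_null fun j => measure_twoAdicFibre hr ν j) (fun y hy hSy => ?_)
    (fun x x' hxx' hx => ?_)
  · obtain ⟨j, hj⟩ := Set.mem_iUnion.mp hSy
    refine hy (Set.mem_iUnion.mpr ⟨j + 1, ?_⟩)
    rw [← preimage_twoAdicFibre, Set.mem_preimage, one_zsmul, add_comm]
    exact hj
  · by_contra hne
    obtain ⟨j, hj⟩ := Function.ne_iff.mp (fun h => hne (Subtype.ext h))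
    exact hx (Set.mem_iUnion.mpr ⟨j, fun i => (residue_add_of_ne hc hr x.2 x'.2
      (fun i => congrFun (congrArg Subtype.val hxx') i) hj i).1⟩)

end Odometer

/-! ### The odometer as a product -/

section Product

variable {c r : ℕ → ℕ}

theorem continuous_toZModPow {p : ℕ} [Fact p.Prime] (n : ℕ) :
    Continuous (PadicInt.toZModPow (p := p) n) := by
  refine continuous_of_continuousAt_zero (PadicInt.toZModPow (p := p) n) ?_
  have hball : Metric.ball (0 : ℤ_[p]) ((p : ℝ) ^ (-(n : ℤ))) ∈ 𝓝 0 :=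
    Metric.ball_mem_nhds _ (zpow_pos (by exact_mod_cast (Fact.out : p.Prime).pos) _)
  have hev : PadicInt.toZModPow (p := p) n =ᶠ[𝓝 0] fun _ => 0 := by
    filter_upwards [hball] with x hx
    rw [← RingHom.mem_ker, PadicInt.ker_toZModPow, ← PadicInt.norm_le_pow_iff_mem_span_pow]
    exact (mem_ball_zero_iff.mp hx).le
  exact continuousAt_const.congr hev.symm

theorem toZModPow_eq_intCast {p : ℕ} [Fact p.Prime] {z : ℤ_[p]} {w : ℤ} {m n : ℕ} (hmn : m ≤ n)
    (h : PadicInt.toZModPow n z = w) : PadicInt.toZModPow m z = w := by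
  rw [← PadicInt.cast_toZModPow m n hmn, h]
  exact ZMod.cast_intCast (pow_dvd_pow p hmn) w

/-- The homomorphism `ℤ₂ × ∏ ℤ/c_i → ∏ ℤ/(2^{r_i} c_i)` given by the Chinese remainder theorem. -/
def crtHom (hc : IsAdmissible c) (r : ℕ → ℕ) :
    (ℤ_[2] × ∀ i, ZMod (c i)) →+* ∀ i, ZMod (moduli c r i) :=
  RingHom.pi fun i =>
    (ZMod.chineseRemainder (hc.coprime_two_pow (r i) i)).symm.toRingHom.comp
      (((PadicInt.toZModPow (r i)).comp (RingHom.fst _ _)).prod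
        ((Pi.evalRingHom _ i).comp (RingHom.snd _ _)))

theorem crtHom_apply_eq_iff (hc : IsAdmissible c) (x : ℤ_[2] × ∀ i, ZMod (c i)) (i : ℕ)
    (a : ZMod (moduli c r i)) :
    crtHom hc r x i = a ↔ (PadicInt.toZModPow (r i) x.1, x.2 i) =
      ZMod.chineseRemainder (hc.coprime_two_pow (r i) i) a :=
  (ZMod.chineseRemainder (hc.coprime_two_pow (r i) i)).toEquiv.symm_apply_eq

theorem continuous_crtHom (hc : IsAdmissible c) (r : ℕ → ℕ) : Continuous (crtHom hc r) := by
  refine continuous_pi fun i => ?_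
  have hcont : Continuous fun x : ℤ_[2] × ∀ i, ZMod (c i) =>
      (PadicInt.toZModPow (r i) x.1, x.2 i) :=
    ((continuous_toZModPow (r i)).comp continuous_fst).prodMk
      ((continuous_apply i).comp continuous_snd)
  exact (continuous_of_discreteTopology
    (f := (ZMod.chineseRemainder (hc.coprime_two_pow (r i) i)).symm)).comp hcont

theorem crtHom_injective (hc : IsAdmissible c) (hr : Tendsto r atTop atTop) :
    Function.Injective (crtHom hc r) := by
  intro x y hxy
  have h : ∀ i, (PadicInt.toZModPow (r i) x.1, x.2 i) = (PadicInt.toZModPow (r i) y.1, y.2 i) :=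
    fun i => (ZMod.chineseRemainder (hc.coprime_two_pow (r i) i)).symm.injective (congrFun hxy i)
  refine Prod.ext (PadicInt.ext_of_toZModPow.mp fun n => ?_)
    (funext fun i => congrArg Prod.snd (h i))
  obtain ⟨i, hi⟩ := (hr.eventually_ge_atTop n).exists
  rw [← PadicInt.cast_toZModPow n (r i) hi, ← PadicInt.cast_toZModPow n (r i) hi]
  exact congrArg _ (congrArg Prod.fst (h i))

/-- A basic neighbourhood constrains finitely many coordinates. One congruence modulo the largest
power of 2 among them, plus one modulo each c_i, yields an integer inside it. -/
theorem crtHom_mem_odometer (hc : IsAdmissible c) (r : ℕ → ℕ) (x : ℤ_[2] × ∀ i, ZMod (c i)) :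
    crtHom hc r x ∈ odometer (moduli c r) := by
  change crtHom hc r x ∈ closure _
  rw [mem_closure_iff]
  intro O hO hxO
  obtain ⟨I, u, hu, hIu⟩ := isOpen_pi_iff.mp hO _ hxO
  obtain ⟨w, hw⟩ := ZMod.intCast_surjective (PadicInt.toZModPow (I.sup r) x.1)
  choose a ha using fun i => ZMod.intCast_surjective (x.2 i)
  obtain ⟨n, hn, hn'⟩ := exists_modEq_forall_modEq c hc.coprime I (2 ^ I.sup r)
    (fun j _ => hc.coprime_two_pow _ j) w a
  refine ⟨_, hIu fun i hi => ?_, ⟨n, rfl⟩⟩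
  have : (Int.castAddHom (∀ i, ZMod (moduli c r i)) n) i = crtHom hc r x i := by
    symm
    rw [crtHom_apply_eq_iff]
    have h1 : (Int.castAddHom (∀ i, ZMod (moduli c r i)) n) i = (n : ZMod (moduli c r i)) := by
      simp
    rw [h1, map_intCast]
    refine Prod.ext ?_ ?_
    · have hwn : PadicInt.toZModPow (I.sup r) x.1 = n := by
        rw [← hw]
        exact ((ZMod.intCast_eq_intCast_iff _ _ _).mpr hn).symm
      exact toZModPow_eq_intCast (Finset.le_sup hi) hwn
    · rw [← ha i]
      exact ((ZMod.intCast_eq_intCast_iff _ _ _).mpr (hn' i hi)).symm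
  rw [this]
  exact (hu i hi).2

theorem exists_odometer_continuousAddEquiv (hc : IsAdmissible c) (hr : Tendsto r atTop atTop) :
    ∃ e : odometer (moduli c r) ≃ₜ+ (ℤ_[2] × ∀ i, ZMod (c i)),
      e (odometerOne (moduli c r)) = 1 := by
  have hne : ∀ i, NeZero (c i) := fun i => ⟨(hc.pos i).ne'⟩
  let f : (ℤ_[2] × ∀ i, ZMod (c i)) →+ odometer (moduli c r) :=
    (crtHom hc r).toAddMonoidHom.codRestrict _ (crtHom_mem_odometer hc r)
  have hf : Continuous f := (continuous_crtHom hc r).subtype_mk _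
  have hf1 : f 1 = odometerOne (moduli c r) := Subtype.ext (map_one (crtHom hc r))
  have hinj : Function.Injective f := fun x y h =>
    crtHom_injective hc hr (congrArg Subtype.val h)
  have hsurj : Function.Surjective f := by
    have hrange : IsClosed (Set.range f) := (isCompact_range hf).isClosed
    have hdense : DenseRange f := (denseRange_zsmul_odometerOne (moduli c r)).mono (by
      rintro _ ⟨n, rfl⟩
      exact ⟨n • 1, by rw [map_zsmul, hf1]⟩)
    exact Set.range_eq_univ.mp (hrange.closure_eq.symm.trans hdense.closure_eq)
  let E : (ℤ_[2] × ∀ i, ZMod (c i)) ≃+ odometer (moduli c r) :=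
    AddEquiv.ofBijective f ⟨hinj, hsurj⟩
  have hE : Continuous E.symm :=
    (Continuous.homeoOfEquivCompactToT2 (f := E.toEquiv) hf).symm.continuous
  exact ⟨{ E.symm with continuous_toFun := hE, continuous_invFun := hf },
    (AddEquiv.symm_apply_eq E).mpr hf1.symm⟩

end Product

/-! ### Automorphisms -/

section Automorphisms

variable {c r : ℕ → ℕ}

/-- Over `h` with `2`-adic component `0` and all other components nonzero there are points with
either value at `0`. -/
theorem exists_residue_eq (hc : IsAdmissible c) (hr : Tendsto r atTop atTop)
    {h : ∀ i, ZMod (moduli c r i)} (h2 : ∀ i, (2 ^ r i : ZMod (moduli c r i)) ∣ h i)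
    (h0 : ∀ i, h i ≠ 0) (v : Fin 2) :
    ∃ x : orbitClosure (etaSeq c r), (x : ℤ → Fin 2) 0 = v ∧
      ∀ i, residue (moduli c r i) (x : ℤ → Fin 2) = h i := by
  classical
  choose w hw using fun i => ZMod.intCast_surjective (h i)
  have hw2 : ∀ i, (2 ^ r i : ℤ) ∣ w i := fun i => by
    rw [← two_pow_dvd_intCast_iff (m := c i), hw]
    exact h2 i
  have hwc : ∀ i, ¬ (c i : ℤ) ∣ w i := fun i hi => h0 i (by
    rw [← hw i, ZMod.intCast_zmod_eq_zero_iff_dvd]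
    exact hc.b_dvd_iff.mpr ⟨by exact_mod_cast hw2 i, hi⟩)
  have hmod : ∀ {n : ℤ} {i : ℕ}, (2 ^ r i : ℤ) ∣ n → n ≡ w i [ZMOD c i] →
      (n : ZMod (moduli c r i)) = h i := fun {n i} hn hni => by
    rw [← hw i, ZMod.intCast_eq_intCast_iff]
    refine modEq_mul_of_coprime (hc.coprime_two_pow _ _) ?_ hni
    have h1 : n ≡ 0 [ZMOD (2 ^ r i : ℕ)] := Int.modEq_zero_iff_dvd.mpr (by exact_mod_cast hn)
    have h2 : w i ≡ 0 [ZMOD (2 ^ r i : ℕ)] := Int.modEq_zero_iff_dvd.mpr (by exact_mod_cast hw2 i)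
    exact h1.trans h2.symm
  -- By compactness it suffices to match finitely many residues by a shift of η. For the value 0,
  -- force b_k ∣ n for a spare k ∉ I. For the value 1, give n exact 2-adic valuation `I.sup r` and
  -- prescribe n ≡ w_i modulo c_i for all r_i up to it: larger r_i fail at the power of 2, the
  -- others at c_i.
  have hfin : ∀ I : Finset ℕ, ∃ n : ℤ, etaSeq c r n = v ∧
      ∀ i ∈ I, (n : ZMod (moduli c r i)) = h i := by
    intro I
    rcases (by revert v; decide : v = 0 ∨ v = 1) with rfl | rfl
    · obtain ⟨k, hk⟩ := Infinite.exists_notMem_finset I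
      obtain ⟨n, hn, hn'⟩ := exists_modEq_forall_modEq c hc.coprime (insert k I)
        (2 ^ (insert k I).sup r) (fun j _ => hc.coprime_two_pow _ j) 0
        (fun i => if i = k then 0 else w i)
      have hdvd : ∀ i ∈ insert k I, (2 ^ r i : ℤ) ∣ n := fun i hi =>
        (pow_dvd_pow 2 (Finset.le_sup hi)).trans (by exact_mod_cast Int.modEq_zero_iff_dvd.mp hn)
      refine ⟨n, etaSeq_eq_zero_iff.mpr ⟨k, hc.b_dvd_iff.mpr
        ⟨by exact_mod_cast hdvd k (by simp), ?_⟩⟩, fun i hi => ?_⟩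
      · have := hn' k (by simp)
        rw [if_pos rfl] at this
        exact Int.modEq_zero_iff_dvd.mp this
      · have := hn' i (by simp [hi])
        rw [if_neg (by rintro rfl; exact hk hi)] at this
        exact hmod (hdvd i (by simp [hi])) this
    · obtain ⟨J, hJ⟩ := exists_finset_lt hr (I.sup r + 1)
      obtain ⟨n, hn, hn'⟩ := exists_modEq_forall_modEq c hc.coprime J
        (2 ^ (I.sup r + 1)) (fun j _ => hc.coprime_two_pow _ j) (2 ^ I.sup r) w
      have hn2 : (2 ^ I.sup r : ℤ) ∣ n := by
        have h1 : n ≡ 2 ^ I.sup r [ZMOD (2 ^ I.sup r : ℤ)] :=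
          hn.of_dvd (by push_cast; exact pow_dvd_pow 2 (Nat.le_succ _))
        exact Int.modEq_zero_iff_dvd.mp (h1.trans (Int.modEq_zero_iff_dvd.mpr dvd_rfl))
      have hn3 : ¬ (2 ^ (I.sup r + 1) : ℤ) ∣ n := fun hdvd => by
        have h1 : (2 ^ I.sup r : ℤ) ≡ 0 [ZMOD (2 ^ (I.sup r + 1) : ℕ)] :=
          hn.symm.trans (Int.modEq_zero_iff_dvd.mpr (by exact_mod_cast hdvd))
        have h3 := Int.le_of_dvd (by positivity) (Int.modEq_zero_iff_dvd.mp h1)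
        push_cast at h3
        rw [pow_succ] at h3
        linarith [show (0 : ℤ) < 2 ^ I.sup r by positivity]
      refine ⟨n, etaSeq_eq_one_iff.mpr fun i hi => ?_, fun i hi => ?_⟩
      · obtain ⟨hi2, hic⟩ := hc.b_dvd_iff.mp hi
        have hiJ : i ∈ J := (hJ i).mpr (by
          by_contra hcon
          exact hn3 ((pow_dvd_pow 2 (not_lt.mp hcon)).trans (by exact_mod_cast hi2)))
        exact hwc i (Int.modEq_zero_iff_dvd.mp
          ((hn' i hiJ).symm.trans (Int.modEq_zero_iff_dvd.mpr hic)))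
      · exact hmod ((pow_dvd_pow 2 (Finset.le_sup hi)).trans hn2)
          (hn' i ((hJ i).mpr (Nat.lt_succ_of_le (Finset.le_sup hi))))
  have hcont0 : Continuous fun x : orbitClosure (etaSeq c r) => (x : ℤ → Fin 2) 0 :=
    (continuous_apply 0).comp continuous_subtype_val
  have hclosed : ∀ i, IsClosed {x : orbitClosure (etaSeq c r) |
      residue (moduli c r i) (x : ℤ → Fin 2) = h i} := fun i =>
    isClosed_eq (continuous_residue hc hr i) continuous_const
  obtain ⟨x, hx0, hx⟩ := (isClosed_eq hcont0 (continuous_const (y := v))).isCompact.inter_iInter_nonempty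
    _ hclosed fun I => by
      obtain ⟨n, hn0, hn⟩ := hfin I
      refine ⟨⟨shift n (etaSeq c r), subset_closure (shift_mem_orbit _ n)⟩, ?_,
        Set.mem_iInter₂.mpr fun i hi => (residue_shift_etaSeq hc hr i n).trans (hn i hi)⟩
      change etaSeq c r (n + 0) = v
      rwa [add_zero]
  exact ⟨x, hx0, fun i => Set.mem_iInter.mp hx i⟩

theorem zpow_subshiftHomeo_etaSeq (c r : ℕ → ℕ) (n : ℤ) :
    (subshiftHomeo (etaSeq c r) ^ n) ⟨etaSeq c r, subset_closure (self_mem_orbit _)⟩ =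
      ⟨shift n (etaSeq c r), subset_closure (shift_mem_orbit _ n)⟩ :=
  Subtype.ext (coe_subshiftHomeo_zpow _ _ _)

theorem subshiftHomeo_zpow_injective (hc : IsAdmissible c) (hr : Tendsto r atTop atTop) :
    Function.Injective fun n : ℤ => subshiftHomeo (etaSeq c r) ^ n := by
  intro m n hmn
  have h1 : shift m (etaSeq c r) = shift n (etaSeq c r) := by
    have := congrArg (fun f : orbitClosure (etaSeq c r) ≃ₜ orbitClosure (etaSeq c r) =>
      f ⟨etaSeq c r, subset_closure (self_mem_orbit _)⟩) hmn
    simp only [zpow_subshiftHomeo_etaSeq] at this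
    exact congrArg Subtype.val this
  refine sub_eq_zero.mp (eq_zero_of_forall_two_pow_dvd hr fun i => ?_)
  have h2 : (m : ZMod (moduli c r i)) = n := by
    rw [← residue_shift_etaSeq hc hr i m, h1, residue_shift_etaSeq hc hr i n]
  have h3 := ((ZMod.intCast_eq_intCast_iff _ _ _).mp h2).symm.dvd
  exact_mod_cast (hc.b_dvd_iff.mp h3).1

/-- An automorphism of the subshift acts on the residues by a translation. -/
theorem exists_residue_map_eq_add (hc : IsAdmissible c) (hr : Tendsto r atTop atTop)
    {f : orbitClosure (etaSeq c r) ≃ₜ orbitClosure (etaSeq c r)}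
    (hf : ∀ x, f (subshiftHomeo (etaSeq c r) x) = subshiftHomeo (etaSeq c r) (f x)) (i : ℕ) :
    ∃ g : ZMod (moduli c r i), ∀ x, residue (moduli c r i) (f x : ℤ → Fin 2) =
      residue (moduli c r i) (x : ℤ → Fin 2) + g := by
  refine ⟨residue (moduli c r i)
    (f ⟨etaSeq c r, subset_closure (self_mem_orbit _)⟩ : ℤ → Fin 2), fun x => ?_⟩
  have hcont := continuous_residue hc hr i
  refine forall_orbitClosure_of_isClosed
    (isClosed_eq (hcont.comp f.continuous) (hcont.add continuous_const)) (fun n => ?_) x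
  change residue (moduli c r i) (f ⟨shift n (etaSeq c r), _⟩ : ℤ → Fin 2) =
    residue (moduli c r i) (shift n (etaSeq c r)) + _
  rw [← zpow_subshiftHomeo_etaSeq, map_zpow_apply hf, coe_subshiftHomeo_zpow,
    residue_shift hc hr i (Subtype.property _), residue_shift_etaSeq hc hr, add_comm]

/-- If an automorphism translates the residues by `g`, the translation by `g` maps the positions of
the two-point fibres to such positions. -/
theorem exists_two_pow_dvd_add (hc : IsAdmissible c) (hr : Tendsto r atTop atTop)
    {f : orbitClosure (etaSeq c r) ≃ₜ orbitClosure (etaSeq c r)} {g : ∀ i, ZMod (moduli c r i)}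
    (hg : ∀ i x, residue (moduli c r i) (f x : ℤ → Fin 2) =
      residue (moduli c r i) (x : ℤ → Fin 2) + g i)
    {h : ∀ i, ZMod (moduli c r i)} (h2 : ∀ i, (2 ^ r i : ZMod (moduli c r i)) ∣ h i)
    (h0 : ∀ i, h i ≠ 0) :
    ∃ j : ℤ, ∀ i, (2 ^ r i : ZMod (moduli c r i)) ∣ h i + g i + j ∧ h i + g i + j ≠ 0 := by
  obtain ⟨x, hx0, hx⟩ := exists_residue_eq hc hr h2 h0 0
  obtain ⟨y, hy0, hy⟩ := exists_residue_eq hc hr h2 h0 1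
  -- The images of a two-point fibre are again distinct and share the residues h + g, so the
  -- position where they differ satisfies `residue_add_of_ne`.
  have hxy : f x ≠ f y := fun heq => by
    rw [f.injective heq, hy0] at hx0
    exact absurd hx0 (by decide)
  obtain ⟨j, hj⟩ := Function.ne_iff.mp (fun h => hxy (Subtype.ext h))
  refine ⟨j, fun i => ?_⟩
  have := residue_add_of_ne hc hr (f x).2 (f y).2 (fun i => by rw [hg, hg, hx, hy]) hj i
  rwa [hg, hx] at this

theorem mem_zpowers_of_commute (hc : IsAdmissible c) (hr : Tendsto r atTop atTop)
    {f : orbitClosure (etaSeq c r) ≃ₜ orbitClosure (etaSeq c r)}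
    (hf : ∀ x, f (subshiftHomeo (etaSeq c r) x) = subshiftHomeo (etaSeq c r) (f x)) :
    f ∈ Subgroup.zpowers (subshiftHomeo (etaSeq c r)) := by
  classical
  set T := subshiftHomeo (etaSeq c r) with hT
  choose g hg using exists_residue_map_eq_add hc hr hf
  have hpow0 : ∀ i, (2 ^ r i : ZMod (moduli c r i)) ≠ 0 := fun i h => by
    have h1 : ((2 ^ r i : ℤ) : ZMod (moduli c r i)) = 0 := by exact_mod_cast h
    rw [ZMod.intCast_zmod_eq_zero_iff_dvd] at h1
    have h3 := Int.le_of_dvd (by positivity) h1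
    push_cast at h3
    have h4 : (3 : ℤ) ≤ c i := by exact_mod_cast (Nat.le_add_left 3 i).trans (hc.add_three_le i)
    nlinarith [show (0 : ℤ) < 2 ^ r i by positivity]
  -- Testing f on one two-point fibre shows that its translation has an integer 2-adic part -j;
  -- composing with T^j removes it.
  obtain ⟨j, hj⟩ := exists_two_pow_dvd_add hc hr hg (h := fun i => 2 ^ r i) (fun i => dvd_rfl) hpow0
  have hgj : ∀ i, (2 ^ r i : ZMod (moduli c r i)) ∣ g i + j := fun i => by
    have := (hj i).1
    rwa [add_assoc, dvd_add_right dvd_rfl] at this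
  have hf' : ∀ x, (T ^ j * f) (T x) = T ((T ^ j * f) x) := fun x => by
    change (T ^ j) (f (T x)) = T ((T ^ j) (f x))
    rw [hf]
    change (T ^ j * T) (f x) = (T * T ^ j) (f x)
    rw [← zpow_add_one, ← zpow_one_add, add_comm]
  have hg' : ∀ i x, residue (moduli c r i) ((T ^ j * f) x : ℤ → Fin 2) =
      residue (moduli c r i) (x : ℤ → Fin 2) + (g i + j) := fun i x => by
    change residue (moduli c r i) ((T ^ j) (f x) : ℤ → Fin 2) = _
    rw [hT, coe_subshiftHomeo_zpow, residue_shift hc hr i (f x).2, hg, add_assoc]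
  have hzero : ∀ i, g i + j = 0 := by
    -- If the k-th component of the remaining translation were nonzero, a two-point fibre whose k-th
    -- coordinate is its negative would be sent to coordinate 0. The offset l is forced to be 0 by
    -- the 2-adic part, so this contradicts the nonvanishing condition.
    intro k
    by_contra hk
    obtain ⟨l, hl⟩ := exists_two_pow_dvd_add hc hr hg'
      (h := fun i => if i = k then -(g i + j) else 2 ^ r i)
      (fun i => by
        by_cases hik : i = k
        · simp only [if_pos hik]
          exact (dvd_neg).mpr (hgj i)
        · simp only [if_neg hik]
          exact dvd_rfl)
      (fun i => by
        by_cases hik : i = k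
        · simp only [if_pos hik]
          rw [hik]
          exact neg_ne_zero.mpr hk
        · simp only [if_neg hik]
          exact hpow0 i)
    have hl0 : l = 0 := eq_zero_of_forall_two_pow_dvd hr fun i => by
      rw [← two_pow_dvd_intCast_iff (m := c i)]
      have := (hl i).1
      by_cases hik : i = k
      · simpa only [if_pos hik, neg_add_cancel, zero_add] using this
      · simp only [if_neg hik] at this
        rwa [add_assoc, dvd_add_right dvd_rfl, dvd_add_right (hgj i)] at this
    refine (hl k).2 ?_
    rw [if_pos rfl, hl0]
    simp
  set e : orbitClosure (etaSeq c r) := ⟨etaSeq c r, subset_closure (self_mem_orbit _)⟩ with he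
  -- The fibre over 0 is a singleton: a difference could only occur at position 0, where the
  -- residues vanish instead of being nonzero. Fixing η, the map is the identity on its dense orbit.
  have hfix : (T ^ j * f) e = e := by
    by_contra hne
    obtain ⟨l, hl⟩ := Function.ne_iff.mp (fun h => hne (Subtype.ext h))
    have hres : ∀ i, residue (moduli c r i) ((T ^ j * f) e : ℤ → Fin 2) = 0 := fun i => by
      rw [hg', hzero, add_zero]
      exact residue_etaSeq hc hr i
    have hdiff := residue_add_of_ne hc hr ((T ^ j * f) e).2 e.2
      (fun i => (hres i).trans (residue_etaSeq hc hr i).symm) hl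
    have hl0 : l = 0 := eq_zero_of_forall_two_pow_dvd hr fun i => by
      rw [← two_pow_dvd_intCast_iff (m := c i)]
      have := (hdiff i).1
      rwa [hres, zero_add] at this
    refine (hdiff 0).2 ?_
    rw [hres, hl0]
    simp
  have hone : T ^ j * f = 1 := by
    ext1 x
    refine forall_orbitClosure_of_isClosed (D := {x | (T ^ j * f) x = x})
      (isClosed_eq (T ^ j * f).continuous continuous_id) (fun n => ?_) x
    change (T ^ j * f) ⟨shift n (etaSeq c r), _⟩ = ⟨shift n (etaSeq c r), _⟩
    rw [← zpow_subshiftHomeo_etaSeq, ← hT, ← he, map_zpow_apply hf', hfix]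
  refine ⟨-j, ?_⟩
  change T ^ (-j) = f
  rw [zpow_neg]
  exact inv_eq_of_mul_eq_one_right hone

theorem hasTrivialAut_etaSeq (hc : IsAdmissible c) (hr : Tendsto r atTop atTop) :
    HasTrivialAut (subshiftHomeo (etaSeq c r)) := by
  have heq : autGroup (subshiftHomeo (etaSeq c r)) =
      Subgroup.zpowers (subshiftHomeo (etaSeq c r)) := by
    refine le_antisymm (fun f hf => mem_zpowers_of_commute hc hr fun x => ?_) ?_
    · have := Subgroup.mem_centralizer_singleton_iff.mp hf
      exact (congrArg (fun k : orbitClosure (etaSeq c r) ≃ₜ orbitClosure (etaSeq c r) => k x) this)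
    · rintro _ ⟨n, rfl⟩
      refine Subgroup.mem_centralizer_singleton_iff.mpr ?_
      change _ ^ n * _ = _ * _ ^ n
      rw [← zpow_add_one, ← zpow_one_add, add_comm]
  have hinj : Function.Injective (zpowersHom _ (subshiftHomeo (etaSeq c r))) := fun m n h =>
    subshiftHomeo_zpow_injective hc hr h
  have hrange : (zpowersHom _ (subshiftHomeo (etaSeq c r))).range =
      autGroup (subshiftHomeo (etaSeq c r)) := by
    rw [heq]
    exact SetLike.ext fun f => Iff.rfl
  exact ⟨heq, ⟨((MonoidHom.ofInjective hinj).trans (MulEquiv.subgroupCongr hrange)).symm⟩⟩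

end Automorphisms

end BFree

end

open BFree in
theorem mainTheorem4 (c : ℕ → ℕ) (hc : IsAdmissible c) :
    -- the dynamics of the shifts, for all exponents `r_i → ∞`
    (∀ r : ℕ → ℕ, Tendsto r atTop atTop →
      IsRegularToeplitz (etaSeq c r) ∧
      IsMinimal (subshiftHomeo (etaSeq c r)) ∧
      topEntropy (subshiftHomeo (etaSeq c r)) = 0 ∧
      (∀ ε : ℝ, 0 < ε → covNum (orbit (etaSeq c r)) ε ≠ ⊤ ∧
        covNum (orbitClosure (etaSeq c r)) ε ≠ ⊤) ∧
      -- an isomorphic extension of the MEF, and the MEF is the odometer of `𝓑`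
      (∃ π : orbitClosure (etaSeq c r) → odometer (fun i => 2 ^ r i * c i),
        IsMEF (subshiftHomeo (etaSeq c r)) (odometerRot fun i => 2 ^ r i * c i) π ∧
        IsMeasureIsoMap (subshiftHomeo (etaSeq c r)) (odometerRot fun i => 2 ^ r i * c i) π) ∧
      -- which does not depend on `r`
      (∃ e : odometer (fun i => 2 ^ r i * c i) ≃ₜ+ (ℤ_[2] × ∀ i, ZMod (c i)),
        e (odometerOne fun i => 2 ^ r i * c i) = 1) ∧
      HasTrivialAut (subshiftHomeo (etaSeq c r))) ∧
    (SlowGrowth c →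
      -- a) `r_i = i`
      (HasAmorphicComplexity (orbit (etaSeq c linExp)) ⊤ ∧
        HasAmorphicComplexity (orbitClosure (etaSeq c linExp)) ⊤) ∧
      -- b) `r_i = [κ log₂(c₁ ⋯ c_i)]`
      (∀ κ : ℝ, 0 < κ →
        HasAmorphicComplexity (orbit (etaSeq c (logExp c κ))) (((1 + κ) / κ : ℝ) : EReal) ∧
        HasAmorphicComplexity (orbitClosure (etaSeq c (logExp c κ)))
          (((1 + κ) / κ : ℝ) : EReal)) ∧
      -- pairwise inequivalence
      (∀ c' : ℕ → ℕ, IsAdmissible c' → SlowGrowth c' →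
        (∀ κ : ℝ, 0 < κ →
          ¬ ScaleEquiv (covNum (orbit (etaSeq c linExp)))
            (covNum (orbit (etaSeq c' (logExp c' κ)))) ∧
          ¬ BlockCodeEquiv (etaSeq c linExp) (etaSeq c' (logExp c' κ)) ∧
          ¬ Conjugate (subshiftHomeo (etaSeq c linExp))
            (subshiftHomeo (etaSeq c' (logExp c' κ)))) ∧
        (∀ κ κ' : ℝ, 0 < κ → 0 < κ' → κ ≠ κ' →
          ¬ ScaleEquiv (covNum (orbit (etaSeq c (logExp c κ))))
            (covNum (orbit (etaSeq c' (logExp c' κ')))) ∧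
          ¬ BlockCodeEquiv (etaSeq c (logExp c κ)) (etaSeq c' (logExp c' κ')) ∧
          ¬ Conjugate (subshiftHomeo (etaSeq c (logExp c κ)))
            (subshiftHomeo (etaSeq c' (logExp c' κ')))))) := by
  refine ⟨fun r hr => ⟨isRegularToeplitz_etaSeq hc hr, (isToeplitz_etaSeq hc hr).isMinimal,
    topEntropy_etaSeq hc hr, fun ε hε => ⟨?_, ?_⟩, ⟨factorMap hc hr, isMEF_factorMap hc hr,
    isMeasureIsoMap_factorMap hc hr⟩, exists_odometer_continuousAddEquiv hc hr,
    hasTrivialAut_etaSeq hc hr⟩, fun hs => ?_⟩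
  · exact covNum_ne_top hc hr subset_rfl (orbit_subset_orbitClosure _) hε
  · exact covNum_ne_top hc hr (orbit_subset_orbitClosure _) subset_rfl hε
  have hlin : HasAmorphicComplexity (orbit (etaSeq c linExp)) ⊤ ∧
      HasAmorphicComplexity (orbitClosure (etaSeq c linExp)) ⊤ :=
    ⟨hasAmorphicComplexity_top_linExp hc hs subset_rfl,
      hasAmorphicComplexity_top_linExp hc hs (orbit_subset_orbitClosure _)⟩
  have hlog : ∀ c : ℕ → ℕ, IsAdmissible c → SlowGrowth c → ∀ κ : ℝ, 0 < κ →
      HasAmorphicComplexity (orbit (etaSeq c (logExp c κ))) (((1 + κ) / κ : ℝ) : EReal) ∧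
      HasAmorphicComplexity (orbitClosure (etaSeq c (logExp c κ)))
        (((1 + κ) / κ : ℝ) : EReal) := fun c hc hs κ hκ =>
    ⟨hasAmorphicComplexity_logExp hc hs hκ subset_rfl (orbit_subset_orbitClosure _),
      hasAmorphicComplexity_logExp hc hs hκ (orbit_subset_orbitClosure _) subset_rfl⟩
  refine ⟨hlin, hlog c hc hs, fun c' hc' hs' => ⟨fun κ hκ => ?_, fun κ κ' hκ hκ' hne => ?_⟩⟩
  · exact inequivalent_of_amorphicComplexity_ne (EReal.coe_ne_top _).symm hlin
      (hlog c' hc' hs' κ hκ)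
  · refine inequivalent_of_amorphicComplexity_ne (fun h => hne ?_) (hlog c hc hs κ hκ)
      (hlog c' hc' hs' κ' hκ')
    have h1 : (1 + κ) / κ = (1 + κ') / κ' := by exact_mod_cast h
    field_simp at h1
    linarith
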